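/- Let $d\ge 0$. Write $\langle u,h\rangle$ for the pairing of $u\in\mathcal S'$ with $h\in\mathcal S$, conjugate-linear in $h$ and extending $\int u\,\overline h$; for $z=(x,\omega)\in\mathbb R^{2n}$ let $\pi(z)g(t)=e^{2\pi i\omega\cdot t}g(t-x)$ and $V_gf(z)=\langle f,\pi(z)g\rangle$ for $f\in\mathcal S'(\mathbb R^n)$, $g\in\mathcal S(\mathbb R^n)$. For a positive measurable weight $m$ on $\mathbb R^{2n}$, a nonzero window $g\in\mathcal S(\mathbb R^n)$ and $1\le p,q\le\infty$, let $M^{p,q}_m(\mathbb R^n)$ be the set of all $f\in\mathcal S'(\mathbb R^n)$ for which $$\|f\|_{M^{p,q}_m}=\Big(\int_{\mathbb R^n}\Big(\int_{\mathbb R^n}|V_gf(x,\omega)|^p\,m(x,\omega)^p\,dx\Big)^{q/p}d\omega\Big)^{1/q}$$ is finite, with the usual modifications for $p=\infty$ or $q=\infty$. Let $v$ be an admissible weight on $\mathbb R^{2d}$: continuous, non-negative, even in each coordinate, $v(0)=1$, $v(w+z)\le v(w)v(z)$, and $\lim_{n\to\infty}v(nz)^{1/n}=1$ for every $z$. Let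 $m\in\mathcal M_v(\mathbb R^{2d})$, that is, $m$ is a positive measurable function with $m(z_1+z_2)\le C\,v(z_1)\,m(z_2)$ for all $z_1,z_2$ and some constant $C\ge 0$; assume moreover that $m\ge1$ everywhere, or that $m(z)\ge c\,(1+|z|^2)^{-N/2}$ for all $z$, with some $c>0$ and $N\in\mathbb N$. Let $J(z_1,z_2)=(z_2,-z_1)$ on $\mathbb R^{2d}$, and let $1\otimes v\circ J^{-1}$ be the weight $(z,\zeta)\mapsto v(J^{-1}\zeta)$ on $\mathbb R^{4d}$. Measure $M^{p,q}_m(\mathbb R^d)$ with a fixed nonzero window $g\in\mathcal S(\mathbb R^d)$ such that $V_gg\in L^1_v(\mathbb R^{2d})$ (for polynomially bounded $v$ every nonzero $g\in\mathcal S$ qualifies, and a Gaussian always does), and measure $M^{\infty,1}_{1\otimes v\circ J^{-1}}(\mathbb R^{2d})$ with a fixed nonzero window $G\in\mathcal S(\mathbb R^{2d})$. For $\tau\in[0,1]$ and $\sigma\in\mathcal S'(\mathbb R^{2d})$, let $\mathrm{Op}_\tau(\sigma):\mathcal S(\mathbb R^d)\to\mathcal S'(\mathbb R^d)$ be given by $\langle\mathrm{Op}_\tau(\sigma)f,h\rangle=\langle\sigma,W_\tau(h,f)\rangle$,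 where $$W_\tau(h,f)(x,\omega)=\int_{\mathbb R^d}e^{-2\pi iy\cdot\omega}\,h(x+\tau y)\,\overline{f(x-(1-\tau)y)}\,dy .$$ Then for every $\tau\in[0,1]$ there is a constant $C_\tau>0$ (depending on $\tau$, $d$, $v$, $m$ and the windows, but not on $p$, $q$, $\sigma$) such that for all $1\le p,q\le\infty$ and all $\sigma\in M^{\infty,1}_{1\otimes v\circ J^{-1}}(\mathbb R^{2d})$ the operator $\mathrm{Op}_\tau(\sigma)$ is bounded on $M^{p,q}_m(\mathbb R^d)$ with $$\|\mathrm{Op}_\tau(\sigma)f\|_{M^{p,q}_m}\le C_\tau\,\|\sigma\|_{M^{\infty,1}_{1\otimes v\circ J^{-1}}}\,\|f\|_{M^{p,q}_m}\qquad (f\in M^{p,q}_m(\mathbb R^d)).$$ Here $\mathrm{Op}_\tau(\sigma)$ on $M^{p,q}_m(\mathbb R^d)$ is understood as a linear operator on $M^{p,q}_m(\mathbb R^d)$ that coincides with the above on $\mathcal S(\mathbb R^d)\cap M^{p,q}_m(\mathbb R^d)$ and is sequentially continuous, on norm-bounded subsets of $M^{p,q}_m(\mathbb R^d)$, for the weak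 topology of $\mathcal S'(\mathbb R^d)$. -/

import Mathlib

open MeasureTheory SchwartzMap Filter Topology
open scoped FourierTransform InnerProductSpace ENNReal NNReal ContDiff

set_option linter.unusedSectionVars false
namespace TauPsiDO

/-- The phase space `E × E` with its Euclidean structure. -/
abbrev Phase (E : Type*) := WithLp 2 (E × E)

section General

variable {E : Type} [NormedAddCommGroup E] [InnerProductSpace ℝ E]

theorem norm_le_add (z : Phase E) : ‖z‖ ≤ ‖z.fst‖ + ‖z.snd‖ := by
  rw [WithLp.prod_norm_eq_of_L2]
  apply Real.sqrt_le_iff.2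
  constructor
  · positivity
  · nlinarith [norm_nonneg z.fst, norm_nonneg z.snd]

theorem fourierChar_hasTemperateGrowth :
    (fun s : ℝ => ((𝐞 s : Circle) : ℂ)).HasTemperateGrowth := by
  have hc : ContDiff ℝ ∞ (fun s : ℝ => ((𝐞 s : Circle) : ℂ)) := by
    have e : (fun s : ℝ => ((𝐞 s : Circle) : ℂ))
        = fun s : ℝ => Complex.exp ((2 * Real.pi * Complex.I) * Complex.ofRealCLM s) := by
      funext s
      rw [Real.fourierChar_apply, Complex.ofRealCLM_apply]
      congr 1
      push_cast
      ring
    rw [e]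
    exact (contDiff_const.mul Complex.ofRealCLM.contDiff).cexp
  refine ⟨hc, fun n => ⟨0, ‖(2 * Real.pi * Complex.I : ℂ)‖ ^ n, fun x => ?_⟩⟩
  rw [norm_iteratedFDeriv_eq_norm_iteratedDeriv]
  have h : ∀ n : ℕ, iteratedDeriv n (fun s : ℝ => ((𝐞 s : Circle) : ℂ))
      = fun s => (2 * Real.pi * Complex.I : ℂ) ^ n * (𝐞 s : Circle) := by
    intro n
    induction n with
    | zero => simp
    | succ n ih =>
      rw [iteratedDeriv_succ, ih]
      funext s
      rw [((Real.hasDerivAt_fourierChar s).const_mul _).deriv]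
      ring
  rw [h, norm_mul, norm_pow, Circle.norm_coe]
  simp

theorem character_hasTemperateGrowth (w : E) :
    (fun t : E => ((𝐞 ⟪w, t⟫_ℝ : Circle) : ℂ)).HasTemperateGrowth :=
  fourierChar_hasTemperateGrowth.comp (Function.hasTemperateGrowth_inner_right w)

/-- `y ↦ (0, y)`. -/
noncomputable def inrL : E →L[ℝ] Phase E :=
  (WithLp.prodContinuousLinearEquiv 2 ℝ E E).symm.toContinuousLinearMap ∘L
    ContinuousLinearMap.inr ℝ E E

/-- `(x, ω) ↦ (x, 0)`. -/
noncomputable def projL : Phase E →L[ℝ] Phase E :=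
  (WithLp.prodContinuousLinearEquiv 2 ℝ E E).symm.toContinuousLinearMap ∘L
    ContinuousLinearMap.inl ℝ E E ∘L WithLp.fstL 2 ℝ E E

theorem inrL_apply (y : E) : inrL y = WithLp.toLp 2 ((0 : E), y) := rfl
theorem projL_apply (z : Phase E) : projL z = WithLp.toLp 2 (z.fst, (0 : E)) := rfl

theorem norm_inrL_le : ‖(inrL : E →L[ℝ] Phase E)‖ ≤ 1 := by
  refine ContinuousLinearMap.opNorm_le_bound _ zero_le_one fun y => ?_
  rw [inrL_apply, WithLp.prod_norm_eq_of_L2]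
  simp

variable {V : Type*} [NormedAddCommGroup V] [NormedSpace ℝ V] [NormedSpace ℂ V]
  [IsScalarTower ℝ ℂ V]

section Meas
variable [FiniteDimensional ℝ E] [MeasurableSpace E] [BorelSpace E]

/-- Partial Fourier transform in the second variable. -/
noncomputable def pft (F : 𝓢(Phase E, V)) (z : Phase E) : V :=
  ∫ y : E, ((𝐞 (-⟪y, z.snd⟫_ℝ) : Circle) : ℂ) • F (WithLp.toLp 2 (z.fst, y))

noncomputable def sndPairing : Phase E →L[ℝ] Phase E →L[ℝ] ℝ :=
  (innerSL ℝ).bilinearComp (WithLp.sndL 2 ℝ E E) (WithLp.sndL 2 ℝ E E)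

variable (E V) in
noncomputable def pftDeriv : 𝓢(Phase E, V) →L[ℝ] 𝓢(Phase E, Phase E →L[ℝ] V) :=
  (postcompCLM ((ContinuousLinearMap.compL ℝ (Phase E) (Phase E) V).flip projL)) ∘L
      (fderivCLM ℝ (Phase E) V)
    + (postcompCLM (ContinuousLinearMap.lsmul ℝ ℂ (-(2 * Real.pi * Complex.I)))) ∘L
      (smulRightCLM ℝ V sndPairing)

theorem pftDeriv_apply (F : 𝓢(Phase E, V)) (p z : Phase E) :
    pftDeriv E V F p z = fderiv ℝ F p (projL z)
      + (-(2 * Real.pi * Complex.I) : ℂ) • (⟪p.snd, z.snd⟫_ℝ • F p) := by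
  simp [pftDeriv, sndPairing]

variable (E) in
noncomputable def weightPower : ℕ := (volume : Measure E).integrablePower

noncomputable def schwartzBound (F : 𝓢(Phase E, V)) (k l : ℕ) : ℝ :=
  2 ^ (k + weightPower E)
        * ((Finset.Iic (k + weightPower E, l)).sup (schwartzSeminormFamily ℝ (Phase E) V)) F

theorem one_add_bound (F : 𝓢(Phase E, V)) (k l j : ℕ) (hj : j ≤ l) (x y : E) :
    (1 + ‖x‖) ^ k * ‖iteratedFDeriv ℝ j F (WithLp.toLp 2 (x, y))‖ ≤
      schwartzBound F k l * (1 + ‖y‖) ^ (-(weightPower E : ℝ)) := by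
  rw [schwartzBound]
  set M := weightPower E
  have h := SchwartzMap.one_add_le_sup_seminorm_apply (𝕜 := ℝ) (m := (k + M, l)) le_rfl hj F
    (WithLp.toLp 2 (x, y))
  have hx : ‖x‖ ≤ ‖WithLp.toLp 2 (x, y)‖ := WithLp.norm_fst_le E (WithLp.toLp 2 (x, y))
  have hy : ‖y‖ ≤ ‖WithLp.toLp 2 (x, y)‖ := WithLp.norm_snd_le E (WithLp.toLp 2 (x, y))
  rw [Real.rpow_neg (by positivity), Real.rpow_natCast, ← div_eq_mul_inv,
    le_div_iff₀ (by positivity)]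
  refine le_trans ?_ h
  calc _ = (1 + ‖x‖) ^ k * (1 + ‖y‖) ^ M * ‖iteratedFDeriv ℝ j F (WithLp.toLp 2 (x, y))‖ := by
        ring
    _ ≤ (1 + ‖WithLp.toLp 2 (x, y)‖) ^ k * (1 + ‖WithLp.toLp 2 (x, y)‖) ^ M
          * ‖iteratedFDeriv ℝ j F (WithLp.toLp 2 (x, y))‖ := by gcongr
    _ = _ := by rw [← pow_add]

theorem continuous_slice (F : 𝓢(Phase E, V)) (x : E) :
    Continuous fun y : E => F (WithLp.toLp 2 (x, y)) :=
  F.continuous.comp (by fun_prop)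

theorem iteratedFDeriv_slice_le (F : 𝓢(Phase E, V)) (x y : E) (j : ℕ) :
    ‖iteratedFDeriv ℝ j (fun y : E => F (WithLp.toLp 2 (x, y))) y‖
      ≤ ‖iteratedFDeriv ℝ j F (WithLp.toLp 2 (x, y))‖ := by
  have h : (fun y : E => F (WithLp.toLp 2 (x, y)))
      = (fun p => F (p + WithLp.toLp 2 (x, (0 : E)))) ∘ inrL := by
    funext y
    simp only [Function.comp, inrL_apply, ← WithLp.toLp_add]
    simp
  have hs : ContDiff ℝ ∞ (fun p => F (p + WithLp.toLp 2 (x, (0 : E)))) :=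
    (F.smooth ⊤).comp (contDiff_id.add contDiff_const)
  rw [h, ContinuousLinearMap.iteratedFDeriv_comp_right inrL hs y (mod_cast le_top),
    iteratedFDeriv_comp_add_right]
  refine (ContinuousMultilinearMap.norm_compContinuousLinearMap_le _ _).trans ?_
  have : inrL y + WithLp.toLp 2 (x, (0 : E)) = WithLp.toLp 2 (x, y) := by
    simp only [inrL_apply, ← WithLp.toLp_add]
    simp
  rw [this]
  refine mul_le_of_le_one_right (norm_nonneg _) ?_
  exact Finset.prod_le_one (fun _ _ => norm_nonneg _) fun _ _ => norm_inrL_le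

theorem integrable_one_add :
    Integrable fun y : E => (1 + ‖y‖) ^ (-(weightPower E : ℝ)) :=
  Measure.integrable_pow_neg_integrablePower volume

theorem integrable_slice_deriv (F : 𝓢(Phase E, V)) (x : E) (j : ℕ) :
    Integrable fun y : E => ‖iteratedFDeriv ℝ j (fun y : E => F (WithLp.toLp 2 (x, y))) y‖ := by
  have hs : ContDiff ℝ ∞ (fun y : E => F (WithLp.toLp 2 (x, y))) :=
    (F.smooth ⊤).comp (by
      have : (fun y : E => WithLp.toLp 2 (x, y))
        = fun y => inrL y + WithLp.toLp 2 (x, (0 : E)) := by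
          funext y; simp only [inrL_apply, ← WithLp.toLp_add]; simp
      rw [this]
      fun_prop)
  refine (integrable_one_add.const_mul (schwartzBound F 0 j)).mono'
    (hs.continuous_iteratedFDeriv (mod_cast le_top)).norm.aestronglyMeasurable
    (.of_forall fun y => ?_)
  rw [norm_norm]
  refine (iteratedFDeriv_slice_le F x y j).trans ?_
  simpa using one_add_bound F 0 j j le_rfl x y

theorem pft_decay (k : ℕ) :
    ∃ (s : Finset (ℕ × ℕ)) (C : ℝ), 0 ≤ C ∧ ∀ (F : 𝓢(Phase E, V)) (z : Phase E),
      ‖z‖ ^ k * ‖pft F z‖ ≤ C * (s.sup (schwartzSeminormFamily ℝ (Phase E) V)) F := by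
  obtain rfl : ‹NormedSpace ℝ V› = NormedSpace.complexToReal := by
    ext r v
    exact (IsScalarTower.algebraMap_smul ℂ r v).symm
  set M := weightPower E with hM
  set I := ∫ y : E, (1 + ‖y‖) ^ (-(weightPower E : ℝ)) with hI
  have hI0 : 0 ≤ I := integral_nonneg fun y => by positivity
  refine ⟨Finset.Iic (k + M, k), 2 ^ (k - 1) * (1 + 2 ^ k * (k + 1)) * 2 ^ (k + M) * I,
    by positivity, fun F z => ?_⟩
  set S := ((Finset.Iic (k + M, k)).sup (schwartzSeminormFamily ℝ (Phase E) V)) F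
  have hS : 0 ≤ S := apply_nonneg _ _
  have hx : ‖z.fst‖ ^ k * ‖pft F z‖ ≤ 2 ^ (k + M) * S * I := by
    calc ‖z.fst‖ ^ k * ‖pft F z‖
        ≤ ‖z.fst‖ ^ k * ∫ y : E, ‖F (WithLp.toLp 2 (z.fst, y))‖ := by
          gcongr
          refine (norm_integral_le_integral_norm _).trans (le_of_eq ?_)
          simp only [norm_smul, Circle.norm_coe, one_mul]
      _ = ∫ y : E, ‖z.fst‖ ^ k * ‖F (WithLp.toLp 2 (z.fst, y))‖ := by
          rw [integral_const_mul]
      _ ≤ ∫ y : E, 2 ^ (k + M) * S * (1 + ‖y‖) ^ (-(M : ℝ)) := by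
          refine integral_mono_of_nonneg (.of_forall fun y => by positivity)
            (integrable_one_add.const_mul _) (.of_forall fun y => ?_)
          have h := one_add_bound F k k 0 (Nat.zero_le _) z.fst y
          rw [norm_iteratedFDeriv_zero] at h
          refine le_trans ?_ h
          dsimp only
          gcongr
          linarith [norm_nonneg z.fst]
      _ = _ := by rw [integral_const_mul]
  have hw : ‖z.snd‖ ^ k * ‖pft F z‖ ≤ 2 ^ k * (k + 1) * (2 ^ (k + M) * S * I) := by
    set h : E → V := fun y => F (WithLp.toLp 2 (z.fst, y)) with hh
    have hs : ContDiff ℝ ∞ h :=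
      (F.smooth ⊤).comp (by
        have : (fun y : E => WithLp.toLp 2 (z.fst, y))
          = fun y => inrL y + WithLp.toLp 2 (z.fst, (0 : E)) := by
            funext y; simp only [inrL_apply, ← WithLp.toLp_add]; simp
        rw [this]
        fun_prop)
    have e : pft F z = 𝓕 h z.snd := by
      rw [Real.fourier_eq]; rfl
    have key := Real.pow_mul_norm_iteratedFDeriv_fourier_le (K := 0) (N := ⊤) hs
      (fun k' n hk' _ => by
        obtain rfl : k' = 0 := by exact_mod_cast nonpos_iff_eq_zero.1 hk'
        simp only [pow_zero, one_mul]
        exact integrable_slice_deriv F z.fst n) (k := 0) (n := k) le_rfl le_top z.snd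
    rw [norm_iteratedFDeriv_zero] at key
    rw [e]
    refine key.trans ?_
    have hb : ∀ p ∈ Finset.range (0 + 1) ×ˢ Finset.range (k + 1),
        ∫ v : E, ‖v‖ ^ p.1 * ‖iteratedFDeriv ℝ p.2 h v‖ ≤ 2 ^ (k + M) * S * I := by
      intro p hp
      simp only [zero_add, Finset.mem_product, Finset.mem_range, Nat.lt_one_iff] at hp
      rw [hp.1, hI, ← integral_const_mul]
      refine integral_mono_of_nonneg (.of_forall fun y => by positivity)
            (integrable_one_add.const_mul _) (.of_forall fun y => ?_)
      dsimp only
      rw [pow_zero, one_mul]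
      refine (iteratedFDeriv_slice_le F z.fst y p.2).trans ?_
      refine le_trans ?_ (one_add_bound F k k p.2 (by omega) z.fst y)
      exact le_mul_of_one_le_left (norm_nonneg _)
        (one_le_pow₀ (by linarith [norm_nonneg z.fst]))
    calc _ ≤ (2 * Real.pi) ^ 0 * (2 * ((0 : ℕ) : ℝ) + 2) ^ k *
        ∑ p ∈ Finset.range (0 + 1) ×ˢ Finset.range (k + 1), 2 ^ (k + M) * S * I := by
          gcongr with p hp
          exact hb p hp
      _ = _ := by simp; ring
  calc ‖z‖ ^ k * ‖pft F z‖ ≤ (‖z.fst‖ + ‖z.snd‖) ^ k * ‖pft F z‖ := by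
        gcongr; exact norm_le_add z
    _ ≤ (2 ^ (k - 1) * (‖z.fst‖ ^ k + ‖z.snd‖ ^ k)) * ‖pft F z‖ := by
        gcongr; exact add_pow_le (norm_nonneg _) (norm_nonneg _) k
    _ = 2 ^ (k - 1) * (‖z.fst‖ ^ k * ‖pft F z‖ + ‖z.snd‖ ^ k * ‖pft F z‖) := by ring
    _ ≤ 2 ^ (k - 1) * (2 ^ (k + M) * S * I + 2 ^ k * (k + 1) * (2 ^ (k + M) * S * I)) := by
        gcongr
    _ = _ := by ring

theorem integrable_integrand (F : 𝓢(Phase E, V)) (z : Phase E) :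
    Integrable fun y : E => ((𝐞 (-⟪y, z.snd⟫_ℝ) : Circle) : ℂ) • F (WithLp.toLp 2 (z.fst, y)) := by
  have hc : Continuous fun y : E =>
      ((𝐞 (-⟪y, z.snd⟫_ℝ) : Circle) : ℂ) • F (WithLp.toLp 2 (z.fst, y)) := by
    have := continuous_slice F z.fst
    have h2 : Continuous fun y : E => ((𝐞 (-⟪y, z.snd⟫_ℝ) : Circle) : ℂ) := by fun_prop
    exact h2.smul this
  refine (integrable_one_add.const_mul (schwartzBound F 0 0)).mono' hc.aestronglyMeasurable (.of_forall fun y => ?_)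
  rw [norm_smul, Circle.norm_coe, one_mul]
  simpa using one_add_bound F 0 0 0 le_rfl z.fst y

theorem hasFDerivAt_integrand (F : 𝓢(Phase E, V)) (y : E) (z : Phase E) :
    HasFDerivAt (fun z : Phase E => ((𝐞 (-⟪y, z.snd⟫_ℝ) : Circle) : ℂ)
        • F (WithLp.toLp 2 (z.fst, y)))
      (((𝐞 (-⟪y, z.snd⟫_ℝ) : Circle) : ℂ) • pftDeriv E V F (WithLp.toLp 2 (z.fst, y))) z := by
  have hL := Real.hasFDerivAt_fourierChar_neg_bilinear_right
    ((innerSL ℝ).bilinearComp (ContinuousLinearMap.id ℝ E) (WithLp.sndL 2 ℝ E E)) y z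
  have hA : HasFDerivAt (fun z : Phase E => WithLp.toLp 2 (z.fst, y)) projL z := by
    have : (fun z : Phase E => WithLp.toLp 2 (z.fst, y)) = fun z => projL z + inrL y := by
      funext z; simp only [inrL_apply, projL_apply, ← WithLp.toLp_add]; simp
    rw [this]
    exact projL.hasFDerivAt.add_const _
  have hF : HasFDerivAt (fun z : Phase E => F (WithLp.toLp 2 (z.fst, y)))
      ((fderiv ℝ F (WithLp.toLp 2 (z.fst, y))).comp projL) z :=
    (F.differentiableAt.hasFDerivAt).comp z hA
  refine (hL.smul hF).congr_fderiv ?_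
  ext w
  simp only [smul_apply, add_apply, pftDeriv_apply,
    ContinuousLinearMap.smulRight_apply, ContinuousLinearMap.comp_apply, smul_add]
  congr 1
  change _ = _ • _ • (⟪y, w.snd⟫_ℝ • F (WithLp.toLp 2 (z.fst, y)))
  rw [← IsScalarTower.algebraMap_smul ℂ ⟪y, w.snd⟫_ℝ (F (WithLp.toLp 2 (z.fst, y))), smul_smul,
    smul_smul]
  congr 1
  have e1 : ((innerSL ℝ).bilinearComp (ContinuousLinearMap.id ℝ E) (WithLp.sndL 2 ℝ E E)) y z
      = ⟪y, z.snd⟫_ℝ := rfl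
  have e2 : ((innerSL ℝ).bilinearComp (ContinuousLinearMap.id ℝ E) (WithLp.sndL 2 ℝ E E)) y w
      = ⟪y, w.snd⟫_ℝ := rfl
  rw [e1, e2, Complex.ofRealCLM_apply, smul_eq_mul, Complex.coe_algebraMap]
  ring

theorem hasFDerivAt_pft (F : 𝓢(Phase E, V)) (z : Phase E) :
    HasFDerivAt (pft F) (pft (pftDeriv E V F) z) z := by
  refine hasFDerivAt_integral_of_dominated_of_fderiv_le (𝕜 := ℝ) (s := Set.univ) Filter.univ_mem
    (.of_forall fun z => (integrable_integrand F z).aestronglyMeasurable)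
    (integrable_integrand F z)
    (integrable_integrand (pftDeriv E V F) z).aestronglyMeasurable
    (.of_forall fun y z' _ => ?_)
    (integrable_one_add.const_mul (schwartzBound (pftDeriv E V F) 0 0))
    (.of_forall fun y z' _ => hasFDerivAt_integrand F y z')
  · rw [norm_smul, Circle.norm_coe, one_mul]
    simpa using one_add_bound (pftDeriv E V F) 0 0 0 le_rfl z'.fst y

theorem pft_contDiff_nat (n : ℕ) : ∀ {V : Type} [NormedAddCommGroup V] [NormedSpace ℝ V]
    [NormedSpace ℂ V] [IsScalarTower ℝ ℂ V] (F : 𝓢(Phase E, V)), ContDiff ℝ n (pft F) := by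
  induction n with
  | zero =>
    intro V _ _ _ _ F
    exact contDiff_zero.2
      (continuous_iff_continuousAt.2 fun z => (hasFDerivAt_pft F z).continuousAt)
  | succ n ih =>
    intro V _ _ _ _ F
    push_cast
    rw [contDiff_succ_iff_fderiv]
    refine ⟨fun z => (hasFDerivAt_pft F z).differentiableAt, by simp, ?_⟩
    have : fderiv ℝ (pft F) = pft (pftDeriv E V F) :=
      funext fun z => (hasFDerivAt_pft F z).fderiv
    rw [this]
    exact ih (V := Phase E →L[ℝ] V) (pftDeriv E V F)

theorem continuous_finsetSup_apply {V : Type} [NormedAddCommGroup V] [NormedSpace ℝ V]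
    (s : Finset (ℕ × ℕ)) :
    Continuous fun F : 𝓢(Phase E, V) => (s.sup (schwartzSeminormFamily ℝ (Phase E) V)) F := by
  classical
  induction s using Finset.induction_on with
  | empty => simpa using continuous_const
  | insert a s _ ih =>
    rw [Finset.sup_insert]
    exact ((schwartz_withSeminorms ℝ (Phase E) V).continuous_seminorm a).sup ih

theorem pft_bound (k n : ℕ) : ∀ {V : Type} [NormedAddCommGroup V] [NormedSpace ℝ V]
    [NormedSpace ℂ V] [IsScalarTower ℝ ℂ V],
    ∃ (s : Finset (ℕ × ℕ)) (C : ℝ), 0 ≤ C ∧ ∀ (F : 𝓢(Phase E, V)) (z : Phase E),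
      ‖z‖ ^ k * ‖iteratedFDeriv ℝ n (pft F) z‖
        ≤ C * (s.sup (schwartzSeminormFamily ℝ (Phase E) V)) F := by
  induction n with
  | zero =>
    intro V _ _ _ _
    simpa only [norm_iteratedFDeriv_zero] using pft_decay k
  | succ n ih =>
    intro V _ _ _ _
    obtain ⟨s, C, hC, h⟩ := ih (V := Phase E →L[ℝ] V)
    set q := (s.sup (schwartzSeminormFamily ℝ (Phase E) (Phase E →L[ℝ] V))).comp
      (pftDeriv E V).toLinearMap
    have hq : Continuous q :=
      ((continuous_finsetSup_apply s)).comp (pftDeriv E V).continuous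
    obtain ⟨s', C', -, h'⟩ := Seminorm.bound_of_continuous (schwartz_withSeminorms ℝ (Phase E) V)
      q hq
    refine ⟨s', C * C', by positivity, fun F z => ?_⟩
    have e : fderiv ℝ (pft F) = pft (pftDeriv E V F) :=
      funext fun z => (hasFDerivAt_pft F z).fderiv
    rw [← norm_iteratedFDeriv_fderiv, e]
    refine (h (pftDeriv E V F) z).trans ?_
    rw [mul_assoc]
    gcongr
    exact h' F

theorem partialFourier_smul_aux (a : ℂ) (F : 𝓢(Phase E, ℂ)) (z : Phase E) :
    pft (a • F) z = a * pft F z := by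
  rw [pft, pft, ← integral_const_mul]
  congr 1
  funext y
  simp only [smul_apply, smul_eq_mul]
  ring

noncomputable def partialFourierAux : 𝓢(Phase E, ℂ) →L[ℝ] 𝓢(Phase E, ℂ) :=
  SchwartzMap.mkCLM (𝕜 := ℝ) (𝕜' := ℝ) (σ := RingHom.id ℝ) (fun F z => pft F z)
    (fun F G z => by
      simp only [pft, add_apply, smul_add]
      exact integral_add (integrable_integrand F z) (integrable_integrand G z))
    (fun a F z => by
      simp only [pft, smul_apply, RingHom.id_apply, ← integral_smul]
      congr 1
      funext y
      rw [smul_comm])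
    (fun F => contDiff_infty.2 fun n => pft_contDiff_nat n F)
    (fun n => pft_bound n.1 n.2)

/-- The partial Fourier transform
`F ↦ ((x, ω) ↦ ∫ exp (-2πi y·ω) F (x, y) dy)` on Schwartz functions. -/
noncomputable def partialFourier : 𝓢(Phase E, ℂ) →L[ℂ] 𝓢(Phase E, ℂ) where
  toFun F := partialFourierAux F
  map_add' F G := map_add _ F G
  map_smul' a F := by
    ext z
    exact partialFourier_smul_aux a F z
  cont := partialFourierAux.continuous

theorem partialFourier_apply (F : 𝓢(Phase E, ℂ)) (z : Phase E) :
    partialFourier F z =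
      ∫ y : E, ((𝐞 (-⟪y, z.snd⟫_ℝ) : Circle) : ℂ) * F (WithLp.toLp 2 (z.fst, y)) := rfl

end Meas

/-- Complex conjugation of Schwartz functions. -/
noncomputable def conjS : 𝓢(E, ℂ) →L[ℝ] 𝓢(E, ℂ) :=
  postcompCLM (Complex.conjCLE : ℂ →L[ℝ] ℂ)

theorem conjS_apply (f : 𝓢(E, ℂ)) (x : E) : conjS f x = starRingEnd ℂ (f x) := rfl

theorem norm_iteratedFDeriv_comp_fst_le (f : 𝓢(E, ℂ)) (n : ℕ) (z : Phase E) :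
    ‖iteratedFDeriv ℝ n (fun z : Phase E => f z.fst) z‖ ≤ ‖iteratedFDeriv ℝ n f z.fst‖ := by
  have hn : ‖WithLp.fstL 2 ℝ E E‖ ≤ 1 :=
    ContinuousLinearMap.opNorm_le_bound _ zero_le_one fun y => by
      rw [one_mul]; exact WithLp.norm_fst_le E y
  change ‖iteratedFDeriv ℝ n (f ∘ WithLp.fstL 2 ℝ E E) z‖ ≤ _
  rw [ContinuousLinearMap.iteratedFDeriv_comp_right _ (f.smooth ⊤) z (mod_cast le_top)]
  refine (ContinuousMultilinearMap.norm_compContinuousLinearMap_le _ _).trans ?_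
  refine mul_le_of_le_one_right (norm_nonneg _) ?_
  exact Finset.prod_le_one (fun _ _ => norm_nonneg _) fun _ _ => hn

theorem norm_iteratedFDeriv_comp_snd_le (f : 𝓢(E, ℂ)) (n : ℕ) (z : Phase E) :
    ‖iteratedFDeriv ℝ n (fun z : Phase E => f z.snd) z‖ ≤ ‖iteratedFDeriv ℝ n f z.snd‖ := by
  have hn : ‖WithLp.sndL 2 ℝ E E‖ ≤ 1 :=
    ContinuousLinearMap.opNorm_le_bound _ zero_le_one fun y => by
      rw [one_mul]; exact WithLp.norm_snd_le E y
  change ‖iteratedFDeriv ℝ n (f ∘ WithLp.sndL 2 ℝ E E) z‖ ≤ _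
  rw [ContinuousLinearMap.iteratedFDeriv_comp_right _ (f.smooth ⊤) z (mod_cast le_top)]
  refine (ContinuousMultilinearMap.norm_compContinuousLinearMap_le _ _).trans ?_
  refine mul_le_of_le_one_right (norm_nonneg _) ?_
  exact Finset.prod_le_one (fun _ _ => norm_nonneg _) fun _ _ => hn

theorem contDiff_comp_fst (f : 𝓢(E, ℂ)) : ContDiff ℝ ∞ (fun z : Phase E => f z.fst) :=
  (f.smooth ⊤).comp (WithLp.fstL 2 ℝ E E).contDiff

theorem contDiff_comp_snd (f : 𝓢(E, ℂ)) : ContDiff ℝ ∞ (fun z : Phase E => f z.snd) :=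
  (f.smooth ⊤).comp (WithLp.sndL 2 ℝ E E).contDiff

theorem tensor_bound (k : 𝓢(E, ℂ)) (N n : ℕ) :
    ∃ (s : Finset (ℕ × ℕ)) (C : ℝ), 0 ≤ C ∧ ∀ (f : 𝓢(E, ℂ)) (z : Phase E),
      ‖z‖ ^ N * ‖iteratedFDeriv ℝ n (fun z : Phase E => f z.fst * k z.snd) z‖
        ≤ C * (s.sup (schwartzSeminormFamily ℂ E ℂ)) f := by
  set K := 2 ^ N * ((Finset.Iic (N, n)).sup fun m => SchwartzMap.seminorm ℂ m.1 m.2) k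
  have hK : 0 ≤ K := by positivity
  refine ⟨Finset.Iic (N, n), ∑ i ∈ Finset.range (n + 1), (n.choose i : ℝ) * 2 ^ N * K,
    by positivity, fun f z => ?_⟩
  have hz : ‖z‖ ^ N ≤ (1 + ‖z.fst‖) ^ N * (1 + ‖z.snd‖) ^ N := by
    rw [← mul_pow]
    refine pow_le_pow_left₀ (norm_nonneg _) ((norm_le_add z).trans ?_) N
    nlinarith [norm_nonneg z.fst, norm_nonneg z.snd]
  have h := norm_iteratedFDeriv_mul_le (contDiff_comp_fst f) (contDiff_comp_snd k) z
    (n := n) (mod_cast le_top)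
  refine (mul_le_mul hz h (norm_nonneg _) (by positivity)).trans ?_
  rw [Finset.mul_sum, Finset.sum_mul]
  refine Finset.sum_le_sum fun i hi => ?_
  have hi' : i ≤ n := by simpa [Nat.lt_succ_iff] using hi
  have hf := SchwartzMap.one_add_le_sup_seminorm_apply (𝕜 := ℂ) (m := (N, n)) le_rfl hi' f z.fst
  have hk := SchwartzMap.one_add_le_sup_seminorm_apply (𝕜 := ℂ) (m := (N, n)) le_rfl
    (Nat.sub_le n i) k z.snd
  calc (1 + ‖z.fst‖) ^ N * (1 + ‖z.snd‖) ^ N *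
        ((n.choose i : ℝ) * ‖iteratedFDeriv ℝ i (fun z : Phase E => f z.fst) z‖
          * ‖iteratedFDeriv ℝ (n - i) (fun z : Phase E => k z.snd) z‖)
      ≤ (1 + ‖z.fst‖) ^ N * (1 + ‖z.snd‖) ^ N *
        ((n.choose i : ℝ) * ‖iteratedFDeriv ℝ i f z.fst‖
          * ‖iteratedFDeriv ℝ (n - i) k z.snd‖) := by
        gcongr
        · exact norm_iteratedFDeriv_comp_fst_le f i z
        · exact norm_iteratedFDeriv_comp_snd_le k (n - i) z
    _ = (n.choose i : ℝ) * ((1 + ‖z.fst‖) ^ N * ‖iteratedFDeriv ℝ i f z.fst‖)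
          * ((1 + ‖z.snd‖) ^ N * ‖iteratedFDeriv ℝ (n - i) k z.snd‖) := by ring
    _ ≤ (n.choose i : ℝ) * (2 ^ N * ((Finset.Iic (N, n)).sup
          fun m => SchwartzMap.seminorm ℂ m.1 m.2) f) * K := by
        gcongr
    _ = (n.choose i : ℝ) * 2 ^ N * K * ((Finset.Iic (N, n)).sup
          fun m => SchwartzMap.seminorm ℂ m.1 m.2) f := by ring

/-- The tensor product `f ⊗ k : (x, y) ↦ f x * k y`, as a function of `f`. -/
noncomputable def tensor (k : 𝓢(E, ℂ)) : 𝓢(E, ℂ) →L[ℂ] 𝓢(Phase E, ℂ) :=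
  SchwartzMap.mkCLM (𝕜 := ℂ) (𝕜' := ℂ) (σ := RingHom.id ℂ)
    (fun f z => f z.fst * k z.snd)
    (fun f g z => by simp [add_mul])
    (fun a f z => by simp [mul_assoc])
    (fun f => (contDiff_comp_fst f).mul (contDiff_comp_snd k))
    (fun n => tensor_bound k n.1 n.2)

theorem tensor_apply (k f : 𝓢(E, ℂ)) (z : Phase E) : tensor k f z = f z.fst * k z.snd := rfl

/-- The change of variables `(x, y) ↦ (x + τ y, x - (1 - τ) y)`. -/
noncomputable def tauShear (τ : ℝ) : Phase E ≃L[ℝ] Phase E where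
  toFun z := WithLp.toLp 2 (z.fst + τ • z.snd, z.fst - (1 - τ) • z.snd)
  invFun z := WithLp.toLp 2 ((1 - τ) • z.fst + τ • z.snd, z.fst - z.snd)
  map_add' z w := by
    apply WithLp.ofLp_injective
    ext <;> simp <;> try module
  map_smul' a z := by
    apply WithLp.ofLp_injective
    ext <;> simp <;> try module
  left_inv z := by
    apply WithLp.ofLp_injective
    ext <;> simp <;> try module
  right_inv z := by
    apply WithLp.ofLp_injective
    ext <;> simp <;> try module
  continuous_toFun := by fun_prop
  continuous_invFun := by fun_prop

section Operators
variable [FiniteDimensional ℝ E] [MeasurableSpace E] [BorelSpace E]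

/-- The cross-`τ`-Wigner distribution
`W_τ(f, g)(x, ω) = ∫ exp (-2πi y·ω) f (x + τ y) conj (g (x - (1 - τ) y)) dy`. -/
noncomputable def tauWigner (τ : ℝ) (f g : 𝓢(E, ℂ)) : 𝓢(Phase E, ℂ) :=
  partialFourier (compCLMOfContinuousLinearEquiv ℂ (tauShear τ) (tensor (conjS g) f))

theorem tauWigner_apply (τ : ℝ) (f g : 𝓢(E, ℂ)) (z : Phase E) :
    tauWigner τ f g z = ∫ y : E, ((𝐞 (-⟪y, z.snd⟫_ℝ) : Circle) : ℂ) *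
      (f (z.fst + τ • y) * starRingEnd ℂ (g (z.fst - (1 - τ) • y))) := rfl

theorem tauWigner_add (τ : ℝ) (f₁ f₂ g : 𝓢(E, ℂ)) :
    tauWigner τ (f₁ + f₂) g = tauWigner τ f₁ g + tauWigner τ f₂ g := by
  simp only [tauWigner, map_add]

theorem tauWigner_smul (τ : ℝ) (a : ℂ) (f g : 𝓢(E, ℂ)) :
    tauWigner τ (a • f) g = a • tauWigner τ f g := by
  simp only [tauWigner, map_smul]

theorem conjS_smul (a : ℂ) (f : 𝓢(E, ℂ)) : conjS (a • f) = starRingEnd ℂ a • conjS f := by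
  ext x
  simp [conjS_apply]

/-- The `τ`-pseudodifferential operator `Op_τ(σ) : 𝓢 → 𝓢'` with symbol `σ ∈ 𝓢'`, given by
`⟨Op_τ(σ) f, g⟩ = ⟨σ, W_τ(g, f)⟩`. The brackets are conjugate-linear in the second argument,
whereas `u h` for a tempered distribution `u` is linear in `h`, i.e. `⟨u, h⟩ = u (conj h)`. -/
noncomputable def opTau (τ : ℝ) (σ : 𝓢'(Phase E, ℂ)) (f : 𝓢(E, ℂ)) : 𝓢'(E, ℂ) :=
  ContinuousLinearMap.toPointwiseConvergenceCLM ℂ (RingHom.id ℂ) 𝓢(E, ℂ) ℂ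
  { toFun := fun h => σ (conjS (tauWigner τ (conjS h) f))
    map_add' := fun h₁ h₂ => by rw [map_add, tauWigner_add, map_add, map_add]
    map_smul' := fun a h => by
      rw [conjS_smul, tauWigner_smul, conjS_smul, map_smul, Complex.conj_conj, RingHom.id_apply]
    cont := by
      unfold tauWigner
      fun_prop }

theorem opTau_apply (τ : ℝ) (σ : 𝓢'(Phase E, ℂ)) (f h : 𝓢(E, ℂ)) :
    opTau τ σ f h = σ (conjS (tauWigner τ (conjS h) f)) := rfl

end Operators

/-- The phase-space shift `π(x, ω) f (t) = exp (2πi ω·t) f (t - x)`, where `z = (x, ω)`. -/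
noncomputable def tfShift (z : Phase E) : 𝓢(E, ℂ) →L[ℂ] 𝓢(E, ℂ) :=
  smulLeftCLM ℂ (fun t : E => ((𝐞 ⟪z.snd, t⟫_ℝ : Circle) : ℂ)) ∘L compSubConstCLM ℂ z.fst

theorem tfShift_apply (z : Phase E) (f : 𝓢(E, ℂ)) (t : E) :
    tfShift z f t = ((𝐞 ⟪z.snd, t⟫_ℝ : Circle) : ℂ) * f (t - z.fst) := by
  simp [tfShift, smulLeftCLM_apply_apply (character_hasTemperateGrowth z.snd)]

/-- The short-time Fourier transform `V_g f (z) = ⟨f, π(z) g⟩`. -/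
noncomputable def stft (g : 𝓢(E, ℂ)) (f : 𝓢'(E, ℂ)) (z : Phase E) : ℂ :=
  f (conjS (tfShift z g))

end General

section Modulation
variable {E : Type} [NormedAddCommGroup E] [InnerProductSpace ℝ E]
  [FiniteDimensional ℝ E] [MeasurableSpace E] [BorelSpace E]

/-- The modulation space norm `‖f‖_{M^{p,q}_m} = ‖V_g f‖_{L^{p,q}_m} ∈ [0, ∞]` with respect to the
window `g`: the `L^p` norm in `x` of `V_g f (x, ω) m (x, ω)`, followed by the `L^q` norm in `ω`.
The space `M^{p,q}_m` consists of the tempered distributions `f` for which it is finite. -/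
noncomputable def modNorm (g : 𝓢(E, ℂ)) (p q : ℝ≥0∞) (m : Phase E → ℝ) (f : 𝓢'(E, ℂ)) : ℝ≥0∞ :=
  eLpNorm (fun ξ : E => eLpNorm
    (fun x : E => (m (WithLp.toLp 2 (x, ξ)) : ℂ) * stft g f (WithLp.toLp 2 (x, ξ)))
    p (volume : Measure E)) q (volume : Measure E)

/-- A map `T` on tempered distributions realises the operator `Op_τ(σ)` on `M^{p,q}_m`: on this
space `T` is linear, it coincides with `Op_τ(σ)` on the Schwartz functions that belong to the space,
and it is sequentially continuous for the topology of `𝓢'` on bounded subsets of the space.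
(Schwartz functions need not be norm dense when `p = ∞` or `q = ∞`. For weights `m` bounded below as
in `HasTemperedLowerBound` and windows `g ∈ M^1_v`, every element of `M^{p,q}_m` is however the limit in `𝓢'` of a norm bounded sequence of Schwartz functions, so that these properties
determine `T` on `M^{p,q}_m`.) -/
structure IsOpTauOn (τ : ℝ) (σ : 𝓢'(Phase E, ℂ)) (g : 𝓢(E, ℂ)) (p q : ℝ≥0∞) (m : Phase E → ℝ)
    (T : 𝓢'(E, ℂ) → 𝓢'(E, ℂ)) : Prop where
  map_add : ∀ f₁ f₂, modNorm g p q m f₁ < ⊤ → modNorm g p q m f₂ < ⊤ → T (f₁ + f₂) = T f₁ + T f₂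
  map_smul : ∀ (a : ℂ) f, modNorm g p q m f < ⊤ → T (a • f) = a • T f
  eq_opTau : ∀ f : 𝓢(E, ℂ), modNorm g p q m (f : 𝓢'(E, ℂ)) < ⊤ →
    T (f : 𝓢'(E, ℂ)) = opTau τ σ f
  tendsto : ∀ (u : ℕ → 𝓢'(E, ℂ)) (f : 𝓢'(E, ℂ)) (B : ℝ≥0), (∀ n, modNorm g p q m (u n) ≤ B) →
    modNorm g p q m f < ⊤ → Tendsto u atTop (𝓝 f) → Tendsto (fun n => T (u n)) atTop (𝓝 (T f))

end Modulation

section Weights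
variable {d : ℕ}

/-- Admissible weights on `ℝ^{2d}`. -/
structure IsAdmissibleWeight (v : Phase (EuclideanSpace ℝ (Fin d)) → ℝ) : Prop where
  continuous : Continuous v
  nonneg : ∀ z, 0 ≤ v z
  map_zero : v 0 = 1
  even : ∀ z w, (∀ i, |z.fst i| = |w.fst i|) → (∀ i, |z.snd i| = |w.snd i|) → v z = v w
  submultiplicative : ∀ w z, v (w + z) ≤ v w * v z
  grs : ∀ z, Tendsto (fun n : ℕ => v ((n : ℝ) • z) ^ ((n : ℝ)⁻¹)) atTop (𝓝 1)

/-- `v`-moderate weights on `ℝ^{2d}` (the class `ℳ_v`). -/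
structure IsModerateWeight (v m : Phase (EuclideanSpace ℝ (Fin d)) → ℝ) : Prop where
  measurable : Measurable m
  pos : ∀ z, 0 < m z
  moderate : ∃ C : ℝ, 0 ≤ C ∧ ∀ z₁ z₂, m (z₁ + z₂) ≤ C * v z₁ * m z₂

/-- The weight is at least `1` everywhere or decays at most polynomially. -/
def HasTemperedLowerBound (m : Phase (EuclideanSpace ℝ (Fin d)) → ℝ) : Prop :=
  (∀ z, 1 ≤ m z) ∨
    ∃ (N : ℕ) (c : ℝ), 0 < c ∧ ∀ z, c * Real.sqrt (1 + ‖z‖ ^ 2) ^ (-(N : ℤ)) ≤ m z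

/-- `J⁻¹ (z₁, z₂) = (-z₂, z₁)` for the canonical symplectic matrix `J (z₁, z₂) = (z₂, -z₁)`. -/
def symplecticInv (z : Phase (EuclideanSpace ℝ (Fin d))) : Phase (EuclideanSpace ℝ (Fin d)) :=
  WithLp.toLp 2 (-z.snd, z.fst)

/-- The weight `1 ⊗ (v ∘ J⁻¹) : (z, ζ) ↦ v (J⁻¹ ζ)` on `ℝ^{4d}`. -/
def symbolWeight (v : Phase (EuclideanSpace ℝ (Fin d)) → ℝ) :
    Phase (Phase (EuclideanSpace ℝ (Fin d))) → ℝ :=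
  fun Z => v (symplecticInv Z.snd)

/-- Nonzero Schwartz windows in `M^1_v`, i.e. `V_g g ∈ L^1_v`. -/
def IsWindow (v : Phase (EuclideanSpace ℝ (Fin d)) → ℝ) (g : 𝓢(EuclideanSpace ℝ (Fin d), ℂ)) :
    Prop :=
  g ≠ 0 ∧ modNorm g 1 1 v (g : 𝓢'(EuclideanSpace ℝ (Fin d), ℂ)) < ⊤

end Weights

end TauPsiDO

/-! The mechanism is the approximate diagonalisation of Op_τ(σ) by phase-space shifts. Put Φ =
W_τ(g, g). Covariance of the τ-Wigner distribution (`tauWigner_tfShift`) turns the Gabor matrix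
entry ⟨Op_τ(σ)π(z)g, π(w)g⟩ into a value of V_Φσ, up to a unimodular factor, at a point whose
frequency component is J(w - z) (`norm_opTau_tfShift`). Taking the supremum over the position
component dominates the matrix by a convolution kernel H(w - z), and ∫ v H is, up to a Jacobian, the
M^{∞,1} norm of σ for the window Φ (`exists_kernel_bound`). Replacing Φ by the given window G
requires weighted integrability of V_ΦΦ. By covariance and Moyal's identity |V_ΦΦ| factors into two
copies of |V_gg|, so V_gg ∈ L^1_v suffices.

Since Schwartz functions need not be norm dense, the operator on M^{p,q}_m is defined by the weak
synthesis integral Tf = ⟨g, γ⟩⁻¹ ∫ V_γf(z) Op_τ(σ)π(z)g dz (`opTauIntegral`). On Schwartz functions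
this is Op_τ(σ) by the inversion formula (`opTauExt_coe`). Moreover |V_g(Tf)| is at most a constant
times |V_γf| * H, so a weighted Young inequality for mixed norms, obtained from Minkowski's
inequality, gives the norm bound (`modNorm_opTauExt_le`). Convergence of the integral and weak
sequential continuity come from domination: |V_γf| is bounded by a multiple of 1/m, while
|⟨Op_τ(σ)π(z)g, h⟩| / m(z) is integrable because V_gh is Schwartz and 1/m grows at most
polynomially. This is the role of the lower bound on m.

The second window γ is the average of π(s)g over a small box (`exists_averaged_window`). Then |V_γf|
is controlled by local averages of |V_gf|. Hölder's inequality turns these into a pointwise bound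
whose constant depends on p and q but serves only for convergence; Young's inequality turns them
into a norm bound with a constant independent of p and q. Exchanging distributions with
Schwartz-valued integrals is justified by `clm_integral_schwartz`. -/

namespace TauPsiDO

/-! ### Schwartz-valued integrals and their exchange with continuous functionals. -/

section SchwartzIntegral

variable {E : Type} [NormedAddCommGroup E] [NormedSpace ℝ E]

/-- Continuous `l`-linear maps, with the operator norm as only normed structure. -/
def Jet (E V : Type) [NormedAddCommGroup E] [NormedSpace ℝ E] [NormedAddCommGroup V]
    [NormedSpace ℝ V] (l : ℕ) : Type := E [×l]→L[ℝ] V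

noncomputable instance (V : Type) [NormedAddCommGroup V] [NormedSpace ℝ V] (l : ℕ) :
    NormedAddCommGroup (Jet E V l) := ContinuousMultilinearMap.normedAddCommGroup

noncomputable instance (V : Type) [NormedAddCommGroup V] [NormedSpace ℝ V] (l : ℕ) :
    NormedSpace ℝ (Jet E V l) := ContinuousMultilinearMap.normedSpace

instance (V : Type) [NormedAddCommGroup V] [NormedSpace ℝ V] [CompleteSpace V] (l : ℕ) :
    CompleteSpace (Jet E V l) := inferInstanceAs (CompleteSpace (E [×l]→L[ℝ] V))

/-- The `l`-th derivative with values in `Jet`. -/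
noncomputable def jetAt {V : Type} [NormedAddCommGroup V] [NormedSpace ℝ V] (l : ℕ) (f : E → V)
    (x : E) : Jet E V l := iteratedFDeriv ℝ l f x

/-- Evaluation of `0`-linear maps. -/
noncomputable def jetZero (V : Type) [NormedAddCommGroup V] [NormedSpace ℝ V] :
    V ≃ₗᵢ[ℝ] Jet E V 0 := (continuousMultilinearCurryFin0 ℝ E V).symm

/-- Currying in the last variable. -/
noncomputable def jetSucc (V : Type) [NormedAddCommGroup V] [NormedSpace ℝ V] (l : ℕ) :
    Jet E (E →L[ℝ] V) l ≃ₗᵢ[ℝ] Jet E V (l + 1) :=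
  (continuousMultilinearCurryRightEquiv' ℝ l E V).symm

theorem continuous_jetAt {V : Type} [NormedAddCommGroup V] [NormedSpace ℝ V] (l : ℕ)
    (φ : 𝓢(E, V)) : Continuous (jetAt l φ) :=
  (φ.smooth ⊤).continuous_iteratedFDeriv (mod_cast le_top)

theorem jetAt_add {V : Type} [NormedAddCommGroup V] [NormedSpace ℝ V] (l : ℕ)
    (φ ψ : 𝓢(E, V)) (x : E) : jetAt l (φ + ψ : 𝓢(E, V)) x = jetAt l φ x + jetAt l ψ x :=
  iteratedFDeriv_add_apply (φ.smooth l).contDiffAt (ψ.smooth l).contDiffAt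

theorem jetAt_smul {V : Type} [NormedAddCommGroup V] [NormedSpace ℝ V] (l : ℕ)
    (a : ℝ) (φ : 𝓢(E, V)) (x : E) : jetAt l (a • φ : 𝓢(E, V)) x = a • jetAt l φ x :=
  iteratedFDeriv_const_smul_apply (φ.smooth l).contDiffAt

theorem pow_mul_norm_jetAt_le {V : Type} [NormedAddCommGroup V] [NormedSpace ℝ V] (k l : ℕ)
    (φ : 𝓢(E, V)) (x : E) : ‖x‖ ^ k * ‖jetAt l φ x‖ ≤ SchwartzMap.seminorm ℝ k l φ :=
  SchwartzMap.le_seminorm ℝ k l φ x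

/-- The map `φ ↦ (x ↦ ‖x‖ ^ k • D^l φ x)` into bounded continuous functions. -/
noncomputable def jet (V : Type) [NormedAddCommGroup V] [NormedSpace ℝ V] (k l : ℕ) :
    𝓢(E, V) →L[ℝ] BoundedContinuousFunction E (Jet E V l) :=
  SchwartzMap.mkCLMtoNormedSpace (𝕜 := ℝ) (𝕜' := ℝ) (σ := RingHom.id ℝ)
    (fun φ : 𝓢(E, V) => BoundedContinuousFunction.ofNormedAddCommGroup
      (fun x => ‖x‖ ^ k • jetAt l φ x)
      ((continuous_norm.pow k).smul (continuous_jetAt l φ))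
      (SchwartzMap.seminorm ℝ k l φ)
      (fun x => by
        rw [norm_smul, norm_pow, norm_norm]
        exact pow_mul_norm_jetAt_le k l φ x))
    (fun φ ψ => by
      ext1 x
      simp only [BoundedContinuousFunction.coe_ofNormedAddCommGroup,
        BoundedContinuousFunction.coe_add, Pi.add_apply, jetAt_add, smul_add])
    (fun a φ => by
      ext1 x
      simp only [BoundedContinuousFunction.coe_ofNormedAddCommGroup,
        BoundedContinuousFunction.coe_smul, RingHom.id_apply, jetAt_smul]
      exact smul_comm _ _ _)
    ⟨{(k, l)}, 1, zero_le_one, fun φ => by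
      rw [Finset.sup_singleton, one_mul]
      exact BoundedContinuousFunction.norm_ofNormedAddCommGroup_le _ (apply_nonneg _ _) _⟩

variable {V : Type} [NormedAddCommGroup V] [NormedSpace ℝ V]

theorem jet_apply (k l : ℕ) (φ : 𝓢(E, V)) (x : E) :
    jet V k l φ x = ‖x‖ ^ k • jetAt l φ x := rfl

theorem norm_jet (k l : ℕ) (φ : 𝓢(E, V)) :
    ‖jet V k l φ‖ = SchwartzMap.seminorm ℝ k l φ := by
  apply le_antisymm
  · refine (BoundedContinuousFunction.norm_le (apply_nonneg _ _)).2 fun x => ?_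
    rw [jet_apply, norm_smul, norm_pow, norm_norm]
    exact pow_mul_norm_jetAt_le k l φ x
  · refine SchwartzMap.seminorm_le_bound ℝ k l φ (norm_nonneg _) fun x => ?_
    have := (jet V k l φ).norm_coe_le_norm x
    rwa [jet_apply, norm_smul, norm_pow, norm_norm] at this

/-- Continuity bounds u by finitely many Schwartz seminorms, each of which is the norm of a jet.
Hence u factors through the range of a map into a finite product of normed spaces, and Hahn–Banach
extends it to the whole product. This reduces integration in the Fréchet space 𝓢 to Bochner
integration in a Banach space. -/
theorem exists_factor_jet (u : 𝓢(E, V) →L[ℝ] ℝ) :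
    ∃ (s : Finset (ℕ × ℕ))
      (U : (∀ i : s, BoundedContinuousFunction E (Jet E V i.1.2)) →L[ℝ] ℝ),
      ∀ φ, u φ = U (fun i => jet V i.1.1 i.1.2 φ) := by
  obtain ⟨s, C, -, hC⟩ := Seminorm.bound_of_continuous (schwartz_withSeminorms ℝ E V)
    ((normSeminorm ℝ ℝ).comp u.toLinearMap) (continuous_norm.comp u.continuous)
  set ι : 𝓢(E, V) →L[ℝ] (∀ i : s, BoundedContinuousFunction E (Jet E V i.1.2)) :=
    ContinuousLinearMap.pi fun i => jet V i.1.1 i.1.2 with hι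
  have hb : ∀ φ, ‖u φ‖ ≤ C * ‖ι φ‖ := by
    intro φ
    refine (hC φ).trans ?_
    change (C : ℝ) * _ ≤ _
    gcongr
    refine Seminorm.finset_sup_apply_le (norm_nonneg _) fun i hi => ?_
    rw [SchwartzMap.schwartzSeminormFamily_apply, ← norm_jet]
    exact norm_le_pi_norm (ι φ) ⟨i, hi⟩
  have hker : LinearMap.ker ι.toLinearMap ≤ LinearMap.ker u.toLinearMap := by
    intro φ hφ
    have h0 : ι φ = 0 := hφ
    have := hb φ
    rw [h0] at this
    exact norm_le_zero_iff.1 (this.trans_eq (by simp))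
  set U₀ : LinearMap.range ι.toLinearMap →ₗ[ℝ] ℝ :=
    ((LinearMap.ker ι.toLinearMap).liftQ u.toLinearMap hker) ∘ₗ
      ι.toLinearMap.quotKerEquivRange.symm.toLinearMap
  have hU₀ : ∀ φ, U₀ ⟨ι φ, ⟨φ, rfl⟩⟩ = u φ := by
    intro φ
    have : ι.toLinearMap.quotKerEquivRange.symm ⟨ι φ, ⟨φ, rfl⟩⟩
        = Submodule.Quotient.mk φ := by
      rw [LinearEquiv.symm_apply_eq]
      rfl
    simp only [U₀, LinearMap.comp_apply, LinearEquiv.coe_coe]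
    rw [this]
    rfl
  obtain ⟨U, hU, -⟩ := exists_extension_norm_eq (LinearMap.range ι.toLinearMap)
    (U₀.mkContinuous C (by
      rintro ⟨_, φ, rfl⟩
      exact (congrArg norm (hU₀ φ)).trans_le (hb φ)))
  exact ⟨s, U, fun φ => ((hU ⟨ι φ, ⟨φ, rfl⟩⟩).trans (hU₀ φ)).symm⟩

variable {X : Type*} [TopologicalSpace X] [SecondCountableTopology X] [MeasurableSpace X]
  [OpensMeasurableSpace X] {μ : Measure X}

theorem integrable_jet {F : X → 𝓢(E, V)} (hF : Continuous F)
    (hi : ∀ k l, Integrable (fun x => SchwartzMap.seminorm ℝ k l (F x)) μ) (k l : ℕ) :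
    Integrable (fun x => jet V k l (F x)) μ := by
  refine (hi k l).mono' ((jet V k l).continuous.comp hF).aestronglyMeasurable
    (.of_forall fun x => ?_)
  rw [norm_jet]

theorem integrable_jetAt_apply {F : X → 𝓢(E, V)} (hF : Continuous F)
    (hi : ∀ k l, Integrable (fun x => SchwartzMap.seminorm ℝ k l (F x)) μ) (k l : ℕ) (t : E) :
    Integrable (fun x => ‖t‖ ^ k • jetAt l (F x) t) μ :=
  (BoundedContinuousFunction.evalCLM ℝ t).integrable_comp (integrable_jet hF hi k l)

theorem integrable_jetAt {F : X → 𝓢(E, V)} (hF : Continuous F)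
    (hi : ∀ k l, Integrable (fun x => SchwartzMap.seminorm ℝ k l (F x)) μ) (l : ℕ) (t : E) :
    Integrable (fun x => jetAt l (F x) t) μ := by
  simpa using integrable_jetAt_apply hF hi 0 l t

theorem integrable_eval {F : X → 𝓢(E, V)} (hF : Continuous F)
    (hi : ∀ k l, Integrable (fun x => SchwartzMap.seminorm ℝ k l (F x)) μ) (t : E) :
    Integrable (fun x => F x t) μ :=
  (jetZero V).symm.toContinuousLinearEquiv.toContinuousLinearMap.integrable_comp
    (integrable_jetAt hF hi 0 t)

theorem seminorm_fderivCLM (k l : ℕ) (φ : 𝓢(E, V)) :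
    SchwartzMap.seminorm ℝ k l (fderivCLM ℝ E V φ) = SchwartzMap.seminorm ℝ k (l + 1) φ := by
  have e : ∀ x, ‖iteratedFDeriv ℝ l (fderivCLM ℝ E V φ) x‖ = ‖iteratedFDeriv ℝ (l + 1) φ x‖ := by
    intro x
    rw [← norm_iteratedFDeriv_fderiv]
    rfl
  apply le_antisymm
  · refine SchwartzMap.seminorm_le_bound ℝ k l _ (apply_nonneg _ _) fun x => ?_
    rw [e]
    exact SchwartzMap.le_seminorm ℝ k (l + 1) φ x
  · refine SchwartzMap.seminorm_le_bound ℝ k (l + 1) _ (apply_nonneg _ _) fun x => ?_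
    rw [← e]
    exact SchwartzMap.le_seminorm ℝ k l _ x

/-- The seminorm of index (0, 1) dominates all first derivatives uniformly in t, so differentiation
under the integral sign applies. -/
theorem hasFDerivAt_integral_schwartz {F : X → 𝓢(E, V)} (hF : Continuous F)
    (hi : ∀ k l, Integrable (fun x => SchwartzMap.seminorm ℝ k l (F x)) μ) (t : E) :
    HasFDerivAt (fun t => ∫ x, F x t ∂μ) (∫ x, fderivCLM ℝ E V (F x) t ∂μ) t := by
  have hF' : Continuous fun x => fderivCLM ℝ E V (F x) := (fderivCLM ℝ E V).continuous.comp hF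
  have hi' : ∀ k l, Integrable (fun x => SchwartzMap.seminorm ℝ k l (fderivCLM ℝ E V (F x))) μ := by
    intro k l
    simpa only [seminorm_fderivCLM] using hi k (l + 1)
  refine hasFDerivAt_integral_of_dominated_of_fderiv_le (𝕜 := ℝ) (s := Set.univ) Filter.univ_mem
    (.of_forall fun z => (integrable_eval hF hi z).aestronglyMeasurable)
    (integrable_eval hF hi t) (F' := fun z x => fderivCLM ℝ E V (F x) z)
    (integrable_eval hF' hi' t).aestronglyMeasurable
    (.of_forall fun x z _ => ?_) (hi 0 1) (.of_forall fun x z _ => ?_)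
  · rw [← seminorm_fderivCLM]
    exact SchwartzMap.norm_le_seminorm ℝ _ z
  · exact (F x).hasFDerivAt z

/-- The induction replaces F by its derivative, whose values lie in `E →L[ℝ] V`; the target space
therefore has to vary with l. -/
theorem iteratedFDeriv_integral_schwartz (l : ℕ) : ∀ {V : Type} [NormedAddCommGroup V]
    [NormedSpace ℝ V] [CompleteSpace V] {F : X → 𝓢(E, V)} (_ : Continuous F)
    (_ : ∀ k l, Integrable (fun x => SchwartzMap.seminorm ℝ k l (F x)) μ),
    ContDiff ℝ l (fun t => ∫ x, F x t ∂μ) ∧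
      ∀ t, jetAt l (fun t => ∫ x, F x t ∂μ) t = ∫ x, jetAt l (F x) t ∂μ := by
  induction l with
  | zero =>
    intro V _ _ _ F hF hi
    refine ⟨contDiff_zero.2 (continuous_iff_continuousAt.2 fun z =>
      (hasFDerivAt_integral_schwartz hF hi z).continuousAt), fun t => ?_⟩
    exact ((jetZero V).toContinuousLinearEquiv.integral_comp_comm (fun x => F x t)).symm
  | succ l ih =>
    intro V _ _ _ F hF hi
    have hF' : Continuous fun x => fderivCLM ℝ E V (F x) := (fderivCLM ℝ E V).continuous.comp hF
    have hi' : ∀ k l,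
        Integrable (fun x => SchwartzMap.seminorm ℝ k l (fderivCLM ℝ E V (F x))) μ := by
      intro k l
      simpa only [seminorm_fderivCLM] using hi k (l + 1)
    have e : fderiv ℝ (fun t => ∫ x, F x t ∂μ) = fun t => ∫ x, fderivCLM ℝ E V (F x) t ∂μ :=
      funext fun z => (hasFDerivAt_integral_schwartz hF hi z).fderiv
    obtain ⟨h1, h2⟩ := ih hF' hi'
    constructor
    · push_cast
      rw [contDiff_succ_iff_fderiv]
      refine ⟨fun z => (hasFDerivAt_integral_schwartz hF hi z).differentiableAt, by simp, ?_⟩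
      rw [e]
      exact h1
    · intro t
      have h : ∀ f : E → V, jetAt (l + 1) f t = jetSucc V l (jetAt l (fderiv ℝ f) t) :=
        fun f => iteratedFDeriv_succ_eq_comp_right
      simp only [h]
      rw [e, h2]
      exact ((jetSucc V l).toContinuousLinearEquiv.integral_comp_comm _).symm

/-- The integral of a continuous family of Schwartz functions with integrable seminorms. -/
noncomputable def schwartzIntegral [CompleteSpace V] (F : X → 𝓢(E, V)) (hF : Continuous F)
    (hi : ∀ k l, Integrable (fun x => SchwartzMap.seminorm ℝ k l (F x)) μ) : 𝓢(E, V) where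
  toFun t := ∫ x, F x t ∂μ
  smooth' := contDiff_infty.2 fun n => (iteratedFDeriv_integral_schwartz n hF hi).1
  decay' k l := ⟨∫ x, SchwartzMap.seminorm ℝ k l (F x) ∂μ, fun t => by
    change ‖t‖ ^ k * ‖jetAt l _ t‖ ≤ _
    rw [(iteratedFDeriv_integral_schwartz l hF hi).2, ← norm_norm t, ← norm_pow, ← norm_smul,
      ← integral_smul]
    refine norm_integral_le_of_norm_le (hi k l) (.of_forall fun x => ?_)
    rw [norm_smul, norm_pow, norm_norm]
    exact SchwartzMap.le_seminorm ℝ k l (F x) t⟩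

theorem integrable_comp_schwartz {F : X → 𝓢(E, V)} (hF : Continuous F)
    (hi : ∀ k l, Integrable (fun x => SchwartzMap.seminorm ℝ k l (F x)) μ)
    (u : 𝓢(E, V) →L[ℝ] ℂ) : Integrable (fun x => u (F x)) μ := by
  obtain ⟨s, C, -, hC⟩ := Seminorm.bound_of_continuous (schwartz_withSeminorms ℝ E V)
    ((normSeminorm ℝ ℂ).comp u.toLinearMap) (continuous_norm.comp u.continuous)
  refine ((integrable_finsetSum s fun i _ => hi i.1 i.2).const_mul (C : ℝ)).mono'
    (u.continuous.comp hF).aestronglyMeasurable (.of_forall fun x => (hC (F x)).trans ?_)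
  change (C : ℝ) * _ ≤ _
  gcongr
  refine (Seminorm.finset_sup_le_sum _ s (F x)).trans (le_of_eq ?_)
  change FunLike.coeAddMonoidHom _ _ _ (∑ i ∈ s, schwartzSeminormFamily ℝ E V i) (F x) = _
  rw [map_sum, Finset.sum_apply]
  rfl

/-- After factoring u through jets, the Bochner integral commutes with the extended functional.
Evaluating at points identifies the integral of the jets with the jet of the pointwise integral Ψ.
-/
theorem clm_real_integral_schwartz [CompleteSpace V] {F : X → 𝓢(E, V)} (hF : Continuous F)
    (hi : ∀ k l, Integrable (fun x => SchwartzMap.seminorm ℝ k l (F x)) μ)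
    {Ψ : 𝓢(E, V)} (hΨ : ∀ t, Ψ t = ∫ x, F x t ∂μ) (u : 𝓢(E, V) →L[ℝ] ℝ) :
    u Ψ = ∫ x, u (F x) ∂μ := by
  obtain ⟨s, U, hU⟩ := exists_factor_jet u
  simp only [hU]
  have hint : Integrable (fun x => fun i : s => jet V i.1.1 i.1.2 (F x)) μ :=
    Integrable.of_eval fun i => integrable_jet hF hi _ _
  rw [U.integral_comp_comm hint]
  congr 1
  funext i
  rw [eval_integral (fun i => integrable_jet hF hi _ _)]
  ext1 t
  have h := (BoundedContinuousFunction.evalCLM ℝ t).integral_comp_comm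
    (integrable_jet hF hi i.1.1 i.1.2)
  simp only [BoundedContinuousFunction.evalCLM_apply, jet_apply] at h
  rw [← h, integral_smul, jet_apply, ← (iteratedFDeriv_integral_schwartz i.1.2 hF hi).2,
    ← funext hΨ]

/-- Continuous real-linear functionals commute with integrals of Schwartz functions. -/
theorem clm_integral_schwartz [CompleteSpace V] {F : X → 𝓢(E, V)} (hF : Continuous F)
    (hi : ∀ k l, Integrable (fun x => SchwartzMap.seminorm ℝ k l (F x)) μ)
    {Ψ : 𝓢(E, V)} (hΨ : ∀ t, Ψ t = ∫ x, F x t ∂μ) (u : 𝓢(E, V) →L[ℝ] ℂ) :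
    u Ψ = ∫ x, u (F x) ∂μ := by
  have h1 := clm_real_integral_schwartz hF hi hΨ (Complex.reCLM ∘L u)
  have h2 := clm_real_integral_schwartz hF hi hΨ (Complex.imCLM ∘L u)
  have hu := integrable_comp_schwartz hF hi u
  simp only [ContinuousLinearMap.comp_apply] at h1 h2
  rw [Complex.reCLM.integral_comp_comm hu] at h1
  rw [Complex.imCLM.integral_comp_comm hu] at h2
  exact Complex.ext h1 h2

end SchwartzIntegral

/-! ### Continuity and polynomial growth of phase-space shifts on Schwartz space. -/

section PhaseSpaceShifts

variable {E : Type} [NormedAddCommGroup E] [InnerProductSpace ℝ E]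

/-- Families of maps of `𝓢` whose seminorm bounds grow at most polynomially in the parameter. -/
def HasPolyBound {Z : Type*} [NormedAddCommGroup Z] (A : Z → 𝓢(E, ℂ) → 𝓢(E, ℂ)) : Prop :=
  ∀ k l : ℕ, ∃ (N : ℕ) (s : Finset (ℕ × ℕ)) (C : ℝ), 0 ≤ C ∧ ∀ z φ,
    SchwartzMap.seminorm ℝ k l (A z φ) ≤
      C * (1 + ‖z‖) ^ N * (s.sup (schwartzSeminormFamily ℝ E ℂ)) φ

theorem HasPolyBound.sup {Z : Type*} [NormedAddCommGroup Z] {A : Z → 𝓢(E, ℂ) → 𝓢(E, ℂ)}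
    (h : HasPolyBound A) (t : Finset (ℕ × ℕ)) :
    ∃ (N : ℕ) (s : Finset (ℕ × ℕ)) (C : ℝ), 0 ≤ C ∧ ∀ z φ,
      (t.sup (schwartzSeminormFamily ℝ E ℂ)) (A z φ) ≤
        C * (1 + ‖z‖) ^ N * (s.sup (schwartzSeminormFamily ℝ E ℂ)) φ := by
  classical
  induction t using Finset.induction_on with
  | empty => exact ⟨0, ∅, 0, le_rfl, fun z φ => by simp⟩
  | insert a t _ ih =>
    obtain ⟨N₁, s₁, C₁, hC₁, h₁⟩ := ih
    obtain ⟨N₂, s₂, C₂, hC₂, h₂⟩ := h a.1 a.2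
    refine ⟨max N₁ N₂, s₁ ∪ s₂, max C₁ C₂, le_max_of_le_left hC₁, fun z φ => ?_⟩
    have hz : 1 ≤ 1 + ‖z‖ := by linarith [norm_nonneg z]
    rw [Finset.sup_insert, Seminorm.sup_apply]
    refine max_le ?_ ?_
    · rw [SchwartzMap.schwartzSeminormFamily_apply]
      refine (h₂ z φ).trans ?_
      gcongr
      · exact le_max_right _ _
      · exact le_max_right _ _
      · exact (Finset.sup_mono Finset.subset_union_right :
          s₂.sup (schwartzSeminormFamily ℝ E ℂ) ≤ _) φ
    · refine (h₁ z φ).trans ?_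
      gcongr
      · exact le_max_left _ _
      · exact le_max_left _ _
      · exact (Finset.sup_mono Finset.subset_union_left :
          s₁.sup (schwartzSeminormFamily ℝ E ℂ) ≤ _) φ

theorem HasPolyBound.comp {Z : Type*} [NormedAddCommGroup Z] {A B : Z → 𝓢(E, ℂ) → 𝓢(E, ℂ)}
    (hA : HasPolyBound A) (hB : HasPolyBound B) : HasPolyBound fun z φ => A z (B z φ) := by
  intro k l
  obtain ⟨N₁, s₁, C₁, hC₁, h₁⟩ := hA k l
  obtain ⟨N₂, s₂, C₂, hC₂, h₂⟩ := hB.sup s₁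
  refine ⟨N₁ + N₂, s₂, C₁ * C₂, by positivity, fun z φ => (h₁ z _).trans ?_⟩
  calc _ ≤ C₁ * (1 + ‖z‖) ^ N₁ *
        (C₂ * (1 + ‖z‖) ^ N₂ * (s₂.sup (schwartzSeminormFamily ℝ E ℂ)) φ) := by
        gcongr
        exact h₂ z φ
    _ = _ := by rw [pow_add]; ring

theorem HasPolyBound.comp_of_le {Z Z' : Type*} [NormedAddCommGroup Z] [NormedAddCommGroup Z']
    {A : Z → 𝓢(E, ℂ) → 𝓢(E, ℂ)} (hA : HasPolyBound A) (a : Z' → Z) (ha : ∀ z, ‖a z‖ ≤ ‖z‖) :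
    HasPolyBound fun z φ => A (a z) φ := by
  intro k l
  obtain ⟨N₁, s₁, C₁, hC₁, h₁⟩ := hA k l
  refine ⟨N₁, s₁, C₁, hC₁, fun z φ => (h₁ _ _).trans ?_⟩
  gcongr
  exact ha z

theorem hasPolyBound_clm {Z : Type*} [NormedAddCommGroup Z] (L : 𝓢(E, ℂ) →L[ℝ] 𝓢(E, ℂ)) :
    HasPolyBound fun (_ : Z) φ => L φ := by
  intro k l
  obtain ⟨s, C, -, hC⟩ := Seminorm.bound_of_continuous (schwartz_withSeminorms ℝ E ℂ)
    ((schwartzSeminormFamily ℝ E ℂ (k, l)).comp L.toLinearMap)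
    (((schwartz_withSeminorms ℝ E ℂ).continuous_seminorm (k, l)).comp L.continuous)
  refine ⟨0, s, C, C.2, fun z φ => ?_⟩
  rw [pow_zero, mul_one]
  exact hC φ

theorem jetAt_compSubConst (l : ℕ) (a : E) (φ : 𝓢(E, ℂ)) (t : E) :
    jetAt l (compSubConstCLM ℂ a φ) t = jetAt l φ (t - a) := by
  have : (compSubConstCLM ℂ a φ : E → ℂ) = fun x => φ (x - a) := by
    funext x
    exact compSubConstCLM_apply ..
  rw [this]
  exact iteratedFDeriv_comp_sub l a t

/-- Peetre-type inequality: ‖t‖ ≤ (1 + ‖a‖)(1 + ‖t - a‖) moves the polynomial weight onto the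
translated variable. -/
theorem hasPolyBound_compSubConst :
    HasPolyBound fun (a : E) (φ : 𝓢(E, ℂ)) => compSubConstCLM ℂ a φ := by
  intro k l
  refine ⟨k, Finset.Iic (k, l), 2 ^ k, by positivity, fun a φ => ?_⟩
  refine SchwartzMap.seminorm_le_bound ℝ k l _ (by positivity) fun t => ?_
  change ‖t‖ ^ k * ‖jetAt l _ t‖ ≤ _
  rw [jetAt_compSubConst]
  have h := SchwartzMap.one_add_le_sup_seminorm_apply (𝕜 := ℝ) (m := (k, l)) le_rfl le_rfl φ (t - a)
  have ht : ‖t‖ ≤ (1 + ‖a‖) * (1 + ‖t - a‖) := by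
    have := norm_add_le (t - a) a
    rw [sub_add_cancel] at this
    nlinarith [norm_nonneg a, norm_nonneg (t - a)]
  calc ‖t‖ ^ k * ‖jetAt l φ (t - a)‖
      ≤ ((1 + ‖a‖) * (1 + ‖t - a‖)) ^ k * ‖jetAt l φ (t - a)‖ := by gcongr
    _ = (1 + ‖a‖) ^ k * ((1 + ‖t - a‖) ^ k * ‖jetAt l φ (t - a)‖) := by rw [mul_pow]; ring
    _ ≤ (1 + ‖a‖) ^ k * (2 ^ k * ((Finset.Iic (k, l)).sup
          fun m => SchwartzMap.seminorm ℝ m.1 m.2) φ) := mul_le_mul_of_nonneg_left h (by positivity)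
    _ = _ := by rw [← mul_assoc, mul_comm ((1 + ‖a‖) ^ k)]; rfl

theorem hasFDerivAt_jetAt (l : ℕ) (φ : 𝓢(E, ℂ)) (t : E) :
    ∃ D : E →L[ℝ] Jet E ℂ l, HasFDerivAt (jetAt l φ) D t ∧ ‖D‖ = ‖jetAt (l + 1) φ t‖ := by
  have h : HasFDerivAt (iteratedFDeriv ℝ l φ) (fderiv ℝ (iteratedFDeriv ℝ l φ) t) t :=
    ((φ.smooth ⊤).differentiable_iteratedFDeriv (mod_cast WithTop.coe_lt_top l) t).hasFDerivAt
  exact ⟨fderiv ℝ (iteratedFDeriv ℝ l φ) t, h, norm_fderiv_iteratedFDeriv⟩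

theorem continuous_schwartz_iff {X : Type*} [TopologicalSpace X] {F : X → 𝓢(E, ℂ)} :
    Continuous F ↔ ∀ x₀ k l, Tendsto (fun x => SchwartzMap.seminorm ℝ k l (F x - F x₀))
      (𝓝 x₀) (𝓝 0) := by
  rw [continuous_iff_continuousAt]
  refine forall_congr' fun x₀ => ?_
  rw [ContinuousAt, (schwartz_withSeminorms ℝ E ℂ).tendsto_nhds]
  constructor
  · intro h k l
    rw [Metric.tendsto_nhds]
    intro ε hε
    filter_upwards [h (k, l) ε hε] with x hx
    rw [Real.dist_0_eq_abs, abs_of_nonneg (apply_nonneg _ _)]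
    exact hx
  · rintro h ⟨k, l⟩ ε hε
    exact (h k l).eventually_lt_const hε

/-- Mean value inequality in the translation parameter c: the derivative of ‖t‖^k D^l φ(t - c) in c
is bounded, uniformly in t, by the (k, l + 1) seminorm of a translate of φ, which is bounded for c
near b. -/
theorem continuous_compSubConst (φ : 𝓢(E, ℂ)) :
    Continuous fun a : E => compSubConstCLM ℂ a φ := by
  rw [continuous_schwartz_iff]
  intro b k l
  obtain ⟨N, s, C, hC, h⟩ := hasPolyBound_compSubConst (E := E) k (l + 1)
  set q := (s.sup (schwartzSeminormFamily ℝ E ℂ)) φ with hq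
  have hq0 : 0 ≤ q := apply_nonneg _ _
  -- The constant 2 + ‖b‖ bounds 1 + ‖c‖ for every c in the unit ball about b.
  have hlim : Tendsto (fun a : E => C * (2 + ‖b‖) ^ N * q * ‖a - b‖) (𝓝 b) (𝓝 0) := by
    have : Tendsto (fun a : E => C * (2 + ‖b‖) ^ N * q * ‖a - b‖) (𝓝 b)
        (𝓝 (C * (2 + ‖b‖) ^ N * q * ‖b - b‖)) := Continuous.tendsto (by fun_prop) b
    simpa using this
  refine squeeze_zero' (.of_forall fun _ => apply_nonneg _ _) ?_ hlim
  filter_upwards [Metric.ball_mem_nhds b one_pos] with a ha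
  refine SchwartzMap.seminorm_le_bound ℝ k l _ (by positivity) fun t => ?_
  change ‖t‖ ^ k * ‖jetAt l _ t‖ ≤ _
  have e : jetAt l (compSubConstCLM ℂ a φ - compSubConstCLM ℂ b φ : 𝓢(E, ℂ)) t
      = jetAt l φ (t - a) - jetAt l φ (t - b) := by
    have h1 := jetAt_add l (compSubConstCLM ℂ a φ) ((-1 : ℝ) • compSubConstCLM ℂ b φ) t
    rw [jetAt_smul, jetAt_compSubConst, jetAt_compSubConst, neg_one_smul, neg_one_smul,
      ← sub_eq_add_neg, ← sub_eq_add_neg] at h1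
    exact h1
  choose D hD hDn using hasFDerivAt_jetAt l φ
  have hmv := (convex_ball b 1).norm_image_sub_le_of_norm_hasFDerivWithin_le
    (f := fun c : E => ‖t‖ ^ k • jetAt l φ (t - c))
    (f' := fun c => ‖t‖ ^ k • ((D (t - c)).comp (-ContinuousLinearMap.id ℝ E)))
    (C := C * (2 + ‖b‖) ^ N * q)
    (fun c _ => by
      have h1 : HasFDerivAt (fun c : E => t - c) (-ContinuousLinearMap.id ℝ E) c :=
        (hasFDerivAt_id c).const_sub t
      exact (((hD (t - c)).comp c h1).const_smul (‖t‖ ^ k)).hasFDerivWithinAt)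
    (fun c hc => by
      have hc1 : ‖c‖ ≤ 1 + ‖b‖ := by
        have := norm_add_le (c - b) b
        rw [sub_add_cancel] at this
        have h2 : ‖c - b‖ < 1 := by rwa [← dist_eq_norm]
        linarith
      calc ‖‖t‖ ^ k • ((D (t - c)).comp (-ContinuousLinearMap.id ℝ E))‖
          = ‖t‖ ^ k * ‖(D (t - c)).comp (-ContinuousLinearMap.id ℝ E)‖ := by
            rw [norm_smul, norm_pow, norm_norm]
        _ ≤ ‖t‖ ^ k * ‖D (t - c)‖ := by
            gcongr
            refine ContinuousLinearMap.opNorm_le_bound _ (norm_nonneg _) fun x => ?_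
            refine ((D (t - c)).le_opNorm _).trans (by simp)
        _ = ‖t‖ ^ k * ‖jetAt (l + 1) (compSubConstCLM ℂ c φ) t‖ := by
            rw [hDn, jetAt_compSubConst]
        _ ≤ SchwartzMap.seminorm ℝ k (l + 1) (compSubConstCLM ℂ c φ) :=
            pow_mul_norm_jetAt_le ..
        _ ≤ C * (1 + ‖c‖) ^ N * q := h c φ
        _ ≤ C * (2 + ‖b‖) ^ N * q := by
            have : 1 + ‖c‖ ≤ 2 + ‖b‖ := by linarith
            gcongr)
    (Metric.mem_ball_self one_pos) ha
  rw [e]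
  rwa [← smul_sub, norm_smul, norm_pow, norm_norm] at hmv

theorem continuous_sup_schwartzSeminorm (s : Finset (ℕ × ℕ)) :
    Continuous fun φ : 𝓢(E, ℂ) => (s.sup (schwartzSeminormFamily ℝ E ℂ)) φ := by
  classical
  induction s using Finset.induction_on with
  | empty => simpa using continuous_const
  | insert a s _ ih =>
    rw [Finset.sup_insert]
    exact ((schwartz_withSeminorms ℝ E ℂ).continuous_seminorm a).sup ih

theorem continuous_compSubConst_joint {X : Type*} [TopologicalSpace X] {a : X → E}
    (ha : Continuous a) {F : X → 𝓢(E, ℂ)} (hF : Continuous F) :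
    Continuous fun x => compSubConstCLM ℂ (a x) (F x) := by
  rw [continuous_schwartz_iff]
  intro x₀ k l
  obtain ⟨N, s, C, hC, h⟩ := hasPolyBound_compSubConst (E := E) k l
  have h1 : Tendsto (fun x => C * (1 + ‖a x‖) ^ N *
      (s.sup (schwartzSeminormFamily ℝ E ℂ)) (F x - F x₀)) (𝓝 x₀) (𝓝 0) := by
    have hc : Continuous fun x => C * (1 + ‖a x‖) ^ N *
        (s.sup (schwartzSeminormFamily ℝ E ℂ)) (F x - F x₀) := by
      refine Continuous.mul (by fun_prop) ?_
      exact (continuous_sup_schwartzSeminorm s).comp (hF.sub continuous_const)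
    simpa using hc.tendsto x₀
  have h2 := ((continuous_schwartz_iff.1 ((continuous_compSubConst (F x₀)).comp ha)) x₀ k l)
  have h3 := h1.add h2
  rw [add_zero] at h3
  refine squeeze_zero (fun _ => apply_nonneg _ _) (fun x => ?_) h3
  -- The first term is controlled by locally uniform boundedness of translations, the second by
  -- continuity of the orbit of the fixed function F x₀.
  have e : compSubConstCLM ℂ (a x) (F x) - compSubConstCLM ℂ (a x₀) (F x₀)
      = compSubConstCLM ℂ (a x) (F x - F x₀)
        + (compSubConstCLM ℂ (a x) (F x₀) - compSubConstCLM ℂ (a x₀) (F x₀)) := by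
    rw [map_sub]; abel
  rw [e]
  exact (map_add_le_add _ _ _).trans (add_le_add (h _ _) le_rfl)

variable [FiniteDimensional ℝ E] [MeasurableSpace E] [BorelSpace E]

/-- Modulation is translation conjugated by the Fourier transform, so every estimate for phase-space
shifts follows from the one for translations. -/
theorem smulLeft_character_eq (w : E) (φ : 𝓢(E, ℂ)) :
    smulLeftCLM ℂ (fun t : E => ((𝐞 ⟪w, t⟫_ℝ : Circle) : ℂ)) φ
      = 𝓕⁻ (compSubConstCLM ℂ w (𝓕 φ)) := by
  have : 𝓕 (smulLeftCLM ℂ (fun t : E => ((𝐞 ⟪w, t⟫_ℝ : Circle) : ℂ)) φ)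
      = compSubConstCLM ℂ w (𝓕 φ) := by
    ext ξ
    rw [compSubConstCLM_apply, SchwartzMap.fourier_coe, SchwartzMap.fourier_coe,
      Real.fourier_eq, Real.fourier_eq]
    congr 1
    funext t
    rw [smulLeftCLM_apply_apply (character_hasTemperateGrowth w), Circle.smul_def, Circle.smul_def,
      smul_smul, ← Circle.coe_mul, ← AddChar.map_add_eq_mul]
    congr 3
    rw [inner_sub_right, real_inner_comm w t]
    ring
  rw [← this, FourierTransform.fourierInv_fourier_eq]

theorem tfShift_eq (z : Phase E) (φ : 𝓢(E, ℂ)) :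
    tfShift z φ = 𝓕⁻ (compSubConstCLM ℂ z.snd (𝓕 (compSubConstCLM ℂ z.fst φ))) :=
  smulLeft_character_eq z.snd _

theorem continuous_tfShift {X : Type*} [TopologicalSpace X] {a : X → Phase E}
    (ha : Continuous a) {F : X → 𝓢(E, ℂ)} (hF : Continuous F) :
    Continuous fun x => tfShift (a x) (F x) := by
  simp only [tfShift_eq]
  have h1 : Continuous fun φ : 𝓢(E, ℂ) => 𝓕 φ := (FourierTransform.fourierCLM ℂ 𝓢(E, ℂ)).continuous
  have h2 : Continuous fun φ : 𝓢(E, ℂ) => 𝓕⁻ φ :=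
    (FourierTransform.fourierInvCLM ℂ 𝓢(E, ℂ)).continuous
  refine h2.comp (continuous_compSubConst_joint (by fun_prop) (h1.comp ?_))
  exact continuous_compSubConst_joint (by fun_prop) hF

theorem hasPolyBound_tfShift :
    HasPolyBound fun (z : Phase E) (φ : 𝓢(E, ℂ)) => tfShift z φ := by
  have h1 : HasPolyBound fun (z : Phase E) (φ : 𝓢(E, ℂ)) => compSubConstCLM ℂ z.fst φ :=
    hasPolyBound_compSubConst.comp_of_le _ (WithLp.norm_fst_le E)
  have h2 : HasPolyBound fun (z : Phase E) (φ : 𝓢(E, ℂ)) => compSubConstCLM ℂ z.snd φ :=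
    hasPolyBound_compSubConst.comp_of_le _ (WithLp.norm_snd_le E)
  have h3 : HasPolyBound fun (_ : Phase E) (φ : 𝓢(E, ℂ)) => 𝓕 φ :=
    hasPolyBound_clm ((FourierTransform.fourierCLM ℂ 𝓢(E, ℂ)).restrictScalars ℝ)
  have h4 : HasPolyBound fun (_ : Phase E) (φ : 𝓢(E, ℂ)) => 𝓕⁻ φ :=
    hasPolyBound_clm ((FourierTransform.fourierInvCLM ℂ 𝓢(E, ℂ)).restrictScalars ℝ)
  simp only [tfShift_eq]
  exact h4.comp (h2.comp (h3.comp h1))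

/-- The Weyl relation: shifts compose up to a unimodular factor, which disappears from all later
estimates. -/
theorem tfShift_tfShift (z w : Phase E) (φ : 𝓢(E, ℂ)) :
    tfShift z (tfShift w φ) = ((𝐞 (-⟪w.snd, z.fst⟫_ℝ) : Circle) : ℂ) • tfShift (z + w) φ := by
  ext t
  rw [smul_apply, smul_eq_mul, tfShift_apply, tfShift_apply, tfShift_apply, ← mul_assoc,
    ← mul_assoc, ← Circle.coe_mul, ← Circle.coe_mul, ← AddChar.map_add_eq_mul,
    ← AddChar.map_add_eq_mul]
  have h : t - z.fst - w.fst = t - (z + w).fst := by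
    rw [WithLp.add_fst]
    abel
  rw [h, WithLp.add_snd, inner_sub_right, inner_add_left]
  ring_nf

end PhaseSpaceShifts

/-! ### The short-time Fourier transform: inversion, covariance, change of window. -/

section ShortTimeFourier

variable {E : Type} [NormedAddCommGroup E] [InnerProductSpace ℝ E]

/-- Tempered distributions as real-linear functionals. -/
noncomputable def realFunctional (f : 𝓢'(E, ℂ)) : 𝓢(E, ℂ) →L[ℝ] ℂ where
  toFun h := f h
  map_add' h₁ h₂ := map_add f h₁ h₂
  map_smul' a h := by
    have : a • h = (a : ℂ) • h := by
      ext x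
      simp
    rw [this, map_smul, RingHom.id_apply, Complex.coe_smul]
  cont := (f : 𝓢(E, ℂ) →L[ℂ] ℂ).continuous

theorem conjS_conjS (f : 𝓢(E, ℂ)) : conjS (conjS f) = f := by
  ext x
  simp [conjS_apply]

variable [FiniteDimensional ℝ E] [MeasurableSpace E] [BorelSpace E]

/-- The `L²` pairing, conjugate-linear in the second argument. -/
noncomputable def pair (f g : 𝓢(E, ℂ)) : ℂ := ∫ t, f t * starRingEnd ℂ (g t)

theorem conj_pair (f g : 𝓢(E, ℂ)) : starRingEnd ℂ (pair f g) = pair g f := by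
  rw [pair, pair, ← integral_conj]
  congr 1
  funext t
  rw [map_mul, Complex.conj_conj, mul_comm]

theorem norm_pair_comm (f g : 𝓢(E, ℂ)) : ‖pair f g‖ = ‖pair g f‖ := by
  rw [← conj_pair, RCLike.norm_conj]

theorem coe_conjS_eq_pair (f h : 𝓢(E, ℂ)) : (f : 𝓢'(E, ℂ)) (conjS h) = pair f h := by
  rw [SchwartzMap.coe_apply, pair]
  congr 1
  funext t
  rw [smul_eq_mul, mul_comm, conjS_apply]

theorem stft_coe (g f : 𝓢(E, ℂ)) (z : Phase E) :
    stft g (f : 𝓢'(E, ℂ)) z = pair f (tfShift z g) := coe_conjS_eq_pair f _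

/-- The change of variables `(x, t) ↦ (t, t - x)`. -/
noncomputable def stftShear : Phase E ≃L[ℝ] Phase E where
  toFun z := WithLp.toLp 2 (z.snd, z.snd - z.fst)
  invFun z := WithLp.toLp 2 (z.fst - z.snd, z.fst)
  map_add' z w := by
    apply WithLp.ofLp_injective
    ext <;> simp
    module
  map_smul' a z := by
    apply WithLp.ofLp_injective
    ext <;> simp
    module
  left_inv z := by
    apply WithLp.ofLp_injective
    ext <;> simp
  right_inv z := by
    apply WithLp.ofLp_injective
    ext <;> simp
  continuous_toFun := by fun_prop
  continuous_invFun := by fun_prop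

/-- The short-time Fourier transform of a Schwartz function as a Schwartz function. -/
noncomputable def stftS (γ : 𝓢(E, ℂ)) : 𝓢(E, ℂ) →L[ℂ] 𝓢(Phase E, ℂ) :=
  partialFourier ∘L compCLMOfContinuousLinearEquiv ℂ stftShear ∘L tensor (conjS γ)

theorem stftS_apply (γ h : 𝓢(E, ℂ)) (z : Phase E) : stftS γ h z = pair h (tfShift z γ) := by
  have : stftS γ h z = ∫ t : E, ((𝐞 (-⟪t, z.snd⟫_ℝ) : Circle) : ℂ) *
      (h t * starRingEnd ℂ (γ (t - z.fst))) := rfl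
  rw [this, pair]
  congr 1
  funext t
  rw [tfShift_apply, map_mul, ← Circle.coe_inv_eq_conj, ← AddChar.map_neg_eq_inv,
    real_inner_comm]
  ring

theorem stft_coe_eq_stftS (g f : 𝓢(E, ℂ)) (z : Phase E) :
    stft g (f : 𝓢'(E, ℂ)) z = stftS g f z := by
  rw [stft_coe, stftS_apply]

/-- Restriction of a Schwartz function on `E × E` to `{x} × E`. -/
noncomputable def slice (x : E) : 𝓢(Phase E, ℂ) →L[ℂ] 𝓢(E, ℂ) :=
  compCLM ℂ (g := fun y : E => WithLp.toLp 2 (x, y))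
    (by
      have : (fun y : E => WithLp.toLp 2 (x, y))
          = fun y => WithLp.toLp 2 (x, (0 : E)) + inrL y := by
        funext y; simp only [inrL_apply, ← WithLp.toLp_add]; simp
      rw [this]
      exact (Function.HasTemperateGrowth.const _).add
        (inrL : E →L[ℝ] Phase E).hasTemperateGrowth)
    ⟨1, 1, fun y => by
      have := WithLp.norm_snd_le E (WithLp.toLp 2 (x, y))
      have h2 : ‖y‖ ≤ ‖WithLp.toLp 2 (x, y)‖ := this
      rw [pow_one, one_mul]
      linarith⟩

theorem slice_apply (x : E) (F : 𝓢(Phase E, ℂ)) (y : E) :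
    slice x F y = F (WithLp.toLp 2 (x, y)) := rfl

theorem partialFourier_eq_fourier_slice (F : 𝓢(Phase E, ℂ)) (x y : E) :
    partialFourier F (WithLp.toLp 2 (x, y)) = 𝓕 (slice x F) y := by
  rw [partialFourier_apply, SchwartzMap.fourier_coe, Real.fourier_eq]
  rfl

theorem integral_partialFourier_mul (F : 𝓢(Phase E, ℂ)) (x t : E) :
    ∫ y, partialFourier F (WithLp.toLp 2 (x, y)) * ((𝐞 ⟪y, t⟫_ℝ : Circle) : ℂ)
      = F (WithLp.toLp 2 (x, t)) := by
  have h : 𝓕⁻ (𝓕 (slice x F)) t = slice x F t := by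
    rw [FourierTransform.fourierInv_fourier_eq]
  rw [SchwartzMap.fourierInv_coe, Real.fourierInv_eq] at h
  rw [← slice_apply, ← h]
  congr 1
  funext y
  rw [partialFourier_eq_fourier_slice, Circle.smul_def, smul_eq_mul, mul_comm]

theorem integral_phase {V : Type*} [NormedAddCommGroup V] [NormedSpace ℝ V] {f : Phase E → V}
    (hf : Integrable f) :
    ∫ z, f z = ∫ x : E, ∫ y : E, f (WithLp.toLp 2 (x, y)) := by
  have hmp := WithLp.volume_preserving_toLp E E
  have hme : MeasurableEmbedding (WithLp.toLp 2 : E × E → Phase E) :=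
    (MeasurableEquiv.toLp 2 (E × E)).measurableEmbedding
  rw [← hmp.integral_comp hme, Measure.volume_eq_prod, integral_prod]
  have := (hmp.integrable_comp_emb hme).2 hf
  rwa [Measure.volume_eq_prod] at this

theorem integrable_one_add_pow_mul {D : Type} [NormedAddCommGroup D] [InnerProductSpace ℝ D]
    [FiniteDimensional ℝ D] [MeasurableSpace D] [BorelSpace D] (f : 𝓢(D, ℂ)) (N : ℕ) :
    Integrable fun z => (1 + ‖z‖) ^ N * ‖f z‖ := by
  have h := (f.integrable.norm.add (f.integrable_pow_mul volume N)).const_mul (2 ^ (N - 1) : ℝ)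
  refine h.mono' (by fun_prop) (.of_forall fun z => ?_)
  rw [Real.norm_of_nonneg (by positivity)]
  have := add_pow_le zero_le_one (norm_nonneg z) N
  rw [one_pow] at this
  calc (1 + ‖z‖) ^ N * ‖f z‖ ≤ 2 ^ (N - 1) * (1 + ‖z‖ ^ N) * ‖f z‖ := by gcongr
    _ = _ := by simp only [Pi.add_apply]; ring

theorem continuous_smul_tfShift (F : 𝓢(Phase E, ℂ)) (g : 𝓢(E, ℂ)) :
    Continuous fun z => F z • tfShift z g :=
  F.continuous.smul (continuous_tfShift continuous_id continuous_const)

theorem integrable_seminorm_smul_tfShift (F : 𝓢(Phase E, ℂ)) (g : 𝓢(E, ℂ)) (k l : ℕ) :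
    Integrable fun z => SchwartzMap.seminorm ℝ k l (F z • tfShift z g) := by
  obtain ⟨N, s, C, hC, h⟩ := hasPolyBound_tfShift (E := E) k l
  refine ((integrable_one_add_pow_mul F N).const_mul
    (C * (s.sup (schwartzSeminormFamily ℝ E ℂ)) g)).mono'
    ((((schwartz_withSeminorms ℝ E ℂ).continuous_seminorm (k, l)).comp
      (continuous_smul_tfShift F g)).aestronglyMeasurable) (.of_forall fun z => ?_)
  have e : SchwartzMap.seminorm ℝ k l (F z • tfShift z g)
      = ‖F z‖ * SchwartzMap.seminorm ℝ k l (tfShift z g) :=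
    map_smul_eq_mul (SchwartzMap.seminorm ℂ k l) (F z) (tfShift z g)
  rw [Real.norm_of_nonneg (apply_nonneg _ _), e]
  calc _ ≤ ‖F z‖ * (C * (1 + ‖z‖) ^ N * (s.sup (schwartzSeminormFamily ℝ E ℂ)) g) := by
        gcongr
        exact h z g
    _ = _ := by ring

/-- The inversion formula pointwise. Integrating first in frequency is Fourier inversion and leaves
h(t) conj(γ(t - x)) g(t - x); the integral over x then gives ⟨g, γ⟩ h(t). -/
theorem integral_stftS_mul_tfShift (γ g h : 𝓢(E, ℂ)) (t : E) :
    ∫ z, stftS γ h z * tfShift z g t = pair g γ * h t := by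
  have hi : Integrable fun z => stftS γ h z * tfShift z g t := by
    have := integrable_eval (continuous_smul_tfShift (stftS γ h) g)
      (integrable_seminorm_smul_tfShift (stftS γ h) g) t
    simpa using this
  rw [integral_phase hi, pair, ← integral_mul_const]
  have : ∀ x : E, ∫ y : E, stftS γ h (WithLp.toLp 2 (x, y)) * tfShift (WithLp.toLp 2 (x, y)) g t
      = (fun s => g s * starRingEnd ℂ (γ s) * h t) (t - x) := by
    intro x
    have e0 : ∀ y : E, stftS γ h (WithLp.toLp 2 (x, y)) * tfShift (WithLp.toLp 2 (x, y)) g t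
        = stftS γ h (WithLp.toLp 2 (x, y)) * ((𝐞 ⟪y, t⟫_ℝ : Circle) : ℂ) * g (t - x) := by
      intro y
      rw [tfShift_apply, mul_assoc]
      rfl
    simp only [e0]
    rw [integral_mul_const]
    have e := integral_partialFourier_mul
      (compCLMOfContinuousLinearEquiv ℂ stftShear (tensor (conjS γ) h)) x t
    have e2 : compCLMOfContinuousLinearEquiv ℂ stftShear (tensor (conjS γ) h) (WithLp.toLp 2 (x, t))
        = h t * starRingEnd ℂ (γ (t - x)) := rfl
    rw [e2] at e
    change (∫ y : E, partialFourier (compCLMOfContinuousLinearEquiv ℂ stftShear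
      (tensor (conjS γ) h)) (WithLp.toLp 2 (x, y)) * _) * _ = _
    rw [e]
    ring
  rw [integral_congr_ae (.of_forall this)]
  exact integral_sub_left_eq_self (fun s => g s * starRingEnd ℂ (γ s) * h t) volume t

/-- The inversion formula for the short-time Fourier transform, tested with a continuous real-linear
functional. -/
theorem stft_inversion (γ g h : 𝓢(E, ℂ)) (u : 𝓢(E, ℂ) →L[ℝ] ℂ) :
    u (pair g γ • h) = ∫ z, u (stftS γ h z • tfShift z g) :=
  clm_integral_schwartz (continuous_smul_tfShift (stftS γ h) g)
    (integrable_seminorm_smul_tfShift (stftS γ h) g)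
    (fun t => by
      simp only [smul_apply, smul_eq_mul]
      exact (integral_stftS_mul_tfShift γ g h t).symm) u

/-- The weak form of inversion for distributions, ⟨g, γ⟩⟨f, h⟩ = ∫ V_γf · conj(V_gh). The functional
h ↦ f(conj h) is conjugate-linear, which is why inversion is tested with real-linear functionals. -/
theorem pair_mul_apply_conjS (f : 𝓢'(E, ℂ)) (g γ h : 𝓢(E, ℂ)) :
    pair g γ * f (conjS h) = ∫ z, starRingEnd ℂ (stftS g h z) * stft γ f z := by
  have := stft_inversion g γ h ((realFunctional f) ∘L conjS)
  have e : ∀ (a : ℂ) (φ : 𝓢(E, ℂ)), ((realFunctional f) ∘L conjS) (a • φ)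
      = starRingEnd ℂ a * f (conjS φ) := by
    intro a φ
    change f (conjS (a • φ)) = _
    rw [conjS_smul, map_smul, smul_eq_mul]
  simp only [e] at this
  rw [conj_pair] at this
  exact this

theorem continuous_stft (g : 𝓢(E, ℂ)) (f : 𝓢'(E, ℂ)) : Continuous (stft g f) :=
  ((realFunctional f) ∘L conjS).continuous.comp (continuous_tfShift continuous_id continuous_const)

/-- Up to a phase, π(w)* π(z) is π(z - w); the substitution t ↦ t + w₁ makes this explicit. -/
theorem norm_pair_tfShift (w z : Phase E) (a b : 𝓢(E, ℂ)) :
    ‖pair (tfShift w a) (tfShift z b)‖ = ‖stftS b a (z - w)‖ := by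
  have : pair (tfShift w a) (tfShift z b)
      = ((𝐞 ⟪w.snd - z.snd, w.fst⟫_ℝ : Circle) : ℂ) * stftS b a (z - w) := by
    rw [stftS_apply, pair, pair, ← integral_const_mul,
      ← integral_add_right_eq_self _ w.fst]
    congr 1
    funext t
    simp only [tfShift_apply, map_mul, ← Circle.coe_inv_eq_conj, ← AddChar.map_neg_eq_inv]
    have h1 : t + w.fst - w.fst = t := by abel
    have h2 : t + w.fst - z.fst = t - (z - w).fst := by rw [WithLp.sub_fst]; abel
    rw [h1, h2]
    have h3 : ((𝐞 ⟪w.snd, t + w.fst⟫_ℝ : Circle) : ℂ) * ((𝐞 (-⟪z.snd, t + w.fst⟫_ℝ) : Circle) : ℂ)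
        = ((𝐞 ⟪w.snd - z.snd, w.fst⟫_ℝ : Circle) : ℂ) *
          ((𝐞 (-⟪(z - w).snd, t⟫_ℝ) : Circle) : ℂ) := by
      rw [← Circle.coe_mul, ← Circle.coe_mul, ← AddChar.map_add_eq_mul, ← AddChar.map_add_eq_mul]
      congr 2
      simp only [WithLp.sub_snd, inner_sub_left, inner_add_right]
      ring
    linear_combination (a t * starRingEnd ℂ (b (t - (z - w).fst))) * h3
  rw [this, norm_mul, Circle.norm_coe, one_mul]

theorem norm_pair_tfShift' (w z : Phase E) (a b : 𝓢(E, ℂ)) :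
    ‖pair (tfShift w a) (tfShift z b)‖ = ‖stftS a b (w - z)‖ := by
  rw [norm_pair_comm, norm_pair_tfShift]

/-- The short-time Fourier transforms with respect to two windows are related by a convolution
inequality. -/
theorem enorm_stft_le_lintegral (f : 𝓢'(E, ℂ)) (g γ g' : 𝓢(E, ℂ)) (w : Phase E) :
    ‖pair g γ‖ₑ * ‖stft g' f w‖ₑ ≤ ∫⁻ z, ‖stft γ f z‖ₑ * ‖stftS g' g (w - z)‖ₑ := by
  rw [← enorm_mul, stft, pair_mul_apply_conjS]
  refine (enorm_integral_le_lintegral_enorm _).trans (le_of_eq ?_)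
  refine lintegral_congr fun z => ?_
  have : ‖stftS g (tfShift w g') z‖ = ‖stftS g' g (w - z)‖ := by
    rw [stftS_apply, norm_pair_tfShift']
  rw [enorm_mul, mul_comm, ← ofReal_norm, ← ofReal_norm, ← ofReal_norm,
    RCLike.norm_conj, this]

theorem pair_self (g : 𝓢(E, ℂ)) : pair g g = ((∫ t, ‖g t‖ ^ 2 : ℝ) : ℂ) := by
  rw [pair, ← integral_complex_ofReal]
  congr 1
  funext t
  rw [Complex.mul_conj, Complex.normSq_eq_norm_sq]

theorem pair_self_ne_zero {g : 𝓢(E, ℂ)} (hg : g ≠ 0) : pair g g ≠ 0 := by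
  intro h
  apply hg
  rw [pair_self, Complex.ofReal_eq_zero] at h
  have hi : Integrable fun t => ‖g t‖ ^ 2 := (memLp_two_iff_integrable_sq_norm
    g.continuous.aestronglyMeasurable).1 (g.memLp 2)
  rw [integral_eq_zero_iff_of_nonneg (fun t => by positivity) hi] at h
  have hc : Continuous fun t => ‖g t‖ ^ 2 := by fun_prop
  have := (hc.ae_eq_iff_eq volume continuous_const).1 h
  ext t
  have ht : ‖g t‖ ^ 2 = 0 := congrFun this t
  simpa using ht

/-- Otherwise the inversion formula with both windows equal to g would give ⟨g, g⟩ h = 0. -/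
theorem exists_stftS_ne_zero {g h : 𝓢(E, ℂ)} (hg : g ≠ 0) (hh : h ≠ 0) : ∃ z, stftS g h z ≠ 0 := by
  by_contra! H
  apply hh
  ext t
  have := integral_stftS_mul_tfShift g g h t
  simp only [H, zero_mul, integral_zero] at this
  simpa [pair_self_ne_zero hg] using this.symm

end ShortTimeFourier

/-! ### Minkowski's integral inequality in [0, ∞]. -/

section Minkowski

variable {α β : Type*} [MeasurableSpace α] [MeasurableSpace β]

theorem essSup_le_iff {μ : Measure α} {f : α → ℝ≥0∞} {c : ℝ≥0∞} :
    essSup f μ ≤ c ↔ ∀ᵐ x ∂μ, f x ≤ c := by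
  refine ⟨fun h => ?_, fun h => essSup_le_of_ae_le c h⟩
  filter_upwards [ENNReal.ae_le_essSup f] with x hx using hx.trans h

theorem measurable_eLpNorm_section {μ : Measure α} [SFinite μ] {F : β → α → ℝ≥0∞}
    (hF : Measurable (Function.uncurry F)) (p : ℝ≥0∞) :
    Measurable fun u => eLpNorm (F u) p μ := by
  rcases eq_or_ne p 0 with rfl | hp0
  · simp
  rcases eq_or_ne p ⊤ with rfl | hp
  · simp only [eLpNorm_exponent_top, eLpNormEssSup, enorm_eq_self]
    refine measurable_of_Iic fun c => ?_
    -- A sublevel set of the essential supremum is the set of u whose exceptional section is null,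
    -- and the measures of sections depend measurably on u.
    have : (fun u => essSup (fun x => F u x) μ) ⁻¹' Set.Iic c
        = (fun u => μ (Prod.mk u ⁻¹' {z : β × α | ¬ F z.1 z.2 ≤ c})) ⁻¹' {0} := by
      ext u
      rw [Set.mem_preimage, Set.mem_Iic, essSup_le_iff, ae_iff]
      rfl
    rw [this]
    exact measurable_measure_prodMk_left (measurableSet_le hF measurable_const).compl
      (measurableSet_singleton 0)
  · simp only [eLpNorm_eq_lintegral_rpow_enorm_toReal hp0 hp, enorm_eq_self]
    exact ((hF.pow_const _).lintegral_prod_right').pow_const _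

/-- Hölder's inequality against the constant function 1, raised to the power r. -/
theorem lintegral_rpow_le {μ : Measure α} {f : α → ℝ≥0∞} (hf : Measurable f) {r : ℝ} (hr : 1 ≤ r) :
    (∫⁻ x, f x ∂μ) ^ r ≤ (∫⁻ x, f x ^ r ∂μ) * μ Set.univ ^ (r - 1) := by
  have hr0 : 0 < r := by linarith
  have h := eLpNorm'_le_eLpNorm'_mul_rpow_measure_univ one_pos hr hf.aestronglyMeasurable (μ := μ)
  simp only [eLpNorm'_eq_lintegral_enorm, enorm_eq_self, ENNReal.rpow_one, div_one] at h
  calc (∫⁻ x, f x ∂μ) ^ r ≤ ((∫⁻ x, f x ^ r ∂μ) ^ (1 / r) * μ Set.univ ^ (1 - 1 / r)) ^ r := by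
        gcongr
    _ = _ := by
        rw [ENNReal.mul_rpow_of_nonneg _ _ hr0.le, ← ENNReal.rpow_mul, ← ENNReal.rpow_mul]
        have e1 : 1 / r * r = 1 := by field_simp
        have e2 : (1 - 1 / r) * r = r - 1 := by field_simp
        rw [e1, e2, ENNReal.rpow_one]

/-- **Minkowski's integral inequality**. -/
theorem eLpNorm_lintegral_le {μ : Measure α} {ν : Measure β} [SFinite μ] [SFinite ν]
    {F : β → α → ℝ≥0∞} (hF : Measurable (Function.uncurry F)) {p : ℝ≥0∞} (hp1 : 1 ≤ p) :
    eLpNorm (fun x => ∫⁻ u, F u x ∂ν) p μ ≤ ∫⁻ u, eLpNorm (F u) p μ ∂ν := by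
  set A : β → ℝ≥0∞ := fun u => eLpNorm (F u) p μ with hA
  have hAm : Measurable A := measurable_eLpNorm_section hF p
  have hp0 : p ≠ 0 := (zero_lt_one.trans_le hp1).ne'
  rcases eq_or_ne p ⊤ with rfl | hp
  · rw [eLpNorm_exponent_top, eLpNormEssSup]
    simp only [enorm_eq_self]
    rw [essSup_le_iff]
    have h : ∀ᵐ u ∂ν, ∀ᵐ x ∂μ, F u x ≤ A u := .of_forall fun u => by
      simpa [hA, eLpNormEssSup] using ENNReal.ae_le_essSup (μ := μ) (F u)
    rw [Measure.ae_ae_comm (p := fun u x => F u x ≤ A u)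
      (measurableSet_le hF (hAm.comp measurable_fst))] at h
    filter_upwards [h] with x hx using lintegral_mono_ae hx
  set r := p.toReal
  have hr : 1 ≤ r := by
    rw [← ENNReal.toReal_one]
    exact ENNReal.toReal_mono hp hp1
  have hr0 : 0 < r := by linarith
  have hAr : ∀ u, ∫⁻ x, F u x ^ r ∂μ = A u ^ r := by
    intro u
    simp only [hA, eLpNorm_eq_lintegral_rpow_enorm_toReal hp0 hp, enorm_eq_self]
    rw [← ENNReal.rpow_mul, one_div_mul_cancel hr0.ne', ENNReal.rpow_one]
  set I := ∫⁻ u, A u ∂ν with hI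
  rcases eq_or_ne I ⊤ with hItop | hItop
  · rw [hItop]; exact le_top
  have hAfin : ∀ᵐ u ∂ν, A u < ⊤ := ae_lt_top hAm hItop
  -- Cancelling A can fail only where A u = ∞, a null set, or where A u = 0; in the latter case F u
  -- vanishes almost everywhere. The two almost-everywhere quantifiers are exchanged by Fubini.
  have hzero : ∀ᵐ x ∂μ, ∀ᵐ u ∂ν, F u x ≤ F u x / A u * A u := by
    have hm : MeasurableSet {z : β × α | F z.1 z.2 ≤ F z.1 z.2 / A z.1 * A z.1} :=
      measurableSet_le hF ((hF.div (hAm.comp measurable_fst)).mul (hAm.comp measurable_fst))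
    rw [← Measure.ae_ae_comm hm]
    filter_upwards [hAfin] with u hu
    rcases eq_or_ne (A u) 0 with h0 | h0
    · have h0' : F u =ᵐ[μ] 0 :=
        (eLpNorm_eq_zero_iff (by fun_prop) hp0).1 h0
      filter_upwards [h0'] with x hx
      rw [hx]
      exact zero_le
    · exact .of_forall fun x => (ENNReal.div_mul_cancel h0 hu.ne).ge
  -- Each section is normalised by its own norm and the norms are absorbed into the measure A dν, of
  -- total mass I. Applying `lintegral_rpow_le` to F / A then produces the factor I^(r - 1).
  set l := ν.withDensity A with hl
  have hluniv : l Set.univ = I := by rw [hl, withDensity_apply _ .univ, Measure.restrict_univ]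
  have key : ∀ᵐ x ∂μ, (∫⁻ u, F u x ∂ν) ^ r ≤ (∫⁻ u, A u * (F u x ^ r / A u ^ r) ∂ν) * I ^ (r - 1) := by
    filter_upwards [hzero] with x hx
    have hFx : Measurable fun u => F u x / A u := by
      have : Measurable fun u => F u x := hF.comp measurable_prodMk_right
      fun_prop
    calc (∫⁻ u, F u x ∂ν) ^ r ≤ (∫⁻ u, F u x / A u ∂l) ^ r := by
          rw [hl, lintegral_withDensity_eq_lintegral_mul _ hAm hFx]
          refine ENNReal.rpow_le_rpow (lintegral_mono_ae ?_) hr0.le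
          filter_upwards [hx] with u hu
          rwa [Pi.mul_apply, mul_comm]
      _ ≤ (∫⁻ u, (F u x / A u) ^ r ∂l) * l Set.univ ^ (r - 1) := lintegral_rpow_le hFx hr
      _ = _ := by
          rw [hluniv, hl, lintegral_withDensity_eq_lintegral_mul _ hAm (hFx.pow_const r)]
          simp only [Pi.mul_apply, ENNReal.div_rpow_of_nonneg _ _ hr0.le]
  have hG : Measurable (Function.uncurry fun (u : β) (x : α) => A u * (F u x ^ r / A u ^ r)) := by
    have h1 : Measurable fun z : β × α => A z.1 := hAm.comp measurable_fst
    exact h1.mul ((hF.pow_const r).div (h1.pow_const r))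
  rw [eLpNorm_eq_lintegral_rpow_enorm_toReal hp0 hp]
  simp only [enorm_eq_self]
  calc (∫⁻ x, (∫⁻ u, F u x ∂ν) ^ r ∂μ) ^ (1 / r)
      ≤ ((∫⁻ x, ∫⁻ u, A u * (F u x ^ r / A u ^ r) ∂ν ∂μ) * I ^ (r - 1)) ^ (1 / r) := by
        refine ENNReal.rpow_le_rpow ?_ (by positivity)
        refine (lintegral_mono_ae key).trans (le_of_eq ?_)
        rw [lintegral_mul_const]
        exact hG.lintegral_prod_left'
    _ ≤ (I * I ^ (r - 1)) ^ (1 / r) := by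
        refine ENNReal.rpow_le_rpow ?_ (by positivity)
        gcongr
        rw [lintegral_lintegral_swap (by exact (hG.comp measurable_swap).aemeasurable)]
        refine lintegral_mono fun u => ?_
        have hFu : Measurable (F u) := hF.comp measurable_prodMk_left
        simp only [div_eq_mul_inv, ← mul_assoc]
        rw [lintegral_mul_const _ (by fun_prop), lintegral_const_mul _ (by fun_prop), hAr,
          mul_assoc, ← div_eq_mul_inv]
        -- The quotient A^r / A^r is at most 1 even when A is 0 or ∞, so no case distinction is
        -- needed.
        exact mul_le_of_le_one_right' ENNReal.div_self_le_one
    _ = I := by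
        have : I * I ^ (r - 1) = I ^ r := by
          nth_rw 1 [← ENNReal.rpow_one I]
          rw [← ENNReal.rpow_add_of_nonneg _ _ zero_le_one (by linarith)]
          congr 1
          ring
        rw [this, ← ENNReal.rpow_mul, mul_one_div_cancel hr0.ne', ENNReal.rpow_one]

end Minkowski

/-! ### Mixed-norm estimates: weighted Young inequality and local averages. -/

section MixedNorm

variable {E : Type} [NormedAddCommGroup E] [InnerProductSpace ℝ E]
  [FiniteDimensional ℝ E] [MeasurableSpace E] [BorelSpace E]

/-- The mixed norm `L^{p,q}` of a nonnegative function on phase space. -/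
noncomputable def mixedNorm (p q : ℝ≥0∞) (F : Phase E → ℝ≥0∞) : ℝ≥0∞ :=
  eLpNorm (fun ξ : E => eLpNorm (fun x : E => F (WithLp.toLp 2 (x, ξ))) p volume) q volume

theorem modNorm_eq_mixedNorm (g : 𝓢(E, ℂ)) (p q : ℝ≥0∞) {m : Phase E → ℝ} (hm : ∀ z, 0 ≤ m z)
    (f : 𝓢'(E, ℂ)) :
    modNorm g p q m f = mixedNorm p q fun z => ENNReal.ofReal (m z) * ‖stft g f z‖ₑ := by
  rw [modNorm, mixedNorm]
  congr 1
  funext ξ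
  refine eLpNorm_congr_enorm_ae (.of_forall fun x => ?_)
  rw [enorm_mul, enorm_eq_self, ← ofReal_norm, Complex.norm_real, Real.norm_of_nonneg (hm _)]

theorem mixedNorm_mono {p q : ℝ≥0∞} {F G : Phase E → ℝ≥0∞} (h : ∀ z, F z ≤ G z) :
    mixedNorm p q F ≤ mixedNorm p q G :=
  eLpNorm_mono_enorm fun ξ => by
    simp only [enorm_eq_self]
    exact eLpNorm_mono_enorm fun x => by simpa only [enorm_eq_self] using h _

theorem measurable_uncurry_toLp {F : Phase E → ℝ≥0∞} (hF : Measurable F) :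
    Measurable fun z : E × E => F (WithLp.toLp 2 (z.1, z.2)) :=
  hF.comp (by fun_prop)

theorem measurable_eLpNorm_slice {F : Phase E → ℝ≥0∞} (hF : Measurable F) (p : ℝ≥0∞) :
    Measurable fun ξ : E => eLpNorm (fun x : E => F (WithLp.toLp 2 (x, ξ))) p volume :=
  measurable_eLpNorm_section (F := fun ξ x => F (WithLp.toLp 2 (x, ξ)))
    ((measurable_uncurry_toLp hF).comp measurable_swap) p

theorem lintegral_phase {F : Phase E → ℝ≥0∞} (hF : Measurable F) :
    ∫⁻ z, F z = ∫⁻ y : E, ∫⁻ x : E, F (WithLp.toLp 2 (x, y)) := by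
  have hmp := WithLp.volume_preserving_toLp E E
  rw [← hmp.lintegral_comp hF, Measure.volume_eq_prod]
  exact lintegral_prod_symm' _ (measurable_uncurry_toLp hF)

theorem mixedNorm_one_one {F : Phase E → ℝ≥0∞} (hF : Measurable F) :
    mixedNorm 1 1 F = ∫⁻ z, F z := by
  simp only [mixedNorm, eLpNorm_one_eq_lintegral_enorm, enorm_eq_self]
  exact (lintegral_phase hF).symm

/-- **Young's inequality** for mixed norms. -/
theorem mixedNorm_conv_le {p q : ℝ≥0∞} (hp : 1 ≤ p) (hq : 1 ≤ q) {F H : Phase E → ℝ≥0∞}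
    (hF : Measurable F) (hH : Measurable H) :
    mixedNorm p q (fun w => ∫⁻ z, F z * H (w - z)) ≤ (∫⁻ z, H z) * mixedNorm p q F := by
  -- The convolution is a superposition of translates of F against the measure H dz. Minkowski's
  -- inequality, first in x and then in ξ, together with translation invariance gives the bound.
  set ν : Measure (Phase E) := volume.withDensity H with hν
  have hconv : ∀ w, ∫⁻ z, F z * H (w - z) = ∫⁻ u, F (w - u) ∂ν := by
    intro w
    rw [hν, lintegral_withDensity_eq_lintegral_mul _ hH (by fun_prop),
      ← lintegral_sub_left_eq_self _ w]
    refine lintegral_congr fun u => ?_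
    rw [Pi.mul_apply, sub_sub_cancel, mul_comm]
  set N : E → ℝ≥0∞ := fun ξ => eLpNorm (fun x : E => F (WithLp.toLp 2 (x, ξ))) p volume with hN
  have hNm : Measurable N := measurable_eLpNorm_slice hF p
  have hinner : ∀ ξ : E, eLpNorm (fun x : E => ∫⁻ u, F (WithLp.toLp 2 (x, ξ) - u) ∂ν) p volume
      ≤ ∫⁻ u, N (ξ - u.snd) ∂ν := by
    intro ξ
    refine (eLpNorm_lintegral_le (F := fun (u : Phase E) (x : E) => F (WithLp.toLp 2 (x, ξ) - u))
      (hF.comp (by fun_prop)) hp).trans (lintegral_mono fun u => le_of_eq ?_)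
    have hmp : MeasurePreserving (fun x : E => x - u.fst) volume volume :=
      measurePreserving_sub_right volume u.fst
    have := eLpNorm_comp_measurePreserving (p := p)
      (g := fun x : E => F (WithLp.toLp 2 (x, ξ - u.snd)))
      (hF.comp (by fun_prop)).aestronglyMeasurable hmp
    rw [hN]
    dsimp only
    rw [← this]
    rfl
  have houter : ∀ u : Phase E, eLpNorm (fun ξ : E => N (ξ - u.snd)) q volume
      = mixedNorm p q F := by
    intro u
    exact eLpNorm_comp_measurePreserving (p := q) (g := N) hNm.aestronglyMeasurable
      (measurePreserving_sub_right volume u.snd)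
  rw [mixedNorm]
  simp only [hconv]
  calc _ ≤ eLpNorm (fun ξ : E => ∫⁻ u, N (ξ - u.snd) ∂ν) q volume :=
        eLpNorm_mono_enorm fun ξ => by simpa only [enorm_eq_self] using hinner ξ
    _ ≤ ∫⁻ u, eLpNorm (fun ξ : E => N (ξ - u.snd)) q volume ∂ν :=
        eLpNorm_lintegral_le (F := fun (u : Phase E) (ξ : E) => N (ξ - u.snd))
          (hNm.comp (by fun_prop)) hq
    _ = (∫⁻ z, H z) * mixedNorm p q F := by
        simp only [houter]
        rw [lintegral_const, hν, withDensity_apply _ .univ, Measure.restrict_univ, mul_comm]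

theorem ofReal_mul_le_of_moderate {v m : Phase E → ℝ} {C : ℝ} (hC : 0 ≤ C) (hv : ∀ z, 0 ≤ v z)
    (hm : ∀ z₁ z₂, m (z₁ + z₂) ≤ C * v z₁ * m z₂) (w z : Phase E) :
    ENNReal.ofReal (m w)
      ≤ ENNReal.ofReal C * ENNReal.ofReal (v (w - z)) * ENNReal.ofReal (m z) := by
  rw [← ENNReal.ofReal_mul hC, ← ENNReal.ofReal_mul (mul_nonneg hC (hv _))]
  refine ENNReal.ofReal_le_ofReal ?_
  simpa using hm (w - z) z

/-- Weighted Young inequality for mixed norms with a moderate weight. -/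
theorem mixedNorm_le_of_le_conv {p q : ℝ≥0∞} (hp : 1 ≤ p) (hq : 1 ≤ q) {v m : Phase E → ℝ} {C : ℝ}
    (hC : 0 ≤ C) (hv : ∀ z, 0 ≤ v z) (hvm : Measurable v) (hmm : Measurable m)
    (hm : ∀ z₁ z₂, m (z₁ + z₂) ≤ C * v z₁ * m z₂) {S F H : Phase E → ℝ≥0∞}
    (hF : Measurable F) (hH : Measurable H) (hS : ∀ w, S w ≤ ∫⁻ z, F z * H (w - z)) :
    mixedNorm p q (fun z => ENNReal.ofReal (m z) * S z) ≤
      ENNReal.ofReal C * (∫⁻ z, ENNReal.ofReal (v z) * H z) *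
        mixedNorm p q (fun z => ENNReal.ofReal (m z) * F z) := by
  have hH' : Measurable fun z => ENNReal.ofReal C * (ENNReal.ofReal (v z) * H z) := by fun_prop
  have h := mixedNorm_conv_le hp hq (F := fun z => ENNReal.ofReal (m z) * F z) (by fun_prop) hH'
  rw [lintegral_const_mul _ (by fun_prop)] at h
  refine (mixedNorm_mono fun w => ?_).trans h
  calc ENNReal.ofReal (m w) * S w ≤ ENNReal.ofReal (m w) * ∫⁻ z, F z * H (w - z) := by
        gcongr; exact hS w
    _ = ∫⁻ z, ENNReal.ofReal (m w) * (F z * H (w - z)) :=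
        (lintegral_const_mul _ (by fun_prop)).symm
    -- Moderateness distributes the weight m(w) over the two factors as v(w - z) m(z), which reduces
    -- the claim to the unweighted inequality.
    _ ≤ _ := by
        refine lintegral_mono fun z => ?_
        calc ENNReal.ofReal (m w) * (F z * H (w - z))
            ≤ ENNReal.ofReal C * ENNReal.ofReal (v (w - z)) * ENNReal.ofReal (m z)
              * (F z * H (w - z)) := by
              gcongr
              exact ofReal_mul_le_of_moderate hC hv hm w z
          _ = _ := by ring

/-- Local integrals are controlled by the mixed norm. -/
theorem exists_setLIntegral_le_mixedNorm {p q : ℝ≥0∞} (hp : 1 ≤ p) (hq : 1 ≤ q) {B : Set E}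
    (hB : volume B ≠ ⊤) :
    ∃ C : ℝ≥0∞, C ≠ ⊤ ∧ ∀ F : Phase E → ℝ≥0∞, Measurable F → ∀ z : Phase E,
      ∫⁻ y in B, ∫⁻ x in B, F (z + WithLp.toLp 2 (x, y)) ≤ C * mixedNorm p q F := by
  -- These are the Hölder constants |B|^(1 - 1/r). For r = ∞ the convention `(⊤ : ℝ≥0∞).toReal = 0`
  -- makes the exponent 1, as it should be.
  have hfin : ∀ r : ℝ≥0∞, 1 ≤ r → volume B ^ (1 / (1 : ℝ≥0∞).toReal - 1 / r.toReal) ≠ ⊤ := by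
    intro r hr
    refine ENNReal.rpow_ne_top_of_nonneg ?_ hB
    rcases eq_or_ne r ⊤ with rfl | hr'
    · simp
    · have : 1 ≤ r.toReal := by
        rw [← ENNReal.toReal_one]
        exact ENNReal.toReal_mono hr' hr
      have : 1 / r.toReal ≤ 1 := by
        rw [div_le_one (by linarith)]; exact this
      simpa using this
  have hloc : ∀ (r : ℝ≥0∞), 1 ≤ r → ∀ (G : E → ℝ≥0∞), Measurable G → ∀ a : E,
      ∫⁻ x in B, G (a + x) ≤ eLpNorm G r volume *
        volume B ^ (1 / (1 : ℝ≥0∞).toReal - 1 / r.toReal) := by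
    intro r hr G hG a
    have hGa : Measurable fun x => G (a + x) := by fun_prop
    have h := eLpNorm_le_eLpNorm_mul_rpow_measure_univ hr
      hGa.aestronglyMeasurable (μ := volume.restrict B)
    rw [eLpNorm_one_eq_lintegral_enorm, Measure.restrict_apply_univ] at h
    simp only [enorm_eq_self] at h
    refine h.trans ?_
    gcongr
    refine (eLpNorm_mono_measure _ Measure.restrict_le_self).trans (le_of_eq ?_)
    exact eLpNorm_comp_measurePreserving hG.aestronglyMeasurable
      (measurePreserving_add_left volume a)
  refine ⟨_, ENNReal.mul_ne_top (hfin p hp) (hfin q hq), fun F hF z => ?_⟩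
  have hslice := measurable_eLpNorm_slice hF p
  calc ∫⁻ y in B, ∫⁻ x in B, F (z + WithLp.toLp 2 (x, y))
      ≤ ∫⁻ y in B, eLpNorm (fun x : E => F (WithLp.toLp 2 (x, z.snd + y))) p volume *
        volume B ^ (1 / (1 : ℝ≥0∞).toReal - 1 / p.toReal) := by
        refine lintegral_mono fun y => ?_
        exact hloc p hp (fun x => F (WithLp.toLp 2 (x, z.snd + y))) (by fun_prop) z.fst
    _ = (∫⁻ y in B, eLpNorm (fun x : E => F (WithLp.toLp 2 (x, z.snd + y))) p volume) *
        volume B ^ (1 / (1 : ℝ≥0∞).toReal - 1 / p.toReal) :=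
        lintegral_mul_const _ (hslice.comp (by fun_prop))
    _ ≤ (mixedNorm p q F * volume B ^ (1 / (1 : ℝ≥0∞).toReal - 1 / q.toReal)) *
        volume B ^ (1 / (1 : ℝ≥0∞).toReal - 1 / p.toReal) := by
        gcongr
        exact hloc q hq _ hslice z.snd
    _ = _ := by ring

end MixedNorm

/-! ### Linear changes of variables with unspecified Jacobians. -/

section ChangeOfVariables

variable {D : Type} [NormedAddCommGroup D] [InnerProductSpace ℝ D]
  [FiniteDimensional ℝ D] [MeasurableSpace D] [BorelSpace D]

/-- The Jacobian is only recorded as some positive number, because its value is absorbed into the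
final constant. -/
theorem exists_map_volume_eq (L : D ≃L[ℝ] D) :
    ∃ κ : ℝ, 0 < κ ∧ Measure.map L (volume : Measure D) = ENNReal.ofReal κ • volume := by
  have hdet : LinearMap.det (L.toLinearEquiv : D →ₗ[ℝ] D) ≠ 0 :=
    (LinearEquiv.isUnit_det' L.toLinearEquiv).ne_zero
  exact ⟨_, abs_pos.2 (inv_ne_zero hdet),
    Measure.map_linearMap_addHaar_eq_smul_addHaar volume hdet⟩

theorem measurableEmbedding_equiv (L : D ≃L[ℝ] D) : MeasurableEmbedding L :=
  L.toHomeomorph.measurableEmbedding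

theorem exists_integral_comp_equiv (L : D ≃L[ℝ] D) :
    ∃ κ : ℝ, 0 < κ ∧ ∀ f : D → ℂ, ∫ x, f (L x) = κ * ∫ x, f x := by
  obtain ⟨κ, hκ, h⟩ := exists_map_volume_eq L
  refine ⟨κ, hκ, fun f => ?_⟩
  rw [← (measurableEmbedding_equiv L).integral_map, h, integral_smul_measure,
    ENNReal.toReal_ofReal hκ.le, Complex.real_smul]

theorem exists_lintegral_comp_equiv (L : D ≃L[ℝ] D) :
    ∃ κ : ℝ≥0∞, κ ≠ 0 ∧ κ ≠ ⊤ ∧ ∀ f : D → ℝ≥0∞, ∫⁻ x, f (L x) = κ * ∫⁻ x, f x := by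
  obtain ⟨κ, hκ, h⟩ := exists_map_volume_eq L
  refine ⟨ENNReal.ofReal κ, by simpa using hκ, ENNReal.ofReal_ne_top, fun f => ?_⟩
  rw [← (measurableEmbedding_equiv L).lintegral_map, h, lintegral_smul_measure, smul_eq_mul]

theorem integrable_mul_conj (f g : 𝓢(D, ℂ)) : Integrable fun x => f x * starRingEnd ℂ (g x) :=
  (SchwartzMap.pairing (ContinuousLinearMap.mul ℂ ℂ) f (conjS g)).integrable

theorem exists_pair_comp_equiv (L : D ≃L[ℝ] D) :
    ∃ κ : ℝ, 0 < κ ∧ ∀ f g : 𝓢(D, ℂ), pair (compCLMOfContinuousLinearEquiv ℂ L f)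
      (compCLMOfContinuousLinearEquiv ℂ L g) = κ * pair f g := by
  obtain ⟨κ, hκ, h⟩ := exists_integral_comp_equiv L
  exact ⟨κ, hκ, fun f g => h fun x => f x * starRingEnd ℂ (g x)⟩

end ChangeOfVariables

/-! ### Moyal identity and covariance of the τ-Wigner distribution. -/

section TauWigner

variable {E : Type} [NormedAddCommGroup E] [InnerProductSpace ℝ E]
  [FiniteDimensional ℝ E] [MeasurableSpace E] [BorelSpace E]

theorem pair_fourier (f g : 𝓢(E, ℂ)) : pair (𝓕 f) (𝓕 g) = pair f g := by
  have h := SchwartzMap.integral_inner_fourier_fourier g f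
  simp only [RCLike.inner_apply] at h
  exact h

theorem pair_eq_integral_pair_slice (F G : 𝓢(Phase E, ℂ)) :
    pair F G = ∫ x, pair (slice x F) (slice x G) :=
  integral_phase (integrable_mul_conj F G)

/-- Plancherel applied on each slice of fixed position. -/
theorem pair_partialFourier (F G : 𝓢(Phase E, ℂ)) :
    pair (partialFourier F) (partialFourier G) = pair F G := by
  have : ∀ (x : E) (F : 𝓢(Phase E, ℂ)), slice x (partialFourier F) = 𝓕 (slice x F) := by
    intro x F
    ext y
    exact partialFourier_eq_fourier_slice F x y
  rw [pair_eq_integral_pair_slice, pair_eq_integral_pair_slice]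
  simp only [this, pair_fourier]

theorem pair_tensor (f f' k k' : 𝓢(E, ℂ)) :
    pair (tensor k f) (tensor k' f') = pair f f' * pair k k' := by
  rw [pair_eq_integral_pair_slice]
  have : ∀ x, pair (slice x (tensor k f)) (slice x (tensor k' f'))
      = (f x * starRingEnd ℂ (f' x)) * pair k k' := by
    intro x
    rw [pair, pair, ← integral_const_mul]
    congr 1
    funext y
    change f x * k y * starRingEnd ℂ (f' x * k' y) = _
    rw [map_mul]
    ring
  simp only [this]
  rw [integral_mul_const]
  rfl

theorem pair_conjS (f g : 𝓢(E, ℂ)) : pair (conjS f) (conjS g) = pair g f := by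
  rw [pair, pair]
  congr 1
  funext t
  rw [conjS_apply, conjS_apply, Complex.conj_conj, mul_comm]

/-- The Moyal identity for the cross-`τ`-Wigner distribution, up to a Jacobian. -/
theorem exists_pair_tauWigner (E : Type) [NormedAddCommGroup E] [InnerProductSpace ℝ E]
    [FiniteDimensional ℝ E] [MeasurableSpace E] [BorelSpace E] (τ : ℝ) :
    ∃ κ : ℝ, 0 < κ ∧ ∀ a b a' b' : 𝓢(E, ℂ),
      pair (tauWigner τ a b) (tauWigner τ a' b') = κ * (pair a a' * pair b' b) := by
  obtain ⟨κ, hκ, h⟩ := exists_pair_comp_equiv (tauShear (E := E) τ)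
  refine ⟨κ, hκ, fun a b a' b' => ?_⟩
  -- W_τ is tensoring, then a linear substitution, then a partial Fourier transform; only the
  -- substitution contributes a constant to the pairing.
  rw [tauWigner, tauWigner, pair_partialFourier, h, pair_tensor, pair_conjS]

/-- The linear map `(w, z) ↦ (((1 - τ) w₁ + τ z₁, τ w₂ + (1 - τ) z₂), J (w - z))`. -/
noncomputable def wignerShift (E : Type) [NormedAddCommGroup E] [InnerProductSpace ℝ E] (τ : ℝ) :
    Phase (Phase E) ≃L[ℝ] Phase (Phase E) where
  toFun W := WithLp.toLp 2
    (WithLp.toLp 2 ((1 - τ) • W.fst.fst + τ • W.snd.fst, τ • W.fst.snd + (1 - τ) • W.snd.snd),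
      WithLp.toLp 2 (W.fst.snd - W.snd.snd, W.snd.fst - W.fst.fst))
  invFun Z := WithLp.toLp 2
    (WithLp.toLp 2 (Z.fst.fst - τ • Z.snd.snd, Z.fst.snd + (1 - τ) • Z.snd.fst),
      WithLp.toLp 2 (Z.fst.fst + (1 - τ) • Z.snd.snd, Z.fst.snd - τ • Z.snd.fst))
  map_add' z w := by
    apply WithLp.ofLp_injective
    ext : 1 <;> apply WithLp.ofLp_injective <;> ext : 1 <;> simp <;> module
  map_smul' a z := by
    apply WithLp.ofLp_injective
    ext : 1 <;> apply WithLp.ofLp_injective <;> ext : 1 <;> simp <;> module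
  left_inv z := by
    apply WithLp.ofLp_injective
    ext : 1 <;> apply WithLp.ofLp_injective <;> ext : 1 <;> simp <;> module
  right_inv z := by
    apply WithLp.ofLp_injective
    ext : 1 <;> apply WithLp.ofLp_injective <;> ext : 1 <;> simp <;> module
  continuous_toFun := by fun_prop
  continuous_invFun := by fun_prop

/-- The substitution y ↦ y + (w₁ - z₁) recentres both arguments, and the remaining exponentials
combine into a modulation and a constant phase. The position of the resulting shift depends on τ,
but its frequency J(w - z) does not; hence the same symbol class works for every τ. -/
theorem tauWigner_tfShift (τ : ℝ) (w z : Phase E) (a b : 𝓢(E, ℂ)) :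
    ∃ c : ℂ, ‖c‖ = 1 ∧ tauWigner τ (tfShift w a) (tfShift z b)
      = c • tfShift (wignerShift E τ (WithLp.toLp 2 (w, z))) (tauWigner τ a b) := by
  set δ := w.fst - z.fst with hδ
  refine ⟨((𝐞 ⟪τ • w.snd + (1 - τ) • z.snd, δ⟫_ℝ : Circle) : ℂ), Circle.norm_coe _, ?_⟩
  ext X
  rw [smul_apply, smul_eq_mul, tfShift_apply, tauWigner_apply, tauWigner_apply,
    ← integral_const_mul, ← integral_const_mul, ← integral_add_right_eq_self _ δ]
  congr 1
  funext y
  have hS1 : (wignerShift E τ (WithLp.toLp 2 (w, z))).fst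
      = WithLp.toLp 2 ((1 - τ) • w.fst + τ • z.fst, τ • w.snd + (1 - τ) • z.snd) := rfl
  have hS2 : (wignerShift E τ (WithLp.toLp 2 (w, z))).snd
      = WithLp.toLp 2 (w.snd - z.snd, z.fst - w.fst) := rfl
  rw [hS1, hS2]
  simp only [tfShift_apply, map_mul, ← Circle.coe_inv_eq_conj, ← AddChar.map_neg_eq_inv]
  have h1 : X.fst + τ • (y + δ) - w.fst
      = (X - WithLp.toLp 2 ((1 - τ) • w.fst + τ • z.fst, τ • w.snd + (1 - τ) • z.snd)).fst
        + τ • y := by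
    change _ = X.fst - ((1 - τ) • w.fst + τ • z.fst) + τ • y
    rw [hδ]
    module
  have h2 : X.fst - (1 - τ) • (y + δ) - z.fst
      = (X - WithLp.toLp 2 ((1 - τ) • w.fst + τ • z.fst, τ • w.snd + (1 - τ) • z.snd)).fst
        - (1 - τ) • y := by
    change _ = X.fst - ((1 - τ) • w.fst + τ • z.fst) - (1 - τ) • y
    rw [hδ]
    module
  rw [h1, h2]
  have h3 : ((𝐞 (-⟪y + δ, X.snd⟫_ℝ) : Circle) : ℂ)
        * ((𝐞 ⟪w.snd, X.fst + τ • (y + δ)⟫_ℝ : Circle) : ℂ)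
        * ((𝐞 (-⟪z.snd, X.fst - (1 - τ) • (y + δ)⟫_ℝ) : Circle) : ℂ)
      = ((𝐞 ⟪τ • w.snd + (1 - τ) • z.snd, δ⟫_ℝ : Circle) : ℂ)
        * ((𝐞 ⟪WithLp.toLp 2 (w.snd - z.snd, z.fst - w.fst), X⟫_ℝ : Circle) : ℂ)
        * ((𝐞 (-⟪y, (X - WithLp.toLp 2 ((1 - τ) • w.fst + τ • z.fst,
            τ • w.snd + (1 - τ) • z.snd)).snd⟫_ℝ) : Circle) : ℂ) := by
    rw [← Circle.coe_mul, ← Circle.coe_mul, ← Circle.coe_mul, ← Circle.coe_mul,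
      ← AddChar.map_add_eq_mul, ← AddChar.map_add_eq_mul, ← AddChar.map_add_eq_mul,
      ← AddChar.map_add_eq_mul]
    congr 2
    rw [WithLp.prod_inner_apply]
    change _ = _ + (⟪w.snd - z.snd, X.fst⟫_ℝ + ⟪z.fst - w.fst, X.snd⟫_ℝ)
      + -⟪y, X.snd - (τ • w.snd + (1 - τ) • z.snd)⟫_ℝ
    rw [hδ]
    simp only [inner_sub_left, inner_sub_right, inner_add_left, inner_add_right,
      real_inner_smul_left, real_inner_smul_right]
    rw [real_inner_comm y w.snd, real_inner_comm y z.snd]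
    ring
  linear_combination (a ((X - WithLp.toLp 2 ((1 - τ) • w.fst + τ • z.fst,
      τ • w.snd + (1 - τ) • z.snd)).fst + τ • y) * starRingEnd ℂ (b ((X - WithLp.toLp 2
      ((1 - τ) • w.fst + τ • z.fst, τ • w.snd + (1 - τ) • z.snd)).fst - (1 - τ) • y))) * h3

/-- The Gabor matrix of the operator is the short-time Fourier transform of its symbol: move both
shifts into W_τ and apply covariance. -/
theorem norm_opTau_tfShift (τ : ℝ) (σ : 𝓢'(Phase E, ℂ)) (a b : 𝓢(E, ℂ)) (w z : Phase E) :
    ‖opTau τ σ (tfShift z b) (conjS (tfShift w a))‖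
      = ‖stft (tauWigner τ a b) σ (wignerShift E τ (WithLp.toLp 2 (w, z)))‖ := by
  obtain ⟨c, hc, h⟩ := tauWigner_tfShift τ w z a b
  rw [opTau_apply, conjS_conjS, h, conjS_smul, map_smul, smul_eq_mul, norm_mul, RCLike.norm_conj,
    hc, one_mul, stft]

end TauWigner

/-! ### From the symbol norm to a convolution bound for the Gabor matrix. -/

section SymbolWindow

variable {E : Type} [NormedAddCommGroup E] [InnerProductSpace ℝ E]

/-- The inverse symplectic map `(z₁, z₂) ↦ (-z₂, z₁)`. -/
noncomputable def sympInv (z : Phase E) : Phase E := WithLp.toLp 2 (-z.snd, z.fst)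

/-- The symplectic map `(z₁, z₂) ↦ (z₂, -z₁)`. -/
noncomputable def symp (E : Type) [NormedAddCommGroup E] [InnerProductSpace ℝ E] :
    Phase E ≃L[ℝ] Phase E where
  toFun z := WithLp.toLp 2 (z.snd, -z.fst)
  invFun := sympInv
  map_add' z w := by
    apply WithLp.ofLp_injective
    ext <;> simp
    module
  map_smul' a z := by
    apply WithLp.ofLp_injective
    ext <;> simp
  left_inv z := by
    apply WithLp.ofLp_injective
    ext <;> simp [sympInv]
  right_inv z := by
    apply WithLp.ofLp_injective
    ext <;> simp [sympInv]
  continuous_toFun := by fun_prop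
  continuous_invFun := by unfold sympInv; fun_prop

theorem sympInv_symp (z : Phase E) : sympInv (symp E z) = z := (symp E).symm_apply_apply z

theorem continuous_sympInv : Continuous (sympInv : Phase E → Phase E) := (symp E).symm.continuous

theorem sympInv_add (z w : Phase E) : sympInv (z + w) = sympInv z + sympInv w :=
  map_add (symp E).symm z w

theorem wignerShift_snd (τ : ℝ) (w z : Phase E) :
    (wignerShift E τ (WithLp.toLp 2 (w, z))).snd = symp E (w - z) := by
  apply WithLp.ofLp_injective
  ext : 1
  · rfl
  · change z.fst - w.fst = -(w - z).fst
    rw [WithLp.sub_fst]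
    abel

/-- Even submultiplicative weights. -/
structure IsSubmultWeight (v : Phase E → ℝ) : Prop where
  continuous : Continuous v
  nonneg : ∀ z, 0 ≤ v z
  even : ∀ z, v (-z) = v z
  submult : ∀ w z, v (w + z) ≤ v w * v z

variable [FiniteDimensional ℝ E] [MeasurableSpace E] [BorelSpace E] {v : Phase E → ℝ}

theorem IsSubmultWeight.ofReal_add_le (hv : IsSubmultWeight v) (w z : Phase E) :
    ENNReal.ofReal (v (w + z)) ≤ ENNReal.ofReal (v w) * ENNReal.ofReal (v z) := by
  rw [← ENNReal.ofReal_mul (hv.nonneg _)]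
  exact ENNReal.ofReal_le_ofReal (hv.submult w z)

/-- By Moyal's identity ⟨Φ, Φ⟩ is a positive multiple of ⟨g, g⟩². -/
theorem tauWigner_ne_zero (τ : ℝ) {g : 𝓢(E, ℂ)} (hg : g ≠ 0) : tauWigner τ g g ≠ 0 := by
  intro h
  obtain ⟨κ, hκ, hM⟩ := exists_pair_tauWigner E τ
  have := hM g g g g
  rw [h] at this
  have h0 : pair (0 : 𝓢(Phase E, ℂ)) 0 = 0 := by simp [pair]
  rw [h0] at this
  have hp := pair_self_ne_zero hg
  have : (κ : ℂ) * (pair g g * pair g g) ≠ 0 :=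
    mul_ne_zero (by exact_mod_cast hκ.ne') (mul_ne_zero hp hp)
  simp_all

/-- The `τ`-Wigner distribution of a window in `M^1_v` has a weighted integrable STFT. -/
theorem lintegral_stftS_tauWigner_lt_top (hv : IsSubmultWeight v) (τ : ℝ) {g : 𝓢(E, ℂ)}
    (hg : ∫⁻ z, ENNReal.ofReal (v z) * ‖stftS g g z‖ₑ < ⊤) :
    ∫⁻ Z : Phase (Phase E), ENNReal.ofReal (v (sympInv Z.snd)) *
      ‖stftS (tauWigner τ g g) (tauWigner τ g g) Z‖ₑ < ⊤ := by
  set Φ := tauWigner τ g g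
  set I := ∫⁻ z, ENNReal.ofReal (v z) * ‖stftS g g z‖ₑ with hI
  have hvm : Measurable v := hv.continuous.measurable
  have hgm : Measurable fun z => ‖stftS g g z‖ₑ := (stftS g g).continuous.measurable.enorm
  obtain ⟨κ, hκ, hM⟩ := exists_pair_tauWigner E τ
  obtain ⟨K, hK0, hKt, hK⟩ := exists_lintegral_comp_equiv (wignerShift E τ)
  -- Covariance writes the shifted window as W_τ(π(w)g, π(z)g) up to a phase, and Moyal's identity
  -- then separates w from z.
  have hpt : ∀ w z : Phase E, ‖stftS Φ Φ (wignerShift E τ (WithLp.toLp 2 (w, z)))‖ₑ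
      = ENNReal.ofReal κ * (‖stftS g g w‖ₑ * ‖stftS g g z‖ₑ) := by
    intro w z
    obtain ⟨c, hc, h⟩ := tauWigner_tfShift τ w z g g
    have e : ‖stftS Φ Φ (wignerShift E τ (WithLp.toLp 2 (w, z)))‖
        = κ * (‖stftS g g w‖ * ‖stftS g g z‖) := by
      have e1 : ‖pair Φ (tauWigner τ (tfShift w g) (tfShift z g))‖
          = ‖stftS Φ Φ (wignerShift E τ (WithLp.toLp 2 (w, z)))‖ := by
        rw [h, stftS_apply, norm_pair_comm, pair]
        simp only [smul_apply, smul_eq_mul, mul_assoc]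
        rw [integral_const_mul, norm_mul, hc, one_mul]
        exact norm_pair_comm _ _
      rw [← e1, hM, norm_mul, norm_mul, norm_pair_comm (tfShift z g), Complex.norm_real,
        Real.norm_of_nonneg hκ.le, stftS_apply, stftS_apply]
    rw [← ofReal_norm, e, ENNReal.ofReal_mul hκ.le, ENNReal.ofReal_mul (norm_nonneg _),
      ofReal_norm, ofReal_norm]
  set f : Phase (Phase E) → ℝ≥0∞ := fun Z => ENNReal.ofReal (v (sympInv Z.snd)) * ‖stftS Φ Φ Z‖ₑ
  have hf : Measurable f := by
    have h1 : Measurable fun Z : Phase (Phase E) => v (sympInv Z.snd) :=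
      (hv.continuous.comp (continuous_sympInv.comp (by fun_prop))).measurable
    exact h1.ennreal_ofReal.mul (stftS Φ Φ).continuous.measurable.enorm
  have hle : K * ∫⁻ Z, f Z ≤ ENNReal.ofReal κ * (I * I) := by
    rw [← hK, lintegral_phase (F := fun Z => f (wignerShift E τ Z))
      (hf.comp (wignerShift E τ).continuous.measurable)]
    calc _ ≤ ∫⁻ z : Phase E, ∫⁻ w : Phase E, ENNReal.ofReal κ *
          (ENNReal.ofReal (v z) * ‖stftS g g z‖ₑ) * (ENNReal.ofReal (v w) * ‖stftS g g w‖ₑ) := by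
          refine lintegral_mono fun z => lintegral_mono fun w => ?_
          simp only [f]
          rw [hpt, wignerShift_snd, sympInv_symp, sub_eq_add_neg]
          -- In the coordinates (w, z) the weight is v(w - z), which submultiplicativity and
          -- evenness bound by v(w) v(z); the integral then splits into I · I.
          calc _ ≤ (ENNReal.ofReal (v w) * ENNReal.ofReal (v (-z))) *
                (ENNReal.ofReal κ * (‖stftS g g w‖ₑ * ‖stftS g g z‖ₑ)) := by
                gcongr
                exact hv.ofReal_add_le _ _
            _ = _ := by rw [hv.even]; ring
      _ = ENNReal.ofReal κ * (I * I) := by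
          have hin : ∀ c : ℝ≥0∞, ∫⁻ w, c * (ENNReal.ofReal (v w) * ‖stftS g g w‖ₑ) = c * I :=
            fun c => lintegral_const_mul _ (by fun_prop)
          simp only [hin]
          rw [lintegral_mul_const _ (by fun_prop), lintegral_const_mul _ (by fun_prop), ← hI,
            mul_assoc]
  have hfin : K * ∫⁻ Z, f Z < ⊤ :=
    hle.trans_lt (ENNReal.mul_lt_top ENNReal.ofReal_lt_top (ENNReal.mul_lt_top hg hg))
  by_contra htop
  rw [not_lt, top_le_iff] at htop
  rw [htop, ENNReal.mul_top hK0] at hfin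
  exact lt_irrefl _ hfin

/-- Change of window for the symbol class. -/
theorem exists_modNorm_tauWigner_le (hv : IsSubmultWeight v) (τ : ℝ) {g : 𝓢(E, ℂ)} (hg0 : g ≠ 0)
    (hg : ∫⁻ z, ENNReal.ofReal (v z) * ‖stftS g g z‖ₑ < ⊤) {G : 𝓢(Phase E, ℂ)} (hG : G ≠ 0) :
    ∃ C : ℝ≥0∞, C ≠ ⊤ ∧ ∀ σ : 𝓢'(Phase E, ℂ),
      modNorm (tauWigner τ g g) ⊤ 1 (fun Z => v (sympInv Z.snd)) σ
        ≤ C * modNorm G ⊤ 1 (fun Z => v (sympInv Z.snd)) σ := by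
  set Φ := tauWigner τ g g with hΦ
  have hΦ0 : Φ ≠ 0 := tauWigner_ne_zero τ hg0
  obtain ⟨Z₀, hZ₀⟩ := exists_stftS_ne_zero hΦ0 hG
  -- Φ itself may be orthogonal to G, so it is shifted to a point where V_ΦG does not vanish.
  -- Analysing with G and synthesising with Γ leaves the kernel V_ΦΓ, whose modulus is a translate
  -- of |V_ΦΦ|; no weighted integrability of G is required.
  set Γ := tfShift Z₀ Φ with hΓ
  have hΓG : pair Γ G ≠ 0 := by
    rw [← norm_ne_zero_iff, norm_pair_comm, ← stftS_apply]
    exact norm_ne_zero_iff.2 hZ₀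
  set V : Phase (Phase E) → ℝ := fun Z => v (sympInv Z.snd) with hV
  have hVc : Continuous V := hv.continuous.comp (continuous_sympInv.comp (by fun_prop))
  have hVs : ∀ z₁ z₂, V (z₁ + z₂) ≤ 1 * V z₁ * V z₂ := by
    intro z₁ z₂
    simp only [hV, WithLp.add_snd, sympInv_add, one_mul]
    exact hv.submult _ _
  set H : Phase (Phase E) → ℝ≥0∞ := fun Z => ‖pair Γ G‖ₑ⁻¹ * ‖stftS Φ Γ Z‖ₑ with hH
  have hHm : Measurable H := (stftS Φ Γ).continuous.measurable.enorm.const_mul _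
  have hpe : ‖pair Γ G‖ₑ ≠ 0 := by simpa using hΓG
  refine ⟨∫⁻ Z, ENNReal.ofReal (V Z) * H Z, ?_, fun σ => ?_⟩
  · have hle : ∀ Z, ENNReal.ofReal (V Z) * H Z ≤ ‖pair Γ G‖ₑ⁻¹ * ENNReal.ofReal (V Z₀) *
        (ENNReal.ofReal (V (Z - Z₀)) * ‖stftS Φ Φ (Z - Z₀)‖ₑ) := by
      intro Z
      have e : ‖stftS Φ Γ Z‖ₑ = ‖stftS Φ Φ (Z - Z₀)‖ₑ := by
        rw [← ofReal_norm, ← ofReal_norm, stftS_apply, hΓ, norm_pair_tfShift]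
      have e2 : ENNReal.ofReal (V Z) ≤ ENNReal.ofReal (V Z₀) * ENNReal.ofReal (V (Z - Z₀)) := by
        rw [← ENNReal.ofReal_mul (hv.nonneg _)]
        refine ENNReal.ofReal_le_ofReal ?_
        simpa using hVs Z₀ (Z - Z₀)
      calc _ ≤ (ENNReal.ofReal (V Z₀) * ENNReal.ofReal (V (Z - Z₀))) * H Z := by gcongr
        _ = _ := by rw [hH]; dsimp only; rw [e]; ring
    refine ((lintegral_mono hle).trans_lt ?_).ne
    rw [lintegral_const_mul' _ _ (ENNReal.mul_ne_top (ENNReal.inv_ne_top.2 hpe)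
        ENNReal.ofReal_ne_top),
      lintegral_sub_right_eq_self (fun Z => ENNReal.ofReal (V Z) * ‖stftS Φ Φ Z‖ₑ)]
    exact ENNReal.mul_lt_top (ENNReal.mul_lt_top (ENNReal.inv_lt_top.2 hpe.bot_lt)
      ENNReal.ofReal_lt_top) (lintegral_stftS_tauWigner_lt_top hv τ hg)
  · rw [modNorm_eq_mixedNorm _ _ _ (fun Z => hv.nonneg _),
      modNorm_eq_mixedNorm _ _ _ (fun Z => hv.nonneg _)]
    have h := mixedNorm_le_of_le_conv (p := ⊤) (q := 1) le_top le_rfl zero_le_one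
      (fun Z => hv.nonneg _) hVc.measurable hVc.measurable hVs
      (S := fun Z => ‖stft Φ σ Z‖ₑ) (F := fun Z => ‖stft G σ Z‖ₑ) (H := H)
      (continuous_stft G σ).measurable.enorm hHm (fun W => by
        have h1 := enorm_stft_le_lintegral σ Γ G Φ W
        calc ‖stft Φ σ W‖ₑ = ‖pair Γ G‖ₑ⁻¹ * (‖pair Γ G‖ₑ * ‖stft Φ σ W‖ₑ) := by
              rw [← mul_assoc, ENNReal.inv_mul_cancel hpe enorm_ne_top, one_mul]
          _ ≤ ‖pair Γ G‖ₑ⁻¹ * ∫⁻ Z, ‖stft G σ Z‖ₑ * ‖stftS Φ Γ (W - Z)‖ₑ := by gcongr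
          _ = _ := by
              rw [← lintegral_const_mul' _ _ (ENNReal.inv_ne_top.2 hpe)]
              refine lintegral_congr fun Z => ?_
              rw [hH]
              ring)
    rwa [ENNReal.ofReal_one, one_mul] at h

/-- The Gabor matrix of `Op_τ(σ)` is dominated by a convolution kernel in `L^1_v`. -/
theorem exists_kernel_bound (hv : IsSubmultWeight v) (τ : ℝ) {g : 𝓢(E, ℂ)} (hg0 : g ≠ 0)
    (hg : ∫⁻ z, ENNReal.ofReal (v z) * ‖stftS g g z‖ₑ < ⊤) {G : 𝓢(Phase E, ℂ)} (hG : G ≠ 0) :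
    ∃ C : ℝ≥0∞, C ≠ ⊤ ∧ ∀ σ : 𝓢'(Phase E, ℂ), ∃ H : Phase E → ℝ≥0∞, Measurable H ∧
      (∀ w z, ‖opTau τ σ (tfShift z g) (conjS (tfShift w g))‖ₑ ≤ H (w - z)) ∧
      ∫⁻ z, ENNReal.ofReal (v z) * H z
        ≤ C * modNorm G ⊤ 1 (fun Z => v (sympInv Z.snd)) σ := by
  obtain ⟨C, hC, hCσ⟩ := exists_modNorm_tauWigner_le hv τ hg0 hg hG
  obtain ⟨K, -, hKt, hK⟩ := exists_lintegral_comp_equiv (symp E)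
  set Φ := tauWigner τ g g with hΦ
  refine ⟨K * C, ENNReal.mul_ne_top hKt hC, fun σ => ?_⟩
  have hcont : Continuous (stft Φ σ) := continuous_stft Φ σ
  set N : Phase E → ℝ≥0∞ := fun ξ =>
    eLpNorm (fun X : Phase E => ‖stft Φ σ (WithLp.toLp 2 (X, ξ))‖ₑ) ⊤ volume with hN
  have hNm : Measurable N := measurable_eLpNorm_slice (E := Phase E) hcont.measurable.enorm ⊤
  -- The M^{∞,1} norm only sees an essential supremum; continuity of V_Φσ makes it a bound at every
  -- point, since an open set of violations would have positive measure.
  have hsup : ∀ X ξ : Phase E, ‖stft Φ σ (WithLp.toLp 2 (X, ξ))‖ₑ ≤ N ξ := by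
    intro X ξ
    have hc : Continuous fun X : Phase E => ‖stft Φ σ (WithLp.toLp 2 (X, ξ))‖ₑ :=
      (hcont.comp (by fun_prop)).enorm
    have hae : ∀ᵐ X : Phase E, ‖stft Φ σ (WithLp.toLp 2 (X, ξ))‖ₑ ≤ N ξ := by
      have := ENNReal.ae_le_essSup (μ := (volume : Measure (Phase E)))
        (fun X : Phase E => ‖stft Φ σ (WithLp.toLp 2 (X, ξ))‖ₑ)
      simpa [hN, eLpNormEssSup] using this
    by_contra! hlt
    have hopen : IsOpen {X : Phase E | N ξ < ‖stft Φ σ (WithLp.toLp 2 (X, ξ))‖ₑ} :=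
      isOpen_lt continuous_const hc
    have hnull : volume {X : Phase E | N ξ < ‖stft Φ σ (WithLp.toLp 2 (X, ξ))‖ₑ} = 0 := by
      rw [ae_iff] at hae
      simpa only [not_le] using hae
    exact (hopen.measure_pos volume ⟨X, hlt⟩).ne' hnull
  -- The kernel is H(u) = sup_X |V_Φσ(X, Ju)|, matching the frequency component J(w - z) of the
  -- Gabor matrix.
  refine ⟨fun u => N (symp E u), hNm.comp (symp E).continuous.measurable, fun w z => ?_, ?_⟩
  · rw [← ofReal_norm, norm_opTau_tfShift, ofReal_norm]
    dsimp only
    rw [← wignerShift_snd τ]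
    exact hsup (wignerShift E τ (WithLp.toLp 2 (w, z))).fst _
  · have e : ∀ u : Phase E, ENNReal.ofReal (v u) * N (symp E u)
        = (fun ξ => ENNReal.ofReal (v (sympInv ξ)) * N ξ) (symp E u) := by
      intro u
      dsimp only
      rw [sympInv_symp]
    rw [lintegral_congr e, hK fun ξ => ENNReal.ofReal (v (sympInv ξ)) * N ξ, mul_assoc]
    gcongr
    refine le_trans (le_of_eq ?_) (hCσ σ)
    rw [modNorm_eq_mixedNorm _ _ _ (fun Z => hv.nonneg _), mixedNorm,
      eLpNorm_one_eq_lintegral_enorm]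
    refine lintegral_congr fun ξ => ?_
    simp only [enorm_eq_self, hN, eLpNorm_exponent_top, eLpNormEssSup]
    exact ENNReal.essSup_const_mul.symm

end SymbolWindow

/-! ### The averaged window γ and the embedding into M^{∞,∞}_m. -/

section AuxiliaryWindow

variable {E : Type} [NormedAddCommGroup E] [InnerProductSpace ℝ E]

/-- The box `{s | ‖s₁‖ ≤ δ, ‖s₂‖ ≤ δ}` in phase space. -/
def phaseBox (E : Type) [NormedAddCommGroup E] (δ : ℝ) : Set (Phase E) :=
  {s | s.fst ∈ Metric.closedBall 0 δ ∧ s.snd ∈ Metric.closedBall 0 δ}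

theorem norm_le_of_mem_phaseBox {δ : ℝ} {s : Phase E} (hs : s ∈ phaseBox E δ) : ‖s‖ ≤ δ + δ :=
  (norm_le_add s).trans (add_le_add (mem_closedBall_zero_iff.1 hs.1)
    (mem_closedBall_zero_iff.1 hs.2))

theorem neg_mem_phaseBox {δ : ℝ} {s : Phase E} (hs : s ∈ phaseBox E δ) : -s ∈ phaseBox E δ := by
  constructor
  · simpa using hs.1
  · simpa using hs.2

theorem isClosed_phaseBox (δ : ℝ) : IsClosed (phaseBox E δ) :=
  (Metric.isClosed_closedBall.preimage (by fun_prop : Continuous fun s : Phase E => s.fst)).inter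
    (Metric.isClosed_closedBall.preimage (by fun_prop : Continuous fun s : Phase E => s.snd))

theorem phaseBox_mem_nhds {δ : ℝ} (hδ : 0 < δ) : phaseBox E δ ∈ 𝓝 (0 : Phase E) := by
  filter_upwards [Metric.closedBall_mem_nhds (0 : Phase E) hδ] with s hs
  rw [mem_closedBall_zero_iff] at hs
  exact ⟨mem_closedBall_zero_iff.2 ((WithLp.norm_fst_le E s).trans hs),
    mem_closedBall_zero_iff.2 ((WithLp.norm_snd_le E s).trans hs)⟩

variable [FiniteDimensional ℝ E] [MeasurableSpace E] [BorelSpace E]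

theorem measurableSet_phaseBox (δ : ℝ) : MeasurableSet (phaseBox E δ) :=
  (isClosed_phaseBox δ).measurableSet

theorem volume_phaseBox_lt_top (δ : ℝ) : volume (phaseBox E δ) < ⊤ :=
  (measure_mono fun _ hs => mem_closedBall_zero_iff.2 (norm_le_of_mem_phaseBox hs)).trans_lt
    (measure_closedBall_lt_top (x := (0 : Phase E)) (r := δ + δ))

theorem setLIntegral_phaseBox {F : Phase E → ℝ≥0∞} (hF : Measurable F) (δ : ℝ) :
    ∫⁻ s in phaseBox E δ, F s = ∫⁻ y in Metric.closedBall (0 : E) δ,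
      ∫⁻ x in Metric.closedBall (0 : E) δ, F (WithLp.toLp 2 (x, y)) := by
  have hB : MeasurableSet (Metric.closedBall (0 : E) δ) := Metric.isClosed_closedBall.measurableSet
  rw [← lintegral_indicator (measurableSet_phaseBox δ),
    lintegral_phase (hF.indicator (measurableSet_phaseBox δ)), ← lintegral_indicator hB]
  refine lintegral_congr fun y => ?_
  by_cases hy : y ∈ Metric.closedBall (0 : E) δ
  · rw [Set.indicator_of_mem hy, ← lintegral_indicator hB]
    refine lintegral_congr fun x => ?_
    by_cases hx : x ∈ Metric.closedBall (0 : E) δ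
    · rw [Set.indicator_of_mem hx, Set.indicator_of_mem]
      exact ⟨hx, hy⟩
    · rw [Set.indicator_of_notMem hx, Set.indicator_of_notMem]
      exact fun h => hx h.1
  · rw [Set.indicator_of_notMem hy]
    refine (lintegral_congr fun x => ?_).trans lintegral_zero
    exact Set.indicator_of_notMem (fun h => hy h.2) _

theorem tfShift_zero (g : 𝓢(E, ℂ)) : tfShift 0 g = g := by
  ext t
  rw [tfShift_apply]
  simp

theorem integrable_seminorm_tfShift_phaseBox (g : 𝓢(E, ℂ)) (δ : ℝ) (k l : ℕ) :
    Integrable (fun s => SchwartzMap.seminorm ℝ k l (tfShift s g))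
      (volume.restrict (phaseBox E δ)) := by
  have hc : Continuous fun s : Phase E => SchwartzMap.seminorm ℝ k l (tfShift s g) :=
    ((schwartz_withSeminorms ℝ E ℂ).continuous_seminorm (k, l)).comp
      (continuous_tfShift continuous_id continuous_const)
  have hK : IsCompact (phaseBox E δ) :=
    Metric.isCompact_of_isClosed_isBounded (isClosed_phaseBox δ)
      (isBounded_iff_forall_norm_le.2 ⟨_, fun _ hs => norm_le_of_mem_phaseBox hs⟩)
  exact hc.continuousOn.integrableOn_compact hK

/-- Averaging the phase space shifts of `g` over a small box gives a window whose short-time Fourier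
transforms are controlled by local averages. -/
theorem exists_averaged_window {g : 𝓢(E, ℂ)} (hg : g ≠ 0) :
    ∃ (δ : ℝ) (γ : 𝓢(E, ℂ)), pair g γ ≠ 0 ∧ ∀ (f : 𝓢'(E, ℂ)) (z : Phase E),
      ‖stft γ f z‖ₑ ≤ ∫⁻ s in phaseBox E δ, ‖stft g f (z + s)‖ₑ := by
  have hcont : Continuous fun s => (stftS g g s).re :=
    Complex.continuous_re.comp (stftS g g).continuous
  have h0 : 0 < (stftS g g 0).re := by
    rw [stftS_apply, tfShift_zero]
    have hne := pair_self_ne_zero hg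
    rw [pair_self] at hne ⊢
    rw [Complex.ofReal_re]
    exact lt_of_le_of_ne (integral_nonneg fun t => by positivity)
      (fun h => hne (by rw [← h, Complex.ofReal_zero]))
  obtain ⟨ε, hε, hball⟩ := Metric.eventually_nhds_iff.1 (hcont.continuousAt.eventually_const_lt h0)
  -- Points of the box have norm at most 2δ < ε, so Re V_gg is positive on all of it.
  set δ := ε / 3 with hδ
  have hδ0 : 0 < δ := by positivity
  have hpos : ∀ s ∈ phaseBox E δ, 0 < (stftS g g s).re := by
    intro s hs
    apply hball
    rw [dist_zero_right]
    have := norm_le_of_mem_phaseBox hs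
    linarith
  have hF : Continuous fun s : Phase E => tfShift s g :=
    continuous_tfShift continuous_id continuous_const
  have hi := integrable_seminorm_tfShift_phaseBox g δ
  -- Here γ = ∫ π(s)g ds over the box, so ⟨g, γ⟩ = ∫ V_gg(s) ds has positive real part.
  set γ := schwartzIntegral _ hF hi with hγ
  have hγt : ∀ t, γ t = ∫ s in phaseBox E δ, tfShift s g t := fun t => rfl
  refine ⟨δ, γ, ?_, fun f z => ?_⟩
  · set u : 𝓢(E, ℂ) →L[ℝ] ℂ := (realFunctional (g : 𝓢'(E, ℂ))) ∘L conjS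
    have hu : ∀ φ, u φ = pair g φ := fun φ => coe_conjS_eq_pair g φ
    have h1 := clm_integral_schwartz hF hi hγt u
    have h2 := integrable_comp_schwartz hF hi u
    simp only [hu, ← stftS_apply] at h1 h2
    intro hzero
    rw [hzero] at h1
    have h3 : ∫ s in phaseBox E δ, (stftS g g s).re = 0 := by
      have := Complex.reCLM.integral_comp_comm h2
      simp only [Complex.reCLM_apply] at this
      rw [this, ← h1, Complex.zero_re]
    have h4 : 0 < ∫ s in phaseBox E δ, (stftS g g s).re := by
      rw [setIntegral_pos_iff_support_of_nonneg_ae]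
      · have hsub : phaseBox E δ ⊆ Function.support (fun s => (stftS g g s).re) ∩ phaseBox E δ :=
          fun s hs => ⟨(hpos s hs).ne', hs⟩
        exact (Measure.measure_pos_of_mem_nhds volume (phaseBox_mem_nhds hδ0)).trans_le
          (measure_mono hsub)
      · exact (ae_restrict_iff' (measurableSet_phaseBox δ)).2
          (.of_forall fun s hs => (hpos s hs).le)
      · exact h2.re
    exact h4.ne' h3
  · have h1 := clm_integral_schwartz hF hi hγt ((realFunctional f) ∘L conjS ∘L
      (tfShift z).restrictScalars ℝ)
    change stft γ f z = ∫ s in phaseBox E δ, f (conjS (tfShift z (tfShift s g))) at h1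
    rw [h1]
    refine (enorm_integral_le_lintegral_enorm _).trans (lintegral_mono fun s => le_of_eq ?_)
    rw [tfShift_tfShift, conjS_smul, map_smul, smul_eq_mul, ← ofReal_norm, norm_mul,
      RCLike.norm_conj, Circle.norm_coe, one_mul, ofReal_norm]
    rfl

/-- Weights moderate with respect to `v` whose inverse grows at most polynomially. -/
structure IsTemperedWeight (v m : Phase E → ℝ) (C A : ℝ) (N : ℕ) : Prop where
  measurable : Measurable m
  pos : ∀ z, 0 < m z
  const_nonneg : 0 ≤ C
  moderate : ∀ z₁ z₂, m (z₁ + z₂) ≤ C * v z₁ * m z₂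
  inv_le : ∀ z, (m z)⁻¹ ≤ A * (1 + ‖z‖) ^ N

variable {v m : Phase E → ℝ} {C A : ℝ} {N : ℕ}

theorem IsSubmultWeight.exists_bound_phaseBox (hv : IsSubmultWeight v) (δ : ℝ) :
    ∃ M : ℝ, ∀ s ∈ phaseBox E δ, v s ≤ M := by
  obtain ⟨M, hM⟩ := (isCompact_closedBall (0 : Phase E) (δ + δ)).exists_bound_of_continuousOn
    hv.continuous.continuousOn
  exact ⟨M, fun s hs => (le_abs_self _).trans
    (hM s (mem_closedBall_zero_iff.2 (norm_le_of_mem_phaseBox hs)))⟩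

/-- The space `M^{p,q}_m` embeds into `M^{∞,∞}_m`. -/
theorem exists_sup_le_modNorm (hv : IsSubmultWeight v) (hm : IsTemperedWeight v m C A N)
    {g γ : 𝓢(E, ℂ)} {δ : ℝ} (hγ : ∀ (f : 𝓢'(E, ℂ)) (z : Phase E),
      ‖stft γ f z‖ₑ ≤ ∫⁻ s in phaseBox E δ, ‖stft g f (z + s)‖ₑ)
    {p q : ℝ≥0∞} (hp : 1 ≤ p) (hq : 1 ≤ q) :
    ∃ K : ℝ≥0∞, K ≠ ⊤ ∧ ∀ (f : 𝓢'(E, ℂ)) (z : Phase E),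
      ENNReal.ofReal (m z) * ‖stft γ f z‖ₑ ≤ K * modNorm g p q m f := by
  obtain ⟨M, hM⟩ := hv.exists_bound_phaseBox δ
  obtain ⟨K, hK, hloc⟩ := exists_setLIntegral_le_mixedNorm hp hq
    (B := Metric.closedBall (0 : E) δ) measure_closedBall_lt_top.ne
  have hKM : ENNReal.ofReal C * ENNReal.ofReal M ≠ ⊤ :=
    ENNReal.mul_ne_top ENNReal.ofReal_ne_top ENNReal.ofReal_ne_top
  refine ⟨ENNReal.ofReal C * ENNReal.ofReal M * K, ENNReal.mul_ne_top hKM hK, fun f z => ?_⟩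
  rw [modNorm_eq_mixedNorm g p q (fun z => (hm.pos z).le)]
  have hVm : Measurable fun z => ‖stft g f z‖ₑ := (continuous_stft g f).measurable.enorm
  have hmm := hm.measurable
  set F : Phase E → ℝ≥0∞ := fun z => ENNReal.ofReal (m z) * ‖stft g f z‖ₑ with hF
  have hFm : Measurable F := by fun_prop
  calc ENNReal.ofReal (m z) * ‖stft γ f z‖ₑ
      ≤ ENNReal.ofReal (m z) * ∫⁻ s in phaseBox E δ, ‖stft g f (z + s)‖ₑ := by
        gcongr; exact hγ f z
    _ = ∫⁻ s in phaseBox E δ, ENNReal.ofReal (m z) * ‖stft g f (z + s)‖ₑ :=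
        (lintegral_const_mul' _ _ ENNReal.ofReal_ne_top).symm
    _ ≤ ∫⁻ s in phaseBox E δ, ENNReal.ofReal C * ENNReal.ofReal M * F (z + s) := by
        refine setLIntegral_mono' (measurableSet_phaseBox δ) fun s hs => ?_
        have h1 := ofReal_mul_le_of_moderate hm.const_nonneg hv.nonneg hm.moderate z (z + s)
        have h2 : v (z - (z + s)) ≤ M := by
          rw [sub_add_cancel_left]
          exact hM _ (neg_mem_phaseBox hs)
        calc _ ≤ (ENNReal.ofReal C * ENNReal.ofReal M * ENNReal.ofReal (m (z + s)))
              * ‖stft g f (z + s)‖ₑ := by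
              gcongr
              refine h1.trans ?_
              gcongr
          _ = _ := by rw [hF]; ring
    _ = ENNReal.ofReal C * ENNReal.ofReal M * ∫⁻ s in phaseBox E δ, F (z + s) :=
        lintegral_const_mul' _ _ hKM
    _ ≤ ENNReal.ofReal C * ENNReal.ofReal M * (K * mixedNorm p q F) := by
        gcongr
        rw [setLIntegral_phaseBox (F := fun s => F (z + s)) (by fun_prop)]
        exact hloc F hFm z
    _ = _ := by ring

/-- The local average is a convolution with the indicator of the box, which is symmetric. Young's
inequality therefore gives a constant that does not depend on p and q. -/
theorem exists_mixedNorm_stft_le (hv : IsSubmultWeight v) (hm : IsTemperedWeight v m C A N)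
    {g γ : 𝓢(E, ℂ)} {δ : ℝ} (hγ : ∀ (f : 𝓢'(E, ℂ)) (z : Phase E),
      ‖stft γ f z‖ₑ ≤ ∫⁻ s in phaseBox E δ, ‖stft g f (z + s)‖ₑ) :
    ∃ K : ℝ≥0∞, K ≠ ⊤ ∧ ∀ p q : ℝ≥0∞, 1 ≤ p → 1 ≤ q → ∀ f : 𝓢'(E, ℂ),
      modNorm γ p q m f ≤ K * modNorm g p q m f := by
  obtain ⟨M, hM⟩ := hv.exists_bound_phaseBox δ
  set H : Phase E → ℝ≥0∞ := (phaseBox E δ).indicator 1 with hH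
  have hHm : Measurable H := measurable_one.indicator (measurableSet_phaseBox δ)
  refine ⟨ENNReal.ofReal C * ∫⁻ z, ENNReal.ofReal (v z) * H z,
    ENNReal.mul_ne_top ENNReal.ofReal_ne_top ?_, fun p q hp hq f => ?_⟩
  · have hle : ∀ z, ENNReal.ofReal (v z) * H z
        ≤ (phaseBox E δ).indicator (fun _ => ENNReal.ofReal M) z := by
      intro z
      by_cases hz : z ∈ phaseBox E δ
      · rw [hH, Set.indicator_of_mem hz, Set.indicator_of_mem hz, Pi.one_apply, mul_one]
        exact ENNReal.ofReal_le_ofReal (hM z hz)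
      · rw [hH, Set.indicator_of_notMem hz, Set.indicator_of_notMem hz, mul_zero]
    refine ((lintegral_mono hle).trans_lt ?_).ne
    rw [lintegral_indicator (measurableSet_phaseBox δ), setLIntegral_const]
    exact ENNReal.mul_lt_top ENNReal.ofReal_lt_top (volume_phaseBox_lt_top δ)
  · rw [modNorm_eq_mixedNorm γ p q (fun z => (hm.pos z).le),
      modNorm_eq_mixedNorm g p q (fun z => (hm.pos z).le)]
    refine mixedNorm_le_of_le_conv hp hq hm.const_nonneg hv.nonneg hv.continuous.measurable
      hm.measurable hm.moderate (continuous_stft g f).measurable.enorm hHm fun w => ?_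
    refine (hγ f w).trans (le_of_eq ?_)
    rw [← lintegral_indicator (measurableSet_phaseBox δ), ← lintegral_add_right_eq_self _ (-w)]
    refine lintegral_congr fun z => ?_
    have hiff : z + -w ∈ phaseBox E δ ↔ w - z ∈ phaseBox E δ := by
      constructor
      · intro h
        have := neg_mem_phaseBox h
        rwa [neg_add, neg_neg, add_comm, ← sub_eq_add_neg] at this
      · intro h
        have := neg_mem_phaseBox h
        rwa [neg_sub, sub_eq_add_neg] at this
    by_cases hz : z + -w ∈ phaseBox E δ
    · rw [Set.indicator_of_mem hz, hH, Set.indicator_of_mem (hiff.1 hz), Pi.one_apply, mul_one,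
        add_comm z, add_neg_cancel_left]
    · rw [Set.indicator_of_notMem hz, hH, Set.indicator_of_notMem (fun h => hz (hiff.2 h)),
        mul_zero]

end AuxiliaryWindow

/-! ### The extension of Op_τ(σ) by a synthesis integral. -/

section Extension

variable {E : Type} [NormedAddCommGroup E] [InnerProductSpace ℝ E]

/-- The change of variables `(x, y) ↦ (y, x)`. -/
noncomputable def phaseSwap (E : Type) [NormedAddCommGroup E] [InnerProductSpace ℝ E] :
    Phase E ≃L[ℝ] Phase E where
  toFun z := WithLp.toLp 2 (z.snd, z.fst)
  invFun z := WithLp.toLp 2 (z.snd, z.fst)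
  map_add' _ _ := rfl
  map_smul' _ _ := rfl
  left_inv _ := rfl
  right_inv _ := rfl
  continuous_toFun := by fun_prop
  continuous_invFun := by fun_prop

variable [FiniteDimensional ℝ E] [MeasurableSpace E] [BorelSpace E]

/-- The operator `Op_τ(σ)` tested with a fixed Schwartz function. -/
noncomputable def opTauEval (τ : ℝ) (σ : 𝓢'(Phase E, ℂ)) (h : 𝓢(E, ℂ)) : 𝓢(E, ℂ) →L[ℝ] ℂ :=
  (realFunctional σ) ∘L conjS ∘L
    ((partialFourier ∘L compCLMOfContinuousLinearEquiv ℂ (tauShear τ) ∘L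
      compCLMOfContinuousLinearEquiv ℂ (phaseSwap E) ∘L
        tensor (conjS h)).restrictScalars ℝ) ∘L conjS

/-- This provides continuity of f ↦ Op_τ(σ)f(h). `tensor` is a continuous linear map only in its
first factor, so f is placed there and the factors are swapped back. -/
theorem opTauEval_apply (τ : ℝ) (σ : 𝓢'(Phase E, ℂ)) (h f : 𝓢(E, ℂ)) :
    opTauEval τ σ h f = opTau τ σ f h := by
  have e : compCLMOfContinuousLinearEquiv ℂ (phaseSwap E) (tensor (conjS h) (conjS f))
      = tensor (conjS f) (conjS h) := by
    ext z
    exact mul_comm _ _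
  change σ (conjS (partialFourier (compCLMOfContinuousLinearEquiv ℂ (tauShear τ)
    (compCLMOfContinuousLinearEquiv ℂ (phaseSwap E) (tensor (conjS h) (conjS f)))))) = _
  rw [e]
  rfl

theorem tauWigner_smul_right (τ : ℝ) (a : ℂ) (f g : 𝓢(E, ℂ)) :
    tauWigner τ f (a • g) = starRingEnd ℂ a • tauWigner τ f g := by
  have e : tensor (conjS (a • g)) f = starRingEnd ℂ a • tensor (conjS g) f := by
    ext z
    simp only [smul_apply, tensor_apply, conjS_smul, smul_eq_mul]
    ring
  rw [tauWigner, e, map_smul, map_smul, tauWigner]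

theorem opTau_smul_apply (τ : ℝ) (σ : 𝓢'(Phase E, ℂ)) (a : ℂ) (f h : 𝓢(E, ℂ)) :
    opTau τ σ (a • f) h = a * opTau τ σ f h := by
  rw [opTau_apply, opTau_apply, tauWigner_smul_right, conjS_smul, map_smul, Complex.conj_conj,
    smul_eq_mul]

theorem continuous_opTau_tfShift (τ : ℝ) (σ : 𝓢'(Phase E, ℂ)) (g h : 𝓢(E, ℂ)) :
    Continuous fun z => opTau τ σ (tfShift z g) h := by
  simp only [← opTauEval_apply]
  exact (opTauEval τ σ h).continuous.comp (continuous_tfShift continuous_id continuous_const)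

variable {τ : ℝ} {σ : 𝓢'(Phase E, ℂ)} {g γ : 𝓢(E, ℂ)} {H : Phase E → ℝ≥0∞}

/-- Expand the test function in the shifts π(w)g by the weak inversion formula; the coefficients are
then paired with the Gabor matrix. -/
theorem enorm_opTau_tfShift_le
    (hH : ∀ w z, ‖opTau τ σ (tfShift z g) (conjS (tfShift w g))‖ₑ ≤ H (w - z))
    (h : 𝓢(E, ℂ)) (z : Phase E) :
    ‖pair g g‖ₑ * ‖opTau τ σ (tfShift z g) h‖ₑ
      ≤ ∫⁻ w, ‖stftS g (conjS h) w‖ₑ * H (w - z) := by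
  have e := pair_mul_apply_conjS (opTau τ σ (tfShift z g)) g g (conjS h)
  rw [conjS_conjS] at e
  rw [← enorm_mul, e]
  refine (enorm_integral_le_lintegral_enorm _).trans (lintegral_mono fun w => ?_)
  dsimp only
  rw [enorm_mul, ← ofReal_norm (starRingEnd ℂ _), RCLike.norm_conj, ofReal_norm]
  gcongr
  exact hH w z

variable {v m : Phase E → ℝ} {C A : ℝ} {N : ℕ}

/-- Moderateness of m read backwards: 1/m is moderate too, with the arguments exchanged. -/
theorem IsTemperedWeight.ofReal_inv_le (hv : IsSubmultWeight v) (hm : IsTemperedWeight v m C A N)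
    (w z : Phase E) : ENNReal.ofReal (m z)⁻¹
      ≤ ENNReal.ofReal C * ENNReal.ofReal (v (w - z)) * ENNReal.ofReal (m w)⁻¹ := by
  rw [← ENNReal.ofReal_mul hm.const_nonneg,
    ← ENNReal.ofReal_mul (mul_nonneg hm.const_nonneg (hv.nonneg _))]
  refine ENNReal.ofReal_le_ofReal ?_
  have h := hm.moderate (w - z) z
  rw [sub_add_cancel] at h
  rw [← div_eq_mul_inv, le_div_iff₀ (hm.pos w), inv_mul_le_iff₀ (hm.pos z)]
  linarith

theorem IsTemperedWeight.ofReal_inv_mul_cancel (hm : IsTemperedWeight v m C A N) (z : Phase E) :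
    ENNReal.ofReal (m z)⁻¹ * ENNReal.ofReal (m z) = 1 := by
  rw [← ENNReal.ofReal_mul (inv_nonneg.2 (hm.pos z).le), inv_mul_cancel₀ (hm.pos z).ne',
    ENNReal.ofReal_one]

/-- The weighted L¹ bound dual to the M^{∞,∞}_m estimate: the weight 1/m(z) is passed to 1/m(w) at
the cost of v(w - z), and Tonelli separates the kernel from the test function. -/
theorem lintegral_inv_weight_opTau_le (hv : IsSubmultWeight v) (hm : IsTemperedWeight v m C A N)
    (hHm : Measurable H)
    (hH : ∀ w z, ‖opTau τ σ (tfShift z g) (conjS (tfShift w g))‖ₑ ≤ H (w - z)) (h : 𝓢(E, ℂ)) :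
    ‖pair g g‖ₑ * ∫⁻ z, ENNReal.ofReal (m z)⁻¹ * ‖opTau τ σ (tfShift z g) h‖ₑ
      ≤ ENNReal.ofReal C * (∫⁻ z, ENNReal.ofReal (v z) * H z) *
        ∫⁻ w, ENNReal.ofReal (m w)⁻¹ * ‖stftS g (conjS h) w‖ₑ := by
  have hmm := hm.measurable
  have hvm := hv.continuous.measurable
  have hSm : Measurable fun w => ‖stftS g (conjS h) w‖ₑ :=
    (stftS g (conjS h)).continuous.measurable.enorm
  have hvH : Measurable fun z => ENNReal.ofReal (v z) * H z := by fun_prop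
  rw [← lintegral_const_mul' _ _ enorm_ne_top]
  calc ∫⁻ z, ‖pair g g‖ₑ * (ENNReal.ofReal (m z)⁻¹ * ‖opTau τ σ (tfShift z g) h‖ₑ)
      ≤ ∫⁻ z, ∫⁻ w, ENNReal.ofReal C * (ENNReal.ofReal (m w)⁻¹ * ‖stftS g (conjS h) w‖ₑ)
          * (ENNReal.ofReal (v (w - z)) * H (w - z)) := by
        refine lintegral_mono fun z => ?_
        calc _ = ENNReal.ofReal (m z)⁻¹ * (‖pair g g‖ₑ * ‖opTau τ σ (tfShift z g) h‖ₑ) := by ring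
          _ ≤ ENNReal.ofReal (m z)⁻¹ * ∫⁻ w, ‖stftS g (conjS h) w‖ₑ * H (w - z) := by
            gcongr
            exact enorm_opTau_tfShift_le hH h z
          _ = ∫⁻ w, ENNReal.ofReal (m z)⁻¹ * (‖stftS g (conjS h) w‖ₑ * H (w - z)) :=
            (lintegral_const_mul' _ _ ENNReal.ofReal_ne_top).symm
          _ ≤ _ := by
            refine lintegral_mono fun w => ?_
            calc _ ≤ (ENNReal.ofReal C * ENNReal.ofReal (v (w - z)) * ENNReal.ofReal (m w)⁻¹)
                  * (‖stftS g (conjS h) w‖ₑ * H (w - z)) := by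
                  gcongr
                  exact hm.ofReal_inv_le hv w z
              _ = _ := by ring
    _ = ∫⁻ w, ENNReal.ofReal C * (ENNReal.ofReal (m w)⁻¹ * ‖stftS g (conjS h) w‖ₑ)
          * ∫⁻ z, ENNReal.ofReal (v z) * H z := by
        rw [lintegral_lintegral_swap (by fun_prop)]
        refine lintegral_congr fun w => ?_
        rw [lintegral_const_mul _ (by fun_prop)]
        congr 1
        exact lintegral_sub_left_eq_self (fun z => ENNReal.ofReal (v z) * H z) w
    _ = _ := by
        rw [lintegral_mul_const _ (by fun_prop), lintegral_const_mul _ (by fun_prop)]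
        ring

/-- Schwartz decay of order N + M beats the growth N of 1/m and leaves an integrable power. The
bound is by a continuous seminorm, so that functionals built from it are continuous. -/
theorem IsTemperedWeight.exists_lintegral_inv_mul_le {D : Type} [NormedAddCommGroup D]
    [InnerProductSpace ℝ D] [FiniteDimensional ℝ D] [MeasurableSpace D] [BorelSpace D]
    {v m : Phase D → ℝ} (hm : IsTemperedWeight v m C A N) :
    ∃ (s : Finset (ℕ × ℕ)) (B : ℝ), 0 ≤ B ∧ ∀ F : 𝓢(Phase D, ℂ),
      ∫⁻ w, ENNReal.ofReal (m w)⁻¹ * ‖F w‖ₑ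
        ≤ ENNReal.ofReal (B * (s.sup (schwartzSeminormFamily ℝ (Phase D) ℂ)) F) := by
  set M := (volume : Measure (Phase D)).integrablePower
  have hI := Measure.integrable_pow_neg_integrablePower (volume : Measure (Phase D))
  have hA : 0 ≤ A := by
    have h1 := hm.inv_le 0
    have h2 := inv_pos.2 (hm.pos 0)
    rw [norm_zero, add_zero, one_pow, mul_one] at h1
    linarith
  refine ⟨Finset.Iic (N + M, 0), A * 2 ^ (N + M) * ∫ w : Phase D, (1 + ‖w‖) ^ (-(M : ℝ)),
    mul_nonneg (by positivity) (integral_nonneg fun w => by positivity), fun F => ?_⟩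
  set S := ((Finset.Iic (N + M, 0)).sup (schwartzSeminormFamily ℝ (Phase D) ℂ)) F with hS
  have hS0 : 0 ≤ S := apply_nonneg _ _
  have hpt : ∀ w, (m w)⁻¹ * ‖F w‖ ≤ A * 2 ^ (N + M) * S * (1 + ‖w‖) ^ (-(M : ℝ)) := by
    intro w
    have h := SchwartzMap.one_add_le_sup_seminorm_apply (𝕜 := ℝ) (m := (N + M, 0)) le_rfl le_rfl F w
    rw [norm_iteratedFDeriv_zero] at h
    rw [Real.rpow_neg (by positivity), Real.rpow_natCast, ← div_eq_mul_inv,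
      le_div_iff₀ (by positivity)]
    calc (m w)⁻¹ * ‖F w‖ * (1 + ‖w‖) ^ M
        ≤ A * (1 + ‖w‖) ^ N * ‖F w‖ * (1 + ‖w‖) ^ M := by
          gcongr
          exact hm.inv_le w
      _ = A * ((1 + ‖w‖) ^ (N + M) * ‖F w‖) := by rw [pow_add]; ring
      _ ≤ A * (2 ^ (N + M) * S) := mul_le_mul_of_nonneg_left h hA
      _ = _ := by ring
  calc ∫⁻ w, ENNReal.ofReal (m w)⁻¹ * ‖F w‖ₑ
      ≤ ∫⁻ w, ENNReal.ofReal (A * 2 ^ (N + M) * S * (1 + ‖w‖) ^ (-(M : ℝ))) := by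
        refine lintegral_mono fun w => ?_
        dsimp only
        rw [← ofReal_norm, ← ENNReal.ofReal_mul (inv_nonneg.2 (hm.pos w).le)]
        exact ENNReal.ofReal_le_ofReal (hpt w)
    _ = ENNReal.ofReal (∫ w : Phase D, A * 2 ^ (N + M) * S * (1 + ‖w‖) ^ (-(M : ℝ))) :=
        (ofReal_integral_eq_lintegral_ofReal (hI.const_mul _)
          (.of_forall fun w => by positivity)).symm
    _ = _ := by
        rw [integral_const_mul]
        congr 1
        ring

/-- The Gabor matrix of `Op_τ(σ)` with respect to `g` is dominated by a convolution kernel in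
`L^1_v`. -/
structure IsGaborKernel (v : Phase E → ℝ) (τ : ℝ) (σ : 𝓢'(Phase E, ℂ)) (g : 𝓢(E, ℂ))
    (H : Phase E → ℝ≥0∞) : Prop where
  measurable : Measurable H
  bound : ∀ w z, ‖opTau τ σ (tfShift z g) (conjS (tfShift w g))‖ₑ ≤ H (w - z)
  lintegral_ne_top : ∫⁻ z, ENNReal.ofReal (v z) * H z ≠ ⊤

theorem exists_lintegral_inv_weight_opTau_le (hg : g ≠ 0) (hv : IsSubmultWeight v)
    (hm : IsTemperedWeight v m C A N) (hH : IsGaborKernel v τ σ g H) :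
    ∃ (s : Finset (ℕ × ℕ)) (B : ℝ), 0 ≤ B ∧ ∀ h : 𝓢(E, ℂ),
      ∫⁻ z, ENNReal.ofReal (m z)⁻¹ * ‖opTau τ σ (tfShift z g) h‖ₑ ≤ ENNReal.ofReal
        (B * (s.sup (schwartzSeminormFamily ℝ (Phase E) ℂ)) (stftS g (conjS h))) := by
  obtain ⟨s, B, hB, hs⟩ := hm.exists_lintegral_inv_mul_le
  have hp0 : ‖pair g g‖ₑ ≠ 0 := enorm_ne_zero.2 (pair_self_ne_zero hg)
  set K : ℝ≥0∞ := ‖pair g g‖ₑ⁻¹ * (ENNReal.ofReal C * ∫⁻ z, ENNReal.ofReal (v z) * H z) with hK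
  have hKt : K ≠ ⊤ := ENNReal.mul_ne_top (ENNReal.inv_ne_top.2 hp0)
    (ENNReal.mul_ne_top ENNReal.ofReal_ne_top hH.lintegral_ne_top)
  refine ⟨s, K.toReal * B, by positivity, fun h => ?_⟩
  have h1 := lintegral_inv_weight_opTau_le hv hm hH.measurable hH.bound h
  rw [mul_comm, ← ENNReal.le_div_iff_mul_le (.inl hp0) (.inl enorm_ne_top)] at h1
  refine h1.trans ?_
  rw [mul_assoc K.toReal, ENNReal.ofReal_mul ENNReal.toReal_nonneg, ENNReal.ofReal_toReal hKt,
    ENNReal.div_eq_inv_mul, ← mul_assoc]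
  gcongr
  exact hs _

/-- Boundedness of the weighted short-time Fourier transform. -/
def HasBoundedSTFT (γ : 𝓢(E, ℂ)) (m : Phase E → ℝ) (f : 𝓢'(E, ℂ)) : Prop :=
  ∃ B : ℝ≥0, ∀ z, ENNReal.ofReal (m z) * ‖stft γ f z‖ₑ ≤ B

/-- Insert (1/m) · m = 1, so that the bounded factor m |V_γf| can be taken out. -/
theorem IsTemperedWeight.enorm_stft_mul_le (hm : IsTemperedWeight v m C A N) {f : 𝓢'(E, ℂ)}
    {B : ℝ≥0} {z : Phase E} (hB : ENNReal.ofReal (m z) * ‖stft γ f z‖ₑ ≤ B) (a : ℂ) :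
    ‖stft γ f z * a‖ₑ ≤ B * (ENNReal.ofReal (m z)⁻¹ * ‖a‖ₑ) := by
  calc ‖stft γ f z * a‖ₑ
      = (ENNReal.ofReal (m z)⁻¹ * ENNReal.ofReal (m z)) * (‖stft γ f z‖ₑ * ‖a‖ₑ) := by
        rw [hm.ofReal_inv_mul_cancel, one_mul, enorm_mul]
    _ = (ENNReal.ofReal (m z) * ‖stft γ f z‖ₑ) * (ENNReal.ofReal (m z)⁻¹ * ‖a‖ₑ) := by ring
    _ ≤ _ := by gcongr

/-- The synthesis integral defining `Op_τ(σ) f` for distributions `f` with bounded weighted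
short-time Fourier transform. -/
noncomputable def opTauIntegral (τ : ℝ) (σ : 𝓢'(Phase E, ℂ)) (g γ : 𝓢(E, ℂ)) (f : 𝓢'(E, ℂ))
    (h : 𝓢(E, ℂ)) : ℂ :=
  (pair g γ)⁻¹ * ∫ z, stft γ f z * opTau τ σ (tfShift z g) h

open Classical in
/-- The extension of `Op_τ(σ)` to tempered distributions by means of the synthesis integral. -/
noncomputable def opTauExt (τ : ℝ) (σ : 𝓢'(Phase E, ℂ)) (g γ : 𝓢(E, ℂ)) (f : 𝓢'(E, ℂ)) :
    𝓢'(E, ℂ) :=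
  if h : ∃ Φ : 𝓢'(E, ℂ), ∀ k, Φ k = opTauIntegral τ σ g γ f k then h.choose else 0

theorem continuous_stft_mul_opTau (τ : ℝ) (σ : 𝓢'(Phase E, ℂ)) (g γ : 𝓢(E, ℂ)) (f : 𝓢'(E, ℂ))
    (h : 𝓢(E, ℂ)) : Continuous fun z => stft γ f z * opTau τ σ (tfShift z g) h :=
  (continuous_stft γ f).mul (continuous_opTau_tfShift τ σ g h)

theorem integrable_stft_mul_opTau (hg : g ≠ 0) (hv : IsSubmultWeight v)
    (hm : IsTemperedWeight v m C A N) (hH : IsGaborKernel v τ σ g H)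
    {f : 𝓢'(E, ℂ)} (hf : HasBoundedSTFT γ m f) (h : 𝓢(E, ℂ)) :
    Integrable fun z => stft γ f z * opTau τ σ (tfShift z g) h := by
  obtain ⟨B, hB⟩ := hf
  obtain ⟨s, K, -, hs⟩ := exists_lintegral_inv_weight_opTau_le hg hv hm hH
  refine ⟨(continuous_stft_mul_opTau τ σ g γ f h).aestronglyMeasurable, ?_⟩
  refine (lintegral_mono fun z => hm.enorm_stft_mul_le (hB z) _).trans_lt ?_
  rw [lintegral_const_mul' _ _ ENNReal.coe_ne_top]
  exact ENNReal.mul_lt_top ENNReal.coe_lt_top ((hs h).trans_lt ENNReal.ofReal_lt_top)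

/-- The synthesis integral really is a tempered distribution in h: it is linear and bounded by a
Schwartz seminorm of V_g(conj h), which depends continuously on h. Hence the default value 0 in the
definition does not occur here. -/
theorem opTauExt_apply (hg : g ≠ 0) (hv : IsSubmultWeight v)
    (hm : IsTemperedWeight v m C A N) (hH : IsGaborKernel v τ σ g H)
    {f : 𝓢'(E, ℂ)} (hf : HasBoundedSTFT γ m f) (h : 𝓢(E, ℂ)) :
    opTauExt τ σ g γ f h = opTauIntegral τ σ g γ f h := by
  have hi := integrable_stft_mul_opTau hg hv hm hH hf
  have hex : ∃ Φ : 𝓢'(E, ℂ), ∀ k, Φ k = opTauIntegral τ σ g γ f k := by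
    obtain ⟨B, hB⟩ := hf
    obtain ⟨s, K, hK, hs⟩ := exists_lintegral_inv_weight_opTau_le hg hv hm hH
    let L : 𝓢(E, ℂ) →ₗ[ℂ] ℂ :=
      { toFun := opTauIntegral τ σ g γ f
        map_add' := fun a b => by
          simp only [opTauIntegral, map_add, mul_add]
          rw [integral_add (hi a) (hi b), mul_add]
        map_smul' := fun c a => by
          simp only [opTauIntegral, map_smul, smul_eq_mul, RingHom.id_apply, mul_left_comm _ c]
          rw [integral_const_mul]
          ring }
    have hbound : ∀ k, ‖L k‖ ≤ ‖(pair g γ)⁻¹‖ * (B *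
        (K * (s.sup (schwartzSeminormFamily ℝ (Phase E) ℂ)) (stftS g (conjS k)))) := by
      intro k
      change ‖(pair g γ)⁻¹ * _‖ ≤ _
      rw [norm_mul]
      gcongr
      rw [← ENNReal.ofReal_le_ofReal_iff (by positivity), ofReal_norm,
        ENNReal.ofReal_mul NNReal.zero_le_coe, ENNReal.ofReal_coe_nnreal]
      refine (enorm_integral_le_lintegral_enorm _).trans ?_
      refine (lintegral_mono fun z => hm.enorm_stft_mul_le (hB z) _).trans ?_
      rw [lintegral_const_mul' _ _ ENNReal.coe_ne_top]
      gcongr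
      exact hs k
    have hcont : Continuous L := by
      refine continuous_of_continuousAt_zero L ?_
      have hc : Continuous fun k : 𝓢(E, ℂ) => ‖(pair g γ)⁻¹‖ * (B *
          (K * (s.sup (schwartzSeminormFamily ℝ (Phase E) ℂ)) (stftS g (conjS k)))) :=
        continuous_const.mul (continuous_const.mul (continuous_const.mul
          ((continuous_finsetSup_apply s).comp
            ((stftS g).continuous.comp conjS.continuous))))
      rw [ContinuousAt, map_zero]
      refine squeeze_zero_norm hbound ?_
      simpa using hc.tendsto 0
    exact ⟨ContinuousLinearMap.toPointwiseConvergenceCLM ℂ (RingHom.id ℂ) 𝓢(E, ℂ) ℂ ⟨L, hcont⟩,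
      fun k => rfl⟩
  rw [opTauExt, dif_pos hex]
  exact hex.choose_spec h

end Extension

/-! ### Norm bound, agreement on Schwartz functions and weak continuity. -/

section Boundedness

variable {E : Type} [NormedAddCommGroup E] [InnerProductSpace ℝ E]
  [FiniteDimensional ℝ E] [MeasurableSpace E] [BorelSpace E]
  {v m : Phase E → ℝ} {C A : ℝ} {N : ℕ}
  {τ : ℝ} {σ : 𝓢'(Phase E, ℂ)} {g γ : 𝓢(E, ℂ)} {H : Phase E → ℝ≥0∞}

/-- Testing the synthesis integral with π(w)g exhibits V_g(Tf) as the Gabor matrix applied to V_γf,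
so |V_g(Tf)| is dominated by a convolution with H and the weighted Young inequality applies. -/
theorem modNorm_opTauExt_le (hg : g ≠ 0) (hv : IsSubmultWeight v)
    (hm : IsTemperedWeight v m C A N) (hH : IsGaborKernel v τ σ g H)
    {p q : ℝ≥0∞} (hp : 1 ≤ p) (hq : 1 ≤ q) {f : 𝓢'(E, ℂ)} (hf : HasBoundedSTFT γ m f) :
    modNorm g p q m (opTauExt τ σ g γ f) ≤ ENNReal.ofReal C *
      (‖(pair g γ)⁻¹‖ₑ * ∫⁻ z, ENNReal.ofReal (v z) * H z) * modNorm γ p q m f := by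
  have hvm := hv.continuous.measurable
  have hHm := hH.measurable
  rw [modNorm_eq_mixedNorm _ _ _ (fun z => (hm.pos z).le),
    modNorm_eq_mixedNorm _ _ _ (fun z => (hm.pos z).le),
    ← lintegral_const_mul _ (by fun_prop)]
  simp only [mul_left_comm ‖(pair g γ)⁻¹‖ₑ]
  refine mixedNorm_le_of_le_conv hp hq hm.const_nonneg hv.nonneg hvm hm.measurable hm.moderate
    (F := fun z => ‖stft γ f z‖ₑ) (H := fun z => ‖(pair g γ)⁻¹‖ₑ * H z)
    (continuous_stft γ f).measurable.enorm (by fun_prop) fun w => ?_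
  rw [stft, opTauExt_apply hg hv hm hH hf, opTauIntegral, enorm_mul]
  simp only [mul_left_comm _ ‖(pair g γ)⁻¹‖ₑ]
  rw [lintegral_const_mul' _ _ enorm_ne_top]
  gcongr
  refine (enorm_integral_le_lintegral_enorm _).trans (lintegral_mono fun z => ?_)
  dsimp only
  rw [enorm_mul]
  gcongr
  exact hH.bound w z

/-- Apply the continuous functional f ↦ Op_τ(σ)f(h) to the inversion formula for f. -/
theorem opTauExt_coe (hg : g ≠ 0) (hv : IsSubmultWeight v)
    (hm : IsTemperedWeight v m C A N) (hH : IsGaborKernel v τ σ g H) (hγ : pair g γ ≠ 0)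
    {f : 𝓢(E, ℂ)} (hf : HasBoundedSTFT γ m (f : 𝓢'(E, ℂ))) :
    opTauExt τ σ g γ (f : 𝓢'(E, ℂ)) = opTau τ σ f := by
  refine DFunLike.ext _ _ fun h => ?_
  rw [opTauExt_apply hg hv hm hH hf, opTauIntegral]
  have e := stft_inversion γ g f (opTauEval τ σ h)
  simp only [opTauEval_apply, opTau_smul_apply] at e
  simp only [stft_coe_eq_stftS]
  rw [← e, inv_mul_cancel_left₀ hγ]

theorem isOpTauOn_opTauExt (hg : g ≠ 0) (hv : IsSubmultWeight v)
    (hm : IsTemperedWeight v m C A N) (hH : IsGaborKernel v τ σ g H) (hγ : pair g γ ≠ 0)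
    {p q K : ℝ≥0∞} (hK : K ≠ ⊤) (hsup : ∀ (f : 𝓢'(E, ℂ)) (z : Phase E),
      ENNReal.ofReal (m z) * ‖stft γ f z‖ₑ ≤ K * modNorm g p q m f) :
    IsOpTauOn τ σ g p q m (opTauExt τ σ g γ) := by
  have hbdd : ∀ f : 𝓢'(E, ℂ), modNorm g p q m f < ⊤ → HasBoundedSTFT γ m f := by
    intro f hf
    refine ⟨(K * modNorm g p q m f).toNNReal, fun z => ?_⟩
    rw [ENNReal.coe_toNNReal (ENNReal.mul_ne_top hK hf.ne)]
    exact hsup f z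
  have hsum : ∀ f₁ f₂ : 𝓢'(E, ℂ), HasBoundedSTFT γ m f₁ → HasBoundedSTFT γ m f₂ →
      HasBoundedSTFT γ m (f₁ + f₂) := by
    rintro f₁ f₂ ⟨B₁, h₁⟩ ⟨B₂, h₂⟩
    refine ⟨B₁ + B₂, fun z => ?_⟩
    calc _ ≤ ENNReal.ofReal (m z) * (‖stft γ f₁ z‖ₑ + ‖stft γ f₂ z‖ₑ) := by
          gcongr
          exact enorm_add_le _ _
      _ ≤ _ := by
          rw [mul_add, ENNReal.coe_add]
          exact add_le_add (h₁ z) (h₂ z)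
  have hmul : ∀ (a : ℂ) (f : 𝓢'(E, ℂ)), HasBoundedSTFT γ m f → HasBoundedSTFT γ m (a • f) := by
    rintro a f ⟨B, hB⟩
    refine ⟨‖a‖₊ * B, fun z => ?_⟩
    have e : stft γ (a • f) z = a * stft γ f z := rfl
    rw [e, enorm_mul, mul_left_comm, ENNReal.coe_mul]
    exact mul_le_mul_right (hB z) _
  refine ⟨fun f₁ f₂ h₁ h₂ => ?_, fun a f hf => ?_, fun f hf => ?_, fun u f B hu hf huf => ?_⟩
  · refine DFunLike.ext _ _ fun h => ?_
    have e : (opTauExt τ σ g γ f₁ + opTauExt τ σ g γ f₂) h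
      = opTauExt τ σ g γ f₁ h + opTauExt τ σ g γ f₂ h := rfl
    rw [e, opTauExt_apply hg hv hm hH (hbdd _ h₁), opTauExt_apply hg hv hm hH (hbdd _ h₂),
      opTauExt_apply hg hv hm hH (hsum _ _ (hbdd _ h₁) (hbdd _ h₂)), opTauIntegral, opTauIntegral,
      opTauIntegral, ← mul_add, ← integral_add
        (integrable_stft_mul_opTau hg hv hm hH (hbdd _ h₁) h)
        (integrable_stft_mul_opTau hg hv hm hH (hbdd _ h₂) h)]
    congr 2
    funext z
    exact add_mul _ _ _
  · refine DFunLike.ext _ _ fun h => ?_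
    have e : (a • opTauExt τ σ g γ f) h = a * opTauExt τ σ g γ f h := rfl
    rw [e, opTauExt_apply hg hv hm hH (hbdd _ hf),
      opTauExt_apply hg hv hm hH (hmul a _ (hbdd _ hf)), opTauIntegral, opTauIntegral,
      mul_left_comm a, ← integral_const_mul a]
    congr 2
    funext z
    exact mul_assoc _ _ _
  · exact opTauExt_coe hg hv hm hH hγ (hbdd _ hf)
  · refine PointwiseConvergenceCLM.tendsto_iff_forall_tendsto.2 fun h => ?_
    have hub : ∀ n, modNorm g p q m (u n) < ⊤ := fun n => (hu n).trans_lt ENNReal.coe_lt_top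
    simp only [opTauExt_apply hg hv hm hH (hbdd _ hf),
      fun n => opTauExt_apply hg hv hm hH (hbdd _ (hub n)), opTauIntegral]
    refine Tendsto.const_mul _ ?_
    obtain ⟨s, L, -, hs⟩ := exists_lintegral_inv_weight_opTau_le hg hv hm hH
    have hcont := continuous_opTau_tfShift τ σ g h
    have hmm := hm.measurable
    have hmeas : Measurable fun z => (m z)⁻¹ * ‖opTau τ σ (tfShift z g) h‖ :=
      hmm.inv.mul hcont.measurable.norm
    have hi : Integrable fun z => (m z)⁻¹ * ‖opTau τ σ (tfShift z g) h‖ := by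
      refine ⟨hmeas.aestronglyMeasurable, ?_⟩
      refine ((lintegral_congr fun z => ?_).trans_le (hs h)).trans_lt ENNReal.ofReal_lt_top
      rw [enorm_mul, enorm_norm, Real.enorm_of_nonneg (inv_nonneg.2 (hm.pos z).le)]
    -- Weak convergence gives V_γu_n(z) → V_γf(z) for each z. The bound |V_γu_n| ≤ K B / m, uniform
    -- in n, makes the majorant K B |Op_τ(σ)π(z)g(h)| / m(z), which is integrable.
    refine tendsto_integral_of_dominated_convergence
      (fun z => (K.toNNReal * B : ℝ≥0) * ((m z)⁻¹ * ‖opTau τ σ (tfShift z g) h‖))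
      (fun n => (continuous_stft_mul_opTau τ σ g γ (u n) h).aestronglyMeasurable)
      (hi.const_mul _) (fun n => .of_forall fun z => ?_) (.of_forall fun z => ?_)
    · have hz : ENNReal.ofReal (m z) * ‖stft γ (u n) z‖ₑ ≤ (K.toNNReal * B : ℝ≥0) := by
        refine (hsup _ z).trans ?_
        rw [ENNReal.coe_mul, ENNReal.coe_toNNReal hK]
        gcongr
        exact hu n
      have h0 := (hm.pos z).le
      rw [← ENNReal.ofReal_le_ofReal_iff (by positivity), ofReal_norm,
        ENNReal.ofReal_mul NNReal.zero_le_coe, ENNReal.ofReal_coe_nnreal,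
        ENNReal.ofReal_mul (inv_nonneg.2 h0), ofReal_norm]
      exact hm.enorm_stft_mul_le hz _
    · exact (PointwiseConvergenceCLM.tendsto_iff_forall_tendsto.1 huf _).mul_const _

/-- Boundedness of `τ`-pseudodifferential operators on modulation spaces, for submultiplicative
weights. -/
theorem exists_opTau_bounded (hv : IsSubmultWeight v) (hm : IsTemperedWeight v m C A N) (τ : ℝ)
    (hg0 : g ≠ 0) (hg : ∫⁻ z, ENNReal.ofReal (v z) * ‖stftS g g z‖ₑ < ⊤)
    {G : 𝓢(Phase E, ℂ)} (hG : G ≠ 0) :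
    ∃ K : ℝ≥0∞, K ≠ ⊤ ∧ ∀ p q : ℝ≥0∞, 1 ≤ p → 1 ≤ q → ∀ σ : 𝓢'(Phase E, ℂ),
      modNorm G ⊤ 1 (fun Z => v (sympInv Z.snd)) σ < ⊤ →
      ∃ T : 𝓢'(E, ℂ) → 𝓢'(E, ℂ), IsOpTauOn τ σ g p q m T ∧
        ∀ f : 𝓢'(E, ℂ), modNorm g p q m f < ⊤ → modNorm g p q m (T f) ≤
          K * modNorm G ⊤ 1 (fun Z => v (sympInv Z.snd)) σ * modNorm g p q m f := by
  obtain ⟨δ, γ, hγ0, hγ⟩ := exists_averaged_window hg0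
  obtain ⟨K₁, hK₁, h₁⟩ := exists_mixedNorm_stft_le hv hm hγ
  obtain ⟨K₂, hK₂, h₂⟩ := exists_kernel_bound hv τ hg0 hg hG
  refine ⟨ENNReal.ofReal C * (‖(pair g γ)⁻¹‖ₑ * K₂) * K₁,
    ENNReal.mul_ne_top (ENNReal.mul_ne_top ENNReal.ofReal_ne_top
      (ENNReal.mul_ne_top enorm_ne_top hK₂)) hK₁, fun p q hp hq σ hσ => ?_⟩
  obtain ⟨H, hHm, hH, hvH⟩ := h₂ σ
  have hker : IsGaborKernel v τ σ g H :=
    ⟨hHm, hH, (hvH.trans_lt (ENNReal.mul_lt_top hK₂.lt_top hσ)).ne⟩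
  -- This constant depends on p and q but only guarantees that the synthesis integral converges; the
  -- norm estimate is built from K₁ and K₂, which were fixed before p and q.
  obtain ⟨K, hK, hsup⟩ := exists_sup_le_modNorm hv hm hγ hp hq
  refine ⟨opTauExt τ σ g γ, isOpTauOn_opTauExt hg0 hv hm hker hγ0 hK hsup, fun f hf => ?_⟩
  have hfb : HasBoundedSTFT γ m f := by
    refine ⟨(K * modNorm g p q m f).toNNReal, fun z => ?_⟩
    rw [ENNReal.coe_toNNReal (ENNReal.mul_ne_top hK hf.ne)]
    exact hsup f z
  calc modNorm g p q m (opTauExt τ σ g γ f)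
      ≤ ENNReal.ofReal C * (‖(pair g γ)⁻¹‖ₑ * ∫⁻ z, ENNReal.ofReal (v z) * H z)
          * modNorm γ p q m f := modNorm_opTauExt_le hg0 hv hm hker hp hq hfb
    _ ≤ ENNReal.ofReal C * (‖(pair g γ)⁻¹‖ₑ *
          (K₂ * modNorm G ⊤ 1 (fun Z => v (sympInv Z.snd)) σ)) * (K₁ * modNorm g p q m f) := by
        gcongr
        exact h₁ p q hp hq f
    _ = _ := by ring

end Boundedness

/-! ### Specialisation to the weights and windows of the statement. -/

section Euclidean

variable {d : ℕ} {v m : Phase (EuclideanSpace ℝ (Fin d)) → ℝ}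

theorem IsAdmissibleWeight.isSubmultWeight (hv : IsAdmissibleWeight v) : IsSubmultWeight v where
  continuous := hv.continuous
  nonneg := hv.nonneg
  even z := hv.even _ _ (fun i => by simp) (fun i => by simp)
  submult := hv.submultiplicative

/-- Both alternatives for the lower bound enter only through polynomial growth of 1/m, with exponent
0 when m ≥ 1. -/
theorem IsModerateWeight.exists_isTemperedWeight (hm : IsModerateWeight v m)
    (hM : HasTemperedLowerBound m) : ∃ (C A : ℝ) (N : ℕ), IsTemperedWeight v m C A N := by
  obtain ⟨C, hC, hmod⟩ := hm.moderate
  rcases hM with h1 | ⟨N, c, hc, h⟩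
  · refine ⟨C, 1, 0, hm.measurable, hm.pos, hC, hmod, fun z => ?_⟩
    simpa using inv_le_one_of_one_le₀ (h1 z)
  · refine ⟨C, c⁻¹, N, hm.measurable, hm.pos, hC, hmod, fun z => ?_⟩
    have hs : 0 < Real.sqrt (1 + ‖z‖ ^ 2) := Real.sqrt_pos.2 (by positivity)
    have hle : Real.sqrt (1 + ‖z‖ ^ 2) ≤ 1 + ‖z‖ :=
      Real.sqrt_le_iff.2 ⟨by positivity, by nlinarith [norm_nonneg z]⟩
    calc (m z)⁻¹ ≤ (c * Real.sqrt (1 + ‖z‖ ^ 2) ^ (-(N : ℤ)))⁻¹ :=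
          inv_anti₀ (by positivity) (h z)
      _ = c⁻¹ * Real.sqrt (1 + ‖z‖ ^ 2) ^ N := by
          rw [mul_inv, zpow_neg, inv_inv, zpow_natCast]
      _ ≤ _ := by gcongr

theorem IsWindow.lintegral_lt_top {g : 𝓢(EuclideanSpace ℝ (Fin d), ℂ)}
    (hv : IsAdmissibleWeight v) (hg : IsWindow v g) :
    ∫⁻ z, ENNReal.ofReal (v z) * ‖stftS g g z‖ₑ < ⊤ := by
  have h := hg.2
  have hvm := hv.continuous.measurable
  have hSm : Measurable fun z => ‖stftS g g z‖ₑ := (stftS g g).continuous.measurable.enorm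
  rw [modNorm_eq_mixedNorm _ _ _ hv.nonneg] at h
  simp only [stft_coe_eq_stftS] at h
  rwa [mixedNorm_one_one (by fun_prop)] at h

end Euclidean

end TauPsiDO

theorem mainTheorem4 {d : ℕ}
    (v : TauPsiDO.Phase (EuclideanSpace ℝ (Fin d)) → ℝ) (hv : TauPsiDO.IsAdmissibleWeight v)
    (m : TauPsiDO.Phase (EuclideanSpace ℝ (Fin d)) → ℝ) (hm : TauPsiDO.IsModerateWeight v m)
    (hM : TauPsiDO.HasTemperedLowerBound m)
    (τ : ℝ) (hτ : τ ∈ Set.Icc (0 : ℝ) 1)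
    (g : 𝓢(EuclideanSpace ℝ (Fin d), ℂ)) (hg : TauPsiDO.IsWindow v g)
    (G : 𝓢(TauPsiDO.Phase (EuclideanSpace ℝ (Fin d)), ℂ)) (hG : G ≠ 0) :
    ∃ C : ℝ, 0 < C ∧
      ∀ p q : ℝ≥0∞, 1 ≤ p → 1 ≤ q →
      ∀ σ : 𝓢'(TauPsiDO.Phase (EuclideanSpace ℝ (Fin d)), ℂ),
        TauPsiDO.modNorm G ⊤ 1 (TauPsiDO.symbolWeight v) σ < ⊤ →
        ∃ T : 𝓢'(EuclideanSpace ℝ (Fin d), ℂ) → 𝓢'(EuclideanSpace ℝ (Fin d), ℂ),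
          TauPsiDO.IsOpTauOn τ σ g p q m T ∧
          ∀ f : 𝓢'(EuclideanSpace ℝ (Fin d), ℂ), TauPsiDO.modNorm g p q m f < ⊤ →
            TauPsiDO.modNorm g p q m (T f) ≤
              ENNReal.ofReal C * TauPsiDO.modNorm G ⊤ 1 (TauPsiDO.symbolWeight v) σ *
                TauPsiDO.modNorm g p q m f := by
  obtain ⟨C, A, N, hw⟩ := hm.exists_isTemperedWeight hM
  obtain ⟨K, hK, h⟩ := TauPsiDO.exists_opTau_bounded hv.isSubmultWeight hw τ hg.1
    (hg.lintegral_lt_top hv) hG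
  -- Adding 1 makes the real constant strictly positive whatever the value of K.
  refine ⟨K.toReal + 1, by positivity, fun p q hp hq σ hσ => ?_⟩
  -- `symbolWeight v` unfolds definitionally to the weight `fun Z => v (sympInv Z.snd)` used above.
  obtain ⟨T, hT, hb⟩ := h p q hp hq σ hσ
  refine ⟨T, hT, fun f hf => (hb f hf).trans ?_⟩
  have hKle : K ≤ ENNReal.ofReal (K.toReal + 1) := by
    rw [← ENNReal.ofReal_toReal hK]
    exact ENNReal.ofReal_le_ofReal (by simp [ENNReal.toReal_ofReal])
  have := mul_le_mul_left (mul_le_mul_left hKle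
    (TauPsiDO.modNorm G ⊤ 1 (TauPsiDO.symbolWeight v) σ)) (TauPsiDO.modNorm g p q m f)
  exact this
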